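/- Let $\mathbb T=\mathbb R/2\pi\mathbb Z$ and let $(x,y,z)$ be the coordinates on $\mathbb T\times\mathbb R\times\mathbb T$. For a function $f$ on $\mathbb T\times\mathbb R\times\mathbb T$ write $$f_0(y,z)=\frac1{2\pi}\int_{\mathbb T}f(x,y,z)\,dx,\qquad f_{\neq}=f-f_0 .$$ Consider the linearization of the isentropic compressible Navier–Stokes equations around the constant density $1$ and the Couette flow $(y,0,0)^\top$, for the real-valued unknowns $b$ and $u=(u^1,u^2,u^3)^\top$: $$\begin{cases}\partial_t b+y\partial_x b+\operatorname{div}u=0,\\[1mm] \partial_t u+y\partial_x u+(u^2,0,0)^\top+\dfrac{\nabla b}{\varepsilon^2}-\mu\Delta u-(\lambda+\mu)\nabla\operatorname{div}u=0,\end{cases}\qquad (b,u)|_{t=0}=(b_{\rm in},u_{\rm in}).$$ **Theorem.** For every Mach number $\varepsilon>0$ there is a constant $C_1>0$, depending only on $\varepsilon$ (in particular not on $\lambda$ or $\mu$), such that the following holds. Let $\mu,\lambda\in\mathbb R$ satisfy $$\mu>0,\quad 2\mu+3\lambda\ge0,\quad \lambda+2\mu\le1,\quad \mu^{1/3}\varepsilon\le\tfrac14,\quad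 \mu^{1/3}(\lambda+2\mu)\varepsilon^2\le1,$$ let $(b_{\rm in},u_{\rm in})\in H^2(\mathbb T\times\mathbb R\times\mathbb T)$, and let $(b,u)\in C([0,\infty);L^2(\mathbb T\times\mathbb R\times\mathbb T))$ be the (distributional) solution of the system with initial data $(b_{\rm in},u_{\rm in})$. Then for all $t\ge0$ $$\|b_{\neq}(t)\|_{L^2}\le C_1\mu^{-\frac16}e^{-\frac{\mu^{1/3}t}{44}}\,\|((\Delta b_{\rm in})_{\neq},(\Delta u_{\rm in})_{\neq})\|_{L^2},$$ $$\|u^1_{\neq}(t)\|_{L^2}\le C_1e^{-\frac{\mu^{1/3}t}{88}}\,\|((\Delta b_{\rm in})_{\neq},(\Delta u_{\rm in})_{\neq})\|_{L^2},$$ $$\|u^2_{\neq}(t)\|_{L^2}\le C_1\mu^{-\frac13}e^{-\frac{\mu^{1/3}t}{88}}\,\|((\Delta b_{\rm in})_{\neq},(\Delta u_{\rm in})_{\neq})\|_{L^2},$$ $$\|u^3_{\neq}(t)\|_{L^2}\le C_1e^{-\frac{\mu^{1/3}t}{44}}\,\|((\Delta b_{\rm in})_{\neq},(\Delta u_{\rm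 in})_{\neq})\|_{L^2}.$$ -/

import Mathlib

open MeasureTheory Set

open scoped ENNReal ContDiff

noncomputable section

namespace Couette

instance factTwoPiPos : Fact (0 < 2 * Real.pi) := ⟨Real.two_pi_pos⟩

/-- The torus `𝕋 = ℝ / 2πℤ`, with its measure of total mass `2π`. -/
abbrev Torus : Type := AddCircle (2 * Real.pi)

/-- The domain `𝕋 × ℝ × 𝕋`, with coordinates `p = (x, y, z)`, `p.1 = x`, `p.2.1 = y`,
`p.2.2 = z`, and the product measure `volume = dx dy dz`. -/
abbrev Dom : Type := Torus × ℝ × Torus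

/-- The space `L²(𝕋 × ℝ × 𝕋)` of real-valued functions. -/
abbrev L2 : Type := Lp ℝ 2 (volume : Measure Dom)

/-- The point `s eᵢ` of the group `𝕋 × ℝ × 𝕋`; the indices `0, 1, 2` are the directions
`x, y, z`. -/
def axis (i : Fin 3) (s : ℝ) : Dom :=
  (((if i = 0 then s else 0 : ℝ) : Torus), (if i = 1 then s else 0),
    ((if i = 2 then s else 0 : ℝ) : Torus))

/-- The classical partial derivative `∂ᵢ φ`. -/
def pd (i : Fin 3) (φ : Dom → ℝ) (p : Dom) : ℝ :=
  deriv (fun s : ℝ => φ (p + axis i s)) 0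

/-- The classical Laplacian `Δ φ`. -/
def lap (φ : Dom → ℝ) (p : Dom) : ℝ := ∑ i : Fin 3, pd i (pd i φ) p

/-- Test functions `φ ∈ C_c^∞(𝕋 × ℝ × 𝕋)`; smoothness is that of the periodic lift to `ℝ³`. -/
def IsTest (φ : Dom → ℝ) : Prop :=
  ContDiff ℝ ∞ (fun q : ℝ × ℝ × ℝ => φ ((q.1 : Torus), q.2.1, (q.2.2 : Torus))) ∧
    HasCompactSupport φ

/-- `g ∈ L²` is the weak partial derivative `∂ᵢ f`. -/
def IsWeakPartial (i : Fin 3) (f g : Dom → ℝ) : Prop :=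
  MemLp g 2 volume ∧ ∀ φ : Dom → ℝ, IsTest φ → ∫ p, f p * pd i φ p = -∫ p, g p * φ p

open Classical in
/-- The weak partial derivative `∂ᵢ f` (unique up to null sets), if `f` has one in `L²`;
the value `0` is never used otherwise. -/
def weakPartial (i : Fin 3) (f : Dom → ℝ) : Dom → ℝ :=
  if h : ∃ g, IsWeakPartial i f g then h.choose else 0

/-- The Sobolev space `H²(𝕋 × ℝ × 𝕋)`: `f` and its weak derivatives of order at most two
are in `L²`. -/
def MemH2 (f : Dom → ℝ) : Prop :=
  MemLp f 2 volume ∧ ∀ i : Fin 3, (∃ g, IsWeakPartial i f g) ∧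
    ∀ j : Fin 3, ∃ h, IsWeakPartial j (weakPartial i f) h

/-- The Laplacian `Δ f` of `f ∈ H²`. -/
def weakLaplacian (f : Dom → ℝ) (p : Dom) : ℝ :=
  ∑ i : Fin 3, weakPartial i (weakPartial i f) p

/-- The average in `x`, `f₀(y, z) = (2π)⁻¹ ∫_𝕋 f(x, y, z) dx`. -/
def xAverage (f : Dom → ℝ) (p : Dom) : ℝ :=
  (2 * Real.pi)⁻¹ * ∫ x : Torus, f (x, p.2)

/-- The projection onto the non-zero frequencies in `x`, `f_≠ = f - f₀`. -/
def nonzeroMode (f : Dom → ℝ) (p : Dom) : ℝ := f p - xAverage f p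

/-- The norm `‖f‖_{L²}`. -/
def l2norm (f : Dom → ℝ) : ℝ≥0∞ := eLpNorm f 2 volume

/-- The norm `‖((Δ b)_≠, (Δ u)_≠)‖_{L²}` of the data. -/
def dataNorm (b : Dom → ℝ) (u : Fin 3 → Dom → ℝ) : ℝ≥0∞ :=
  (l2norm (nonzeroMode (weakLaplacian b)) ^ 2 +
    ∑ i : Fin 3, l2norm (nonzeroMode (weakLaplacian (u i))) ^ 2) ^ (1 / 2 : ℝ)

/-- `(b, u) ∈ C([0, ∞); L²)` is the (weak) solution, with initial data `(bin, uin)`, of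

* `∂ₜ b + y ∂ₓ b + div u = 0`,
* `∂ₜ u + y ∂ₓ u + (u², 0, 0) + ε⁻² ∇ b - μ Δ u - (lam + μ) ∇ div u = 0`.

All spatial derivatives are moved to the test function. The components `u¹, u², u³` are
`u t 0, u t 1, u t 2`. -/
structure IsSolution (ε μ lam : ℝ) (bin : Dom → ℝ) (uin : Fin 3 → Dom → ℝ)
    (b : ℝ → L2) (u : ℝ → Fin 3 → L2) : Prop where
  continuousOn_b : ContinuousOn b (Ici 0)
  continuousOn_u : ∀ i, ContinuousOn (fun t => u t i) (Ici 0)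
  initial_b : (b 0 : Dom → ℝ) =ᵐ[volume] bin
  initial_u : ∀ i, (u 0 i : Dom → ℝ) =ᵐ[volume] uin i
  mass : ∀ φ : Dom → ℝ, IsTest φ → ∀ t : ℝ, 0 ≤ t →
    HasDerivWithinAt (fun s : ℝ => ∫ p, b s p * φ p)
      ((∫ p, b t p * (p.2.1 * pd 0 φ p)) + ∑ j : Fin 3, ∫ p, u t j p * pd j φ p)
      (Ici 0) t
  momentum : ∀ φ : Dom → ℝ, IsTest φ → ∀ i : Fin 3, ∀ t : ℝ, 0 ≤ t →
    HasDerivWithinAt (fun s : ℝ => ∫ p, u s i p * φ p)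
      ((∫ p, u t i p * (p.2.1 * pd 0 φ p))
        - (if i = 0 then ∫ p, u t 1 p * φ p else 0)
        + (1 / ε ^ 2) * (∫ p, b t p * pd i φ p)
        + μ * (∫ p, u t i p * lap φ p)
        + (lam + μ) * ∑ j : Fin 3, ∫ p, u t j p * pd j (pd i φ) p)
      (Ici 0) t

end Couette

end

/-!
The Couette flow shears every wave without mixing frequencies. In the coordinates which move with
the flow, a Fourier coefficient with wave numbers `k ≠ 0` in `x`, `l` in `z` and frequency `η` in
`y` has the wave vector `(k, η - k t, l)` at time `t`, and the symbol of `-Δ` becomes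
`p = k² + (η - k t)² + l²`. The equations turn into an ordinary differential system for each
`(k, η, l)`, and that system is real in the unknowns `b̂` and `i û` (`IsMode`). The theorem is a
bound for its solutions that is uniform in the frequency (`exists_mode_le`), summed by Parseval's
identity.

Write `ρ = μ^{1/3}` and `κ² = k² + l²`. Let `D` be the divergence and `d = D / p`.

* The acoustic waves `(B, d)` oscillate with the slowly varying frequency `p^{1/2} / ε`. Their
  energy `B² / ε² + p d²` changes at the mean rate `p' / (2 p)`. A correction `(bw - ρ) B d` with
  `bw ≈ p' / (2 p)` removes the oscillation from this rate, and makes the dissipation of `d` alone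
  damp `B` as well.
* The acoustic waves are coupled to the rest of the velocity only through the good unknown
  `w = (η - k t) D - p V₂ - k B`, whose equation is `w' = -μ p (w + k B)`. The corrected energy is
  combined with `w²`, with weights that are powers of `g = (p / κ²)^{1/8}`; the powers differ before
  and after the critical time `η / k`, at which `p` is minimal. The remaining errors have the
  coefficient `fw`, whose antiderivative `Fw` is bounded uniformly in all parameters. It contains
  the amount `nw` by which the dissipation `μ p` may fall short of `ρ` near the critical time.
  Grönwall's inequality gives the decay of the energy, up to a growth like `p^{1/2}`
  (`exists_ener_le`), and then that of `w` (`exists_wvar_le`).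
* The vertical vorticity `k V₃ - l V₁` is forced by an oscillating term, which a multiple of `B`
  integrates by parts in time. What is left has integrable coefficients, so that the corrected
  vorticity decays without growth (`exists_zvar_le`).
* The velocity is a combination of `d`, `w`, `B` and the vorticity. The squares of `V₁` and `V₃`
  decay like `e^{-3ρt/10}`; those of `B` and `V₂` have an additional growth `1 + t`, which the
  exponential absorbs at the cost of a factor `1 / ρ`. Since `4 μ / 3 ≤ lam + 2 μ ≤ 1` gives
  `ρ ≤ 1`, these bounds are stronger than those of the theorem.

A distributional solution is reduced to these ordinary differential equations as follows. Testing
with `e^{-i(kx + lz)}` times functions of `y` gives equations between distributions on the line for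
the coefficients `lineCoef`, which a modulation by `e^{ikty}` moves into the frame of the flow. A
relation `F₀ + F₁' + F₂'' = 0` of this kind, with `Fᵢ` in `L²`, is an algebraic relation between
Fourier transforms (`fourier_add_eq_zero`). Hence on a band of bounded frequencies the Fourier
transform of the solution solves a linear equation in `L²` whose coefficients are bounded
multiplication operators. Such an equation has a unique solution, and the propagator of the system
with coefficients in the algebra of bounded functions provides one which solves the ordinary
differential equations pointwise (`exists_pointwise_solution`, `exists_solution_frequency`).
The weights of the data match `Δ` because the Fourier transform of the weak Laplacian of an `H²`
function is the symbol times that of the function (`MemH2.fourier_weakLaplacian`).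
-/

noncomputable section

namespace Couette

/-! ### Grönwall estimates with exponential decay -/

/-- Grönwall's inequality: `Q' ≤ -c Q` gives decay at rate `c`. The sign of `Q` is arbitrary. -/
theorem le_of_hasDerivAt_le {c t₀ t : ℝ} {Q Q' : ℝ → ℝ} (ht : t₀ ≤ t)
    (hQ : ∀ s ∈ Icc t₀ t, HasDerivAt Q (Q' s) s) (hle : ∀ s ∈ Icc t₀ t, Q' s ≤ -c * Q s) :
    Q t ≤ Real.exp (-c * (t - t₀)) * Q t₀ := by
  have hE : ∀ s ∈ Icc t₀ t, HasDerivAt (fun s => Real.exp (c * (s - t₀)) * Q s)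
      (Real.exp (c * (s - t₀)) * (c * Q s + Q' s)) s := by
    intro s hs
    have h1 : HasDerivAt (fun s => Real.exp (c * (s - t₀))) (Real.exp (c * (s - t₀)) * (c * 1)) s :=
      (((hasDerivAt_id s).sub_const t₀).const_mul c).exp
    exact (h1.mul (hQ s hs)).congr_deriv (by ring)
  have hanti : AntitoneOn (fun s => Real.exp (c * (s - t₀)) * Q s) (Icc t₀ t) := by
    apply antitoneOn_of_deriv_nonpos (convex_Icc t₀ t)
    · exact fun s hs => (hE s hs).continuousAt.continuousWithinAt
    · intro s hs
      rw [interior_Icc] at hs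
      exact (hE s (Ioo_subset_Icc_self hs)).differentiableAt.differentiableWithinAt
    · intro s hs
      rw [interior_Icc] at hs
      rw [(hE s (Ioo_subset_Icc_self hs)).deriv]
      have := hle s (Ioo_subset_Icc_self hs)
      exact mul_nonpos_of_nonneg_of_nonpos (Real.exp_pos _).le (by linarith)
  have h2 := hanti (left_mem_Icc.2 ht) (right_mem_Icc.2 ht) ht
  simp only [sub_self, mul_zero, Real.exp_zero, one_mul] at h2
  have h3 : Real.exp (-c * (t - t₀)) * Real.exp (c * (t - t₀)) = 1 := by
    rw [← Real.exp_add]; simp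
  calc Q t = Real.exp (-c * (t - t₀)) * (Real.exp (c * (t - t₀)) * Q t) := by
        rw [← mul_assoc, h3, one_mul]
    _ ≤ _ := mul_le_mul_of_nonneg_left h2 (Real.exp_pos _).le

/-- If `X` decays at rate `q₁ ρ`, up to a multiplicative error `f` whose antiderivative `F` stays
bounded and a source of size `A (ρ + f) e^{-qρt}` with `q < q₁`, then `X` decays like `e^{-qρt}`,
with a constant independent of `ρ`. -/
theorem exp_decay_of_hasDerivAt_le {X X' F f : ℝ → ℝ} {ρ q q₁ A M t₀ t : ℝ} (hρ : 0 < ρ)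
    (hq : q < q₁) (hA : 0 ≤ A) (ht : t₀ ≤ t)
    (hX : ∀ s ∈ Icc t₀ t, HasDerivAt X (X' s) s)
    (hF : ∀ s ∈ Icc t₀ t, HasDerivAt F (f s) s)
    (hf : ∀ s ∈ Icc t₀ t, 0 ≤ f s) (hM : ∀ s ∈ Icc t₀ t, |F s| ≤ M)
    (hX0 : 0 ≤ X t₀)
    (hle : ∀ s ∈ Icc t₀ t, X' s ≤ (-(q₁ * ρ) + f s) * X s
      + A * (ρ + f s) * Real.exp (-(q * ρ * s))) :
    X t ≤ Real.exp (2 * M) * (Real.exp (q * ρ * t₀) * X t₀ + A * (3 * M + 1 / (q₁ - q)))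
      * Real.exp (-(q * ρ * t)) := by
  set δ := q₁ - q with hδ
  have hδ0 : 0 < δ := sub_pos.2 hq
  set G := Real.exp M with hG
  have hM0 : 0 ≤ M := (abs_nonneg _).trans (hM t₀ (left_mem_Icc.2 ht))
  have hG1 : 0 < G := Real.exp_pos M
  have hEF : ∀ s ∈ Icc t₀ t, Real.exp (-F s) ≤ G ∧ Real.exp (F s) ≤ G := by
    intro s hs
    have := abs_le.1 (hM s hs)
    exact ⟨Real.exp_le_exp.2 (by linarith), Real.exp_le_exp.2 (by linarith)⟩
  set c := A * G * (1 + δ * M) / δ with hc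
  have hcδ : δ * c = A * G * (1 + δ * M) := by rw [hc]; field_simp
  -- `Q = e^{-F} e^{qρt} X - A G F - c` satisfies `Q' ≤ -δρ Q`.
  let Q : ℝ → ℝ := fun s => Real.exp (-F s) * (Real.exp (q * ρ * s) * X s) - A * G * F s - c
  have hQ : ∀ s ∈ Icc t₀ t, HasDerivAt Q
      (Real.exp (-F s) * Real.exp (q * ρ * s) * (-f s * X s + q * ρ * X s + X' s)
        - A * G * f s) s := by
    intro s hs
    have h1 : HasDerivAt (fun s => Real.exp (-F s)) (Real.exp (-F s) * (-f s)) s :=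
      ((hF s hs).neg).exp
    have h2 : HasDerivAt (fun s => Real.exp (q * ρ * s)) (Real.exp (q * ρ * s) * (q * ρ * 1)) s :=
      ((hasDerivAt_id s).const_mul (q * ρ)).exp
    refine (((h1.mul (h2.mul (hX s hs))).sub
      ((hF s hs).const_mul (A * G))).sub_const c).congr_deriv ?_
    simp only [Pi.mul_apply]
    ring
  have hQle : ∀ s ∈ Icc t₀ t, Real.exp (-F s) * Real.exp (q * ρ * s) *
      (-f s * X s + q * ρ * X s + X' s) - A * G * f s ≤ -(δ * ρ) * Q s := by
    intro s hs
    have h1 := hle s hs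
    have hee : Real.exp (q * ρ * s) * Real.exp (-(q * ρ * s)) = 1 := by
      rw [← Real.exp_add]; simp
    have h2 : Real.exp (-F s) * Real.exp (q * ρ * s) * (-f s * X s + q * ρ * X s + X' s)
        ≤ Real.exp (-F s) * Real.exp (q * ρ * s) * (-(δ * ρ) * X s
          + A * (ρ + f s) * Real.exp (-(q * ρ * s))) := by
      apply mul_le_mul_of_nonneg_left _ (by positivity)
      rw [hδ]; linarith
    have h3 : Real.exp (-F s) * Real.exp (q * ρ * s) * (-(δ * ρ) * X s
          + A * (ρ + f s) * Real.exp (-(q * ρ * s)))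
        = -(δ * ρ) * (Real.exp (-F s) * (Real.exp (q * ρ * s) * X s))
          + A * (ρ + f s) * Real.exp (-F s) := by
      linear_combination A * (ρ + f s) * Real.exp (-F s) * hee
    have h4 : A * (ρ + f s) * Real.exp (-F s) ≤ A * (ρ + f s) * G := by
      apply mul_le_mul_of_nonneg_left (hEF s hs).1
      have := hf s hs
      positivity
    have h5 : -M ≤ F s := (abs_le.1 (hM s hs)).1
    have h6 : δ * ρ * (A * G) * (-M) ≤ δ * ρ * (A * G) * F s :=
      mul_le_mul_of_nonneg_left h5 (by positivity)
    simp only [Q]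
    have h7 : δ * ρ * c = ρ * (A * G * (1 + δ * M)) := by rw [← hcδ]; ring
    linarith
  have h1 := le_of_hasDerivAt_le ht hQ hQle
  have hc0 : 0 ≤ c := by positivity
  have hX0' : 0 ≤ Real.exp (q * ρ * t₀) * X t₀ := by positivity
  have h2 : Q t₀ ≤ G * (Real.exp (q * ρ * t₀) * X t₀) + A * G * M := by
    have ha := mul_le_mul_of_nonneg_right (hEF t₀ (left_mem_Icc.2 ht)).1 hX0'
    have hb : -M ≤ F t₀ := (abs_le.1 (hM t₀ (left_mem_Icc.2 ht))).1
    have hc' : A * G * (-M) ≤ A * G * F t₀ := mul_le_mul_of_nonneg_left hb (by positivity)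
    simp only [Q]; linarith
  have h3 : Q t ≤ G * (Real.exp (q * ρ * t₀) * X t₀) + A * G * M := by
    have he1 : Real.exp (-(δ * ρ) * (t - t₀)) ≤ 1 := by
      rw [Real.exp_le_one_iff]
      have : 0 ≤ δ * ρ * (t - t₀) := by
        have := sub_nonneg.2 ht
        positivity
      linarith
    refine h1.trans ?_
    refine (mul_le_mul_of_nonneg_left h2 (Real.exp_pos _).le).trans ?_
    exact mul_le_of_le_one_left (by positivity) he1
  have h4 : Real.exp (-F t) * (Real.exp (q * ρ * t) * X t)
      ≤ G * (Real.exp (q * ρ * t₀) * X t₀ + A * (3 * M + 1 / δ)) := by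
    have hb : F t ≤ M := (abs_le.1 (hM t (right_mem_Icc.2 ht))).2
    have hc' : A * G * F t ≤ A * G * M := mul_le_mul_of_nonneg_left hb (by positivity)
    have hcc : c = A * G * (1 / δ) + A * G * M := by rw [hc]; field_simp
    simp only [Q] at h3
    linarith
  have hR : 0 ≤ G * (Real.exp (q * ρ * t₀) * X t₀ + A * (3 * M + 1 / δ)) := by positivity
  have h5 : Real.exp (q * ρ * t) * X t
      ≤ G * (G * (Real.exp (q * ρ * t₀) * X t₀ + A * (3 * M + 1 / δ))) := by
    have : Real.exp (q * ρ * t) * X t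
        = Real.exp (F t) * (Real.exp (-F t) * (Real.exp (q * ρ * t) * X t)) := by
      rw [← mul_assoc, ← Real.exp_add]; simp
    rw [this]
    exact (mul_le_mul_of_nonneg_left h4 (Real.exp_pos _).le).trans
      (mul_le_mul_of_nonneg_right (hEF t (right_mem_Icc.2 ht)).2 hR)
  have h6 : X t = Real.exp (q * ρ * t) * X t * Real.exp (-(q * ρ * t)) := by
    rw [mul_right_comm, ← Real.exp_add]; simp
  have h7 : Real.exp (2 * M) = G * G := by rw [hG, ← Real.exp_add]; ring_nf
  rw [h6, h7, mul_assoc G G]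
  exact mul_le_mul_of_nonneg_right h5 (Real.exp_pos _).le

/-! ### The weights -/

/-- The antiderivative of `(1 + x²)^{-5/8}` that vanishes at `0`. It is bounded because
`5/4 > 1`, so that error terms of this size can be absorbed by a bounded weight. -/
def ghost (x : ℝ) : ℝ := ∫ y in (0 : ℝ)..x, (1 + y ^ 2) ^ (-(5 / 8) : ℝ)

theorem continuous_ghost_integrand : Continuous fun y : ℝ => (1 + y ^ 2) ^ (-(5 / 8) : ℝ) := by
  apply Continuous.rpow_const (by fun_prop)
  intro y; left; positivity

theorem hasDerivAt_ghost (x : ℝ) : HasDerivAt ghost ((1 + x ^ 2) ^ (-(5 / 8) : ℝ)) x :=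
  intervalIntegral.integral_hasDerivAt_right
    (continuous_ghost_integrand.intervalIntegrable _ _)
    (continuous_ghost_integrand.stronglyMeasurableAtFilter _ _)
    continuous_ghost_integrand.continuousAt

theorem exists_abs_ghost_le : ∃ M : ℝ, 0 ≤ M ∧ ∀ x, |ghost x| ≤ M := by
  have hint : Integrable (fun y : ℝ => (1 + y ^ 2) ^ (-(5 / 8) : ℝ)) := by
    have := integrable_rpow_neg_one_add_norm_sq (E := ℝ) (μ := volume) (r := 5 / 4) (by norm_num)
    convert this using 2 with y
    rw [Real.norm_eq_abs, sq_abs]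
    norm_num
  refine ⟨∫ y : ℝ, (1 + y ^ 2) ^ (-(5 / 8) : ℝ), integral_nonneg fun y => by positivity, ?_⟩
  intro x
  rw [ghost, ← Real.norm_eq_abs]
  refine (intervalIntegral.norm_integral_le_integral_norm_uIoc).trans ?_
  have : ∀ y : ℝ, ‖(1 + y ^ 2) ^ (-(5 / 8) : ℝ)‖ = (1 + y ^ 2) ^ (-(5 / 8) : ℝ) := fun y =>
    Real.norm_of_nonneg (by positivity)
  simp only [this]
  exact setIntegral_le_integral hint (Filter.Eventually.of_forall fun y => by positivity)

/-! ### The pointwise energy inequality -/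

theorem mul_le_mul_of_abs_le {x y X Y : ℝ} (hx : |x| ≤ X) (hy : |y| ≤ Y) : x * y ≤ X * Y :=
  (le_abs_self _).trans (by
    rw [abs_mul]; exact mul_le_mul hx hy (abs_nonneg _) ((abs_nonneg _).trans hx))

theorem abs_mul_le_mul {x y X Y : ℝ} (hx : |x| ≤ X) (hy : |y| ≤ Y) : |x * y| ≤ X * Y := by
  rw [abs_mul]; exact mul_le_mul hx hy (abs_nonneg _) ((abs_nonneg _).trans hx)

/-- The differential inequality for the energy `E = b² + δ² + (β - ρ) (ε b) (P δ)` of the acoustic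
waves, as an inequality between real numbers. Here `b = B / ε`, `δ = p^{1/2} d` with `d` the
divergence divided by the symbol `p`, `P = p^{-1/2}`, `u = (p / κ²)^{-1/8}` and `a = |k| / κ` with
`κ² = k² + l²`, `r = p' / p`, and `w` is the good unknown. On the left-hand side, the term with
`α` comes from a weight `p^α` and the other terms make up the derivative of `E`. The correction
with `β ≈ r / 2` replaces `r δ²` by its average `r (b² + δ²) / 2`, whose sign is that of `r`; the
correction with `ρ` transfers a part of the dissipation of `δ` to `b`. The number `n` is the part
of `ρ` which the dissipation `ν p` fails to reach near the critical time. -/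
theorem energy_ineq {ε ρ ν n a u P p k b δ w r α β dβ : ℝ} (hε : 0 < ε) (hρ : 0 < ρ)
    (hρ1 : ρ ≤ 1) (hν : 0 < ν) (hν1 : ν ≤ 1) (hρν : ρ * ν * ε ^ 2 ≤ 1) (ha : 0 ≤ a) (ha1 : a ≤ 1)
    (hu : 0 < u) (hP : 0 < P) (hP1 : P ≤ 1) (hPu : P ≤ u ^ 4) (hpP : p * P ^ 2 = 1)
    (hkP : |k| * P = a * u ^ 4) (hr : |r| ≤ 2 * a * u ^ 4) (hα : |α| ≤ 7 / 4)
    (hαr : (α + 1 / 2) * r ≤ 0) (hβ : |β| ≤ a * u ^ 4) (hu1 : u ≤ 1) (hdβ : |dβ| ≤ a * u ^ 8)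
    (hβr : |β - r / 2| ≤ 4 * ε * a * u ^ 8) (hνp : 4 / 3 * (ρ - n) ≤ ν * p) :
    α * r * (b ^ 2 + δ ^ 2 + (β - ρ) * (ε * b) * (P * δ)) + r * δ ^ 2 - 2 * ν * p * δ ^ 2
      + 4 * P ^ 2 * (k * w + k ^ 2 * (ε * b)) * (P * δ) + dβ * (ε * b) * (P * δ)
      + (β - ρ) * (b ^ 2 - δ ^ 2) - (β - ρ) * ν * p * (ε * b) * (P * δ)
      + 2 * (β - ρ) * P ^ 4 * (ε * b) * (k * w + k ^ 2 * (ε * b))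
    ≤ -(ρ / 2) * (b ^ 2 + δ ^ 2) + (5 / 3 * n * δ ^ 2
      + (10 * ε + 5 * ε ^ 2) * (a * u ^ 8) * (b ^ 2 + δ ^ 2))
      + 4 * |k| * P ^ 3 * |w| * (|δ| + ε * |b|) := by
  set E := b ^ 2 + δ ^ 2 with hE
  have hE0 : 0 ≤ E := by positivity
  have hu4 : u ^ 4 ≤ 1 := pow_le_one₀ hu.le hu1
  have hau : a * u ^ 4 ≤ 1 := mul_le_one₀ ha1 (by positivity) hu4
  have hbδ : |b * δ| ≤ E / 2 := by
    rw [abs_le]; constructor <;> linarith [sq_nonneg (b + δ), sq_nonneg (b - δ)]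
  have hbδP : |b * δ * P| ≤ E / 2 * u ^ 4 := abs_mul_le_mul hbδ (by rwa [abs_of_pos hP])
  have hγ : |β - ρ| ≤ 2 := by
    rw [abs_le] at hβ ⊢; constructor <;> linarith
  have hkP2 : k ^ 2 * P ^ 2 ≤ a * u ^ 8 := by
    have : k ^ 2 * P ^ 2 = a * (a * u ^ 8) := by
      rw [← sq_abs k, ← mul_pow, hkP]; ring
    rw [this]
    exact mul_le_of_le_one_left (by positivity) ha1
  have hkP2' : |k ^ 2 * P ^ 2| ≤ a * u ^ 8 := by rwa [abs_of_nonneg (by positivity)]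
  have hb2 : b ^ 2 ≤ E := by rw [hE]; linarith [sq_nonneg δ]
  have hbd2 : |b ^ 2 - δ ^ 2| ≤ E := by
    rw [abs_le]; constructor <;> linarith [sq_nonneg δ, sq_nonneg b]
  -- the principal part, and then the error terms one by one
  have t1 : (α + 1 / 2) * r * E ≤ 0 := mul_nonpos_of_nonpos_of_nonneg hαr hE0
  have t2 : (β - r / 2) * (b ^ 2 - δ ^ 2) ≤ 4 * ε * a * u ^ 8 * E :=
    mul_le_mul_of_abs_le hβr hbd2
  have t3 : α * r * ((β - ρ) * (b * δ * P)) * ε ≤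
      7 / 4 * (2 * a * u ^ 4) * (2 * (E / 2 * u ^ 4)) * ε := by
    apply mul_le_mul_of_nonneg_right _ hε.le
    exact mul_le_mul_of_abs_le (abs_mul_le_mul hα hr) (abs_mul_le_mul hγ hbδP)
  have t4 : k ^ 2 * P ^ 2 * (b * δ * P) * (4 * ε) ≤ a * u ^ 8 * (E / 2 * 1) * (4 * ε) := by
    apply mul_le_mul_of_nonneg_right _ (by positivity)
    refine mul_le_mul_of_abs_le hkP2' (hbδP.trans ?_)
    exact mul_le_mul_of_nonneg_left hu4 (by positivity)
  have t5 : dβ * (b * δ * P) * ε ≤ a * u ^ 8 * (E / 2 * 1) * ε := by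
    apply mul_le_mul_of_nonneg_right _ (by positivity)
    refine mul_le_mul_of_abs_le hdβ (hbδP.trans ?_)
    exact mul_le_mul_of_nonneg_left hu4 (by positivity)
  have hx : (p * P * δ) ^ 2 = p * δ ^ 2 := by linear_combination p * δ ^ 2 * hpP
  have hβ2 : β ^ 2 ≤ a * u ^ 8 := by
    have h1 : β ^ 2 ≤ (a * u ^ 4) ^ 2 := sq_le_sq' (abs_le.1 hβ).1 (abs_le.1 hβ).2
    have h2 : (a * u ^ 4) ^ 2 = a * (a * u ^ 8) := by ring
    rw [h2] at h1
    exact h1.trans (mul_le_of_le_one_left (by positivity) ha1)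
  -- the dissipation `2 ν p δ²` pays for the two terms with `ν p (ε b) (P δ)`
  have t7 : -(β * ν * ε * b * (p * P * δ)) ≤ ν * (p * δ ^ 2) / 4 + ε ^ 2 * (a * u ^ 8) * E := by
    have h1 : -(β * ν * ε * b * (p * P * δ)) ≤ ν * (p * P * δ) ^ 2 / 4
        + ν * (β ^ 2 * ε ^ 2 * b ^ 2) := by
      linarith [mul_nonneg hν.le (sq_nonneg (p * P * δ / 2 + β * ε * b))]
    have h2 : β ^ 2 * ε ^ 2 * b ^ 2 ≤ a * u ^ 8 * ε ^ 2 * E := by gcongr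
    have h3 : ν * (β ^ 2 * ε ^ 2 * b ^ 2) ≤ β ^ 2 * ε ^ 2 * b ^ 2 :=
      mul_le_of_le_one_left (by positivity) hν1
    rw [hx] at h1
    linarith
  have t8 : ρ * ν * ε * b * (p * P * δ) ≤ ν * (p * δ ^ 2) / 2 + ρ / 2 * b ^ 2 := by
    have h1 : ρ * ν * ε * b * (p * P * δ) ≤ ν * (p * P * δ) ^ 2 / 2
        + (ρ * b ^ 2 / 2) * (ρ * ν * ε ^ 2) := by
      linarith [mul_nonneg hν.le (sq_nonneg (p * P * δ - ρ * ε * b))]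
    have h2 : (ρ * b ^ 2 / 2) * (ρ * ν * ε ^ 2) ≤ (ρ * b ^ 2 / 2) * 1 :=
      mul_le_mul_of_nonneg_left hρν (by positivity)
    rw [hx] at h1
    linarith
  have t9 : (β - ρ) * (k ^ 2 * P ^ 2 * (P ^ 2 * b ^ 2)) * (2 * ε ^ 2)
      ≤ 2 * (a * u ^ 8 * (1 * E)) * (2 * ε ^ 2) := by
    apply mul_le_mul_of_nonneg_right _ (by positivity)
    refine mul_le_mul_of_abs_le hγ (abs_mul_le_mul hkP2' ?_)
    rw [abs_of_nonneg (by positivity)]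
    exact mul_le_mul (pow_le_one₀ hP.le hP1) hb2 (by positivity) zero_le_one
  have t10 : k * w * δ * (4 * P ^ 3) ≤ |k| * |w| * |δ| * (4 * P ^ 3) := by
    apply mul_le_mul_of_nonneg_right _ (by positivity)
    exact mul_le_mul_of_abs_le (abs_mul_le_mul le_rfl le_rfl) le_rfl
  have t11 : (β - ρ) * (k * w * b * P) * (2 * ε * P ^ 3) ≤
      2 * (|k| * |w| * |b| * 1) * (2 * ε * P ^ 3) := by
    apply mul_le_mul_of_nonneg_right _ (by positivity)
    refine mul_le_mul_of_abs_le hγ (abs_mul_le_mul (abs_mul_le_mul (abs_mul_le_mul le_rfl le_rfl)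
      le_rfl) ?_)
    rwa [abs_of_pos hP]
  have t12 : 4 / 3 * (ρ - n) * δ ^ 2 ≤ ν * p * δ ^ 2 :=
    mul_le_mul_of_nonneg_right hνp (sq_nonneg δ)
  have hid : α * r * (E + (β - ρ) * (ε * b) * (P * δ)) + r * δ ^ 2 - 2 * ν * p * δ ^ 2
      + 4 * P ^ 2 * (k * w + k ^ 2 * (ε * b)) * (P * δ) + dβ * (ε * b) * (P * δ)
      + (β - ρ) * (b ^ 2 - δ ^ 2) - (β - ρ) * ν * p * (ε * b) * (P * δ)
      + 2 * (β - ρ) * P ^ 4 * (ε * b) * (k * w + k ^ 2 * (ε * b))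
      = (α + 1 / 2) * r * E + (β - r / 2) * (b ^ 2 - δ ^ 2)
        + α * r * ((β - ρ) * (b * δ * P)) * ε + k ^ 2 * P ^ 2 * (b * δ * P) * (4 * ε)
        + dβ * (b * δ * P) * ε - (β * ν * ε * b * (p * P * δ)) + ρ * ν * ε * b * (p * P * δ)
        + (β - ρ) * (k ^ 2 * P ^ 2 * (P ^ 2 * b ^ 2)) * (2 * ε ^ 2)
        + k * w * δ * (4 * P ^ 3) + (β - ρ) * (k * w * b * P) * (2 * ε * P ^ 3)
        - ρ * (b ^ 2 - δ ^ 2) - 2 * ν * p * δ ^ 2 := by rw [hE]; ring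
  rw [hid]
  have hEe : E = b ^ 2 + δ ^ 2 := hE
  have e1 : -(ρ / 2) * E = -(ρ / 2) * b ^ 2 - (ρ / 2) * δ ^ 2 := by rw [hE]; ring
  rw [e1]
  have e2 : 0 ≤ ρ * δ ^ 2 := by positivity
  linarith

set_option maxHeartbeats 1000000 in
/-- The inequality `energy_ineq`, weighted with `κ⁴ g¹⁴` and completed by the equation of `w`.
Here `g = u⁻¹` and `P = p^{-1/2} = u⁴ / κ`. The power `14` is the one for which the coupling of `w`
into the equation of `d` and that of `B` into the equation of `w` both have an integrable
coefficient `a u⁵`; the weight `g¹⁴` itself contributes `7/4 r` to the logarithmic derivative. -/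
theorem weighted_energy_ineq {ε ρ ν n a u g P p k κ b δ w r α β dβ : ℝ} (hε : 0 < ε) (hρ : 0 < ρ)
    (hρ1 : ρ ≤ 1) (hρε : ρ * ε ≤ 1 / 4) (hν : 0 < ν) (hν1 : ν ≤ 1) (hρν : ρ * ν * ε ^ 2 ≤ 1)
    (ha : 0 ≤ a) (ha1 : a ≤ 1)
    (hu : 0 < u) (hug : u * g = 1) (hκ : 1 ≤ κ) (hPκ : P * κ = u ^ 4) (hpP : p * P ^ 2 = 1)
    (hkκ : |k| = a * κ) (hr : |r| ≤ 2 * a * u ^ 4) (hα : |α| ≤ 7 / 4)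
    (hαr : (α + 1 / 2) * r ≤ 0) (hαr' : (α - 7 / 4) * r ≤ 0)
    (hβ : |β| ≤ a * u ^ 4) (hβ' : |β| * ε * P ≤ 1 / 4) (hu1 : u ≤ 1) (hdβ : |dβ| ≤ a * u ^ 8)
    (hn : 0 ≤ n)
    (hβr : |β - r / 2| ≤ 4 * ε * a * u ^ 8) (hνp : 4 / 3 * (ρ - n) ≤ ν * p)
    (hρp : ρ - n ≤ ρ ^ 3 * p) :
    κ ^ 4 * g ^ 14 * (α * r * (b ^ 2 + δ ^ 2 + (β - ρ) * (ε * b) * (P * δ)) + r * δ ^ 2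
      - 2 * ν * p * δ ^ 2
      + 4 * P ^ 2 * (k * w + k ^ 2 * (ε * b)) * (P * δ) + dβ * (ε * b) * (P * δ)
      + (β - ρ) * (b ^ 2 - δ ^ 2) - (β - ρ) * ν * p * (ε * b) * (P * δ)
      + 2 * (β - ρ) * P ^ 4 * (ε * b) * (k * w + k ^ 2 * (ε * b)))
      + (α - 7 / 4) * r * w ^ 2 + 2 * w * (-(ρ ^ 3 * p) * (w + k * (ε * b)))
    ≤ (-(2 / 5 * ρ) + (10 + 40 * ε + 20 * ε ^ 2) * (a * u ^ 5 + n)) *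
      (κ ^ 4 * g ^ 14 * (b ^ 2 + δ ^ 2 + (β - ρ) * (ε * b) * (P * δ)) + w ^ 2) := by
  have hg : 0 < g := by
    by_contra h
    have : u * g ≤ 0 := mul_nonpos_of_nonneg_of_nonpos hu.le (not_lt.1 h)
    linarith
  have hκ0 : 0 < κ := by linarith
  have hP : 0 < P := by
    by_contra h
    have : P * κ ≤ 0 := mul_nonpos_of_nonpos_of_nonneg (not_lt.1 h) hκ0.le
    have := pow_pos hu 4
    linarith
  have hPu : P ≤ u ^ 4 := by rw [← hPκ]; exact le_mul_of_one_le_right hP.le hκ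
  have hP1 : P ≤ 1 := hPu.trans (pow_le_one₀ hu.le hu1)
  have hkP : |k| * P = a * u ^ 4 := by rw [hkκ, ← hPκ]; ring
  have h1 := energy_ineq (w := w) (b := b) (δ := δ) hε hρ hρ1 hν hν1 hρν ha ha1 hu hP hP1 hPu hpP
    hkP hr hα hαr hβ hu1 hdβ hβr hνp
  set E := b ^ 2 + δ ^ 2 with hE
  set e := E + (β - ρ) * (ε * b) * (P * δ) with he
  have hE0 : 0 ≤ E := by positivity
  have hbδ : |b * δ| ≤ E / 2 := by
    rw [abs_le]; constructor <;> linarith [sq_nonneg (b + δ), sq_nonneg (b - δ)]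
  have hcross : |(β - ρ) * (ε * b) * (P * δ)| ≤ E / 4 := by
    have h2 : (β - ρ) * (ε * b) * (P * δ) = ((β - ρ) * (ε * P)) * (b * δ) := by ring
    have h3 : |(β - ρ) * (ε * P)| ≤ 1 / 2 := by
      rw [abs_mul, abs_of_pos (mul_pos hε hP)]
      have h4 : |β - ρ| ≤ |β| + ρ := by
        have := abs_sub β ρ
        rwa [abs_of_pos hρ] at this
      have h5 : ρ * (ε * P) ≤ 1 / 4 := by
        rw [← mul_assoc]
        exact (mul_le_of_le_one_right (by positivity) hP1).trans hρε
      have h6 : |β - ρ| * (ε * P) ≤ (|β| + ρ) * (ε * P) :=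
        mul_le_mul_of_nonneg_right h4 (by positivity)
      linarith
    rw [h2]
    exact (abs_mul_le_mul h3 hbδ).trans (by linarith)
  have heE : e ≤ 5 / 4 * E := by rw [he]; linarith [(abs_le.1 hcross).2]
  have hEe : E ≤ 4 / 3 * e := by rw [he]; linarith [(abs_le.1 hcross).1]
  set Ω := κ ^ 4 * g ^ 14 with hΩ
  have hΩ0 : 0 < Ω := by positivity
  have hu8 : u ^ 8 ≤ u ^ 5 := pow_le_pow_of_le_one hu.le hu1 (by norm_num)
  -- the coupling with `w` in the equation of `d`
  have hP3 : Ω * (|k| * P ^ 3) = a * u ^ 5 * (κ ^ 2 * g ^ 7) := by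
    have e1 : |k| * P ^ 3 * κ ^ 2 = a * u ^ 12 := by
      rw [hkκ]; linear_combination a * ((P * κ) ^ 2 + (P * κ) * u ^ 4 + u ^ 8) * hPκ
    have e2 : u ^ 7 * g ^ 7 = 1 := by rw [← mul_pow, hug, one_pow]
    have e3 : Ω * (|k| * P ^ 3) = κ ^ 2 * g ^ 14 * (|k| * P ^ 3 * κ ^ 2) := by rw [hΩ]; ring
    rw [e3, e1]
    linear_combination κ ^ 2 * g ^ 7 * a * u ^ 5 * e2
  have hΩsq : Ω = (κ ^ 2 * g ^ 7) ^ 2 := by rw [hΩ]; ring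
  have hAM : ∀ x : ℝ, κ ^ 2 * g ^ 7 * (|w| * |x|) ≤ (Ω * x ^ 2 + w ^ 2) / 2 := by
    intro x
    rw [hΩsq, ← sq_abs w, ← sq_abs x]
    linarith [sq_nonneg (κ ^ 2 * g ^ 7 * |x| - |w|)]
  have hau5 : 0 ≤ a * u ^ 5 := by positivity
  have hcoup : Ω * (4 * |k| * P ^ 3 * |w| * (|δ| + ε * |b|)) ≤
      a * u ^ 5 * ((2 + 2 * ε) * (Ω * E + w ^ 2)) := by
    have e1 : Ω * (4 * |k| * P ^ 3 * |w| * (|δ| + ε * |b|)) =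
        a * u ^ 5 *
          (4 * (κ ^ 2 * g ^ 7 * (|w| * |δ|)) + 4 * ε * (κ ^ 2 * g ^ 7 * (|w| * |b|))) := by
      linear_combination 4 * |w| * (|δ| + ε * |b|) * hP3
    rw [e1]
    apply mul_le_mul_of_nonneg_left _ hau5
    have h2 := hAM δ
    have h3 := mul_le_mul_of_nonneg_left (hAM b) (by positivity : 0 ≤ 4 * ε)
    have h4 : Ω * E = Ω * b ^ 2 + Ω * δ ^ 2 := by rw [hE]; ring
    have h5 : 0 ≤ Ω * b ^ 2 := by positivity
    have h6 : 0 ≤ ε * (Ω * δ ^ 2) := by positivity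
    have h7 : 0 ≤ ε * (Ω * b ^ 2) := by positivity
    have h8 : (2 + 2 * ε) * (Ω * E + w ^ 2) = 2 * (Ω * b ^ 2 + Ω * δ ^ 2) + 2 * w ^ 2
      + 2 * ε * (Ω * b ^ 2) + 2 * ε * (Ω * δ ^ 2) + 2 * ε * w ^ 2 := by rw [h4]; ring
    rw [h8]
    linarith
  -- the forcing of `w` by `B`
  have hρ3 : ρ ^ 3 ≤ 1 := pow_le_one₀ hρ.le hρ1
  have hp0 : 0 < p := by
    by_contra h
    have : p * P ^ 2 ≤ 0 := mul_nonpos_of_nonpos_of_nonneg (not_lt.1 h) (by positivity)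
    linarith
  have hpκ : p * u ^ 8 = κ ^ 2 := by
    have : u ^ 8 = P ^ 2 * κ ^ 2 := by rw [← mul_pow, hPκ]; ring
    rw [this, ← mul_assoc, hpP, one_mul]
  have hforce : 2 * w * (-(ρ ^ 3 * p) * (w + k * (ε * b))) ≤
      -(ρ ^ 3 * p) * w ^ 2 + a * u ^ 5 * (ε ^ 2 * (Ω * E)) := by
    have e1 : 2 * w * (-(ρ ^ 3 * p) * (w + k * (ε * b))) ≤
      -(ρ ^ 3 * p) * w ^ 2 + ρ ^ 3 * (p * (k ^ 2 * ε ^ 2 * b ^ 2)) := by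
      linarith [mul_nonneg (mul_pos (pow_pos hρ 3) hp0).le (sq_nonneg (w + k * (ε * b)))]
    have e2 : p * k ^ 2 = a * (a * u ^ 6 * Ω) := by
      have e3 : u ^ 14 * g ^ 14 = 1 := by rw [← mul_pow, hug, one_pow]
      have e4 : k ^ 2 = a ^ 2 * κ ^ 2 := by rw [← sq_abs k, hkκ]; ring
      rw [hΩ, e4, ← hpκ]
      linear_combination (-p ^ 2 * a ^ 2 * u ^ 8) * e3 +
        a ^ 2 * u ^ 6 * g ^ 14 * (κ ^ 2 + p * u ^ 8) * hpκ
    have e5 : p * (k ^ 2 * ε ^ 2 * b ^ 2) ≤ a * u ^ 5 * (ε ^ 2 * (Ω * E)) := by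
      have e6 : p * (k ^ 2 * ε ^ 2 * b ^ 2) = (a * (a * u ^ 6) * Ω) * (ε ^ 2 * b ^ 2) := by
        linear_combination ε ^ 2 * b ^ 2 * e2
      have e7 : a * (a * u ^ 6) ≤ a * u ^ 5 := by
        apply mul_le_mul_of_nonneg_left _ ha
        calc a * u ^ 6 ≤ u ^ 6 := mul_le_of_le_one_left (by positivity) ha1
          _ ≤ u ^ 5 := pow_le_pow_of_le_one hu.le hu1 (by norm_num)
      have e8 : b ^ 2 ≤ E := by rw [hE]; linarith [sq_nonneg δ]
      rw [e6]
      calc (a * (a * u ^ 6) * Ω) * (ε ^ 2 * b ^ 2) ≤ (a * u ^ 5 * Ω) * (ε ^ 2 * E) := by gcongr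
        _ = _ := by ring
    have e9 : ρ ^ 3 * (p * (k ^ 2 * ε ^ 2 * b ^ 2)) ≤ p * (k ^ 2 * ε ^ 2 * b ^ 2) :=
      mul_le_of_le_one_left (by positivity) hρ3
    linarith
  have hdw : -(ρ ^ 3 * p) * w ^ 2 ≤ -(ρ - n) * w ^ 2 := by
    have := mul_le_mul_of_nonneg_right hρp (sq_nonneg w)
    linarith
  have hrw : (α - 7 / 4) * r * w ^ 2 ≤ 0 := mul_nonpos_of_nonpos_of_nonneg hαr' (sq_nonneg w)
  have h2 := mul_le_mul_of_nonneg_left h1 hΩ0.le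
  have hΩE : Ω * E ≤ 4 / 3 * (Ω * e) := by
    have := mul_le_mul_of_nonneg_left hEe hΩ0.le
    linarith
  have hΩE' : Ω * e ≤ 5 / 4 * (Ω * E) := by
    have := mul_le_mul_of_nonneg_left heE hΩ0.le
    linarith
  have h3 : Ω * (5 / 3 * n * δ ^ 2) ≤ 5 / 3 * (n * (Ω * E)) := by
    have : δ ^ 2 ≤ E := by rw [hE]; linarith [sq_nonneg b]
    have := mul_le_mul_of_nonneg_left this (mul_nonneg hn hΩ0.le)
    linarith
  have h4 : (10 * ε + 5 * ε ^ 2) * (a * u ^ 8) * (Ω * E) ≤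
      (10 * ε + 5 * ε ^ 2) * (a * u ^ 5) * (Ω * E) := by gcongr
  have h5 : 0 ≤ Ω * E := by positivity
  have h6 : 0 ≤ Ω * e := by linarith
  have h7 : ρ * (2 / 5 * (Ω * e)) ≤ ρ * (1 / 2 * (Ω * E)) :=
    mul_le_mul_of_nonneg_left (by linarith) hρ.le
  have h8 : 0 ≤ w ^ 2 := sq_nonneg w
  have h9 : n * (Ω * E) ≤ n * (4 / 3 * (Ω * e)) := mul_le_mul_of_nonneg_left hΩE hn
  have h10 : (a * u ^ 5 * (2 + 12 * ε + 6 * ε ^ 2)) * (Ω * E) ≤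
      (a * u ^ 5 * (2 + 12 * ε + 6 * ε ^ 2)) * (4 / 3 * (Ω * e)) :=
    mul_le_mul_of_nonneg_left hΩE (by positivity)
  have h11 : (a * u ^ 5 * (2 + 2 * ε)) * w ^ 2 ≤
      (a * u ^ 5 * (10 + 40 * ε + 20 * ε ^ 2)) * w ^ 2 := by
    have : 2 + 2 * ε ≤ 10 + 40 * ε + 20 * ε ^ 2 := by linarith [sq_nonneg ε]
    gcongr
  have h12 : (a * u ^ 5 * (2 + 12 * ε + 6 * ε ^ 2)) * (4 / 3 * (Ω * e)) ≤
      (a * u ^ 5 * (10 + 40 * ε + 20 * ε ^ 2)) * (Ω * e) := by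
    have h13 : (2 + 12 * ε + 6 * ε ^ 2) * (4 / 3) ≤ 10 + 40 * ε + 20 * ε ^ 2 := by
      linarith [sq_nonneg ε]
    have := mul_le_mul_of_nonneg_left h13 (mul_nonneg hau5 h6)
    linarith
  have h14 : n * (10 : ℝ) * (Ω * e + w ^ 2) ≤ n * (10 + 40 * ε + 20 * ε ^ 2) * (Ω * e + w ^ 2) := by
    have : 10 ≤ 10 + 40 * ε + 20 * ε ^ 2 := by linarith [sq_nonneg ε]
    gcongr
  have h15 : 0 ≤ n * (Ω * e) := by positivity
  have h16 : 0 ≤ n * w ^ 2 := by positivity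
  have h17 : 0 ≤ ρ * w ^ 2 := by positivity
  linarith

/-! ### One frequency in the moving frame -/

/-- The parameters: `ρ = μ^{1/3}` and `ν = lam + 2 μ`. -/
structure Admissible (ε ρ ν : ℝ) : Prop where
  ε_pos : 0 < ε
  ρ_pos : 0 < ρ
  ρ_le : ρ ≤ 1
  ρε : ρ * ε ≤ 1 / 4
  le_ν : 4 / 3 * ρ ^ 3 ≤ ν
  ν_le : ν ≤ 1
  ρν : ρ * ν * ε ^ 2 ≤ 1

/-- The symbol `p = k² + (η - k t)² + l²` of `-Δ` in the moving frame. -/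
def symb (k l η t : ℝ) : ℝ := k ^ 2 + l ^ 2 + (η - k * t) ^ 2

/-- The linearized system at the frequency `(k, η, l)`, in the frame moving with the Couette flow.
The unknowns are `B = b̂` and `Vⱼ = i ûʲ`; with this choice the system has real coefficients, so
that the real and the imaginary parts of the Fourier transform solve it separately. -/
structure IsMode (ε ρ ν k l η : ℝ) (B V₁ V₂ V₃ : ℝ → ℝ) : Prop where
  B' : ∀ t, HasDerivAt B (-(k * V₁ t + (η - k * t) * V₂ t + l * V₃ t)) t
  V₁' : ∀ t, HasDerivAt V₁ (-V₂ t + k * B t / ε ^ 2 - ρ ^ 3 * symb k l η t * V₁ t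
    - (ν - ρ ^ 3) * k * (k * V₁ t + (η - k * t) * V₂ t + l * V₃ t)) t
  V₂' : ∀ t, HasDerivAt V₂ ((η - k * t) * B t / ε ^ 2 - ρ ^ 3 * symb k l η t * V₂ t
    - (ν - ρ ^ 3) * (η - k * t) * (k * V₁ t + (η - k * t) * V₂ t + l * V₃ t)) t
  V₃' : ∀ t, HasDerivAt V₃ (l * B t / ε ^ 2 - ρ ^ 3 * symb k l η t * V₃ t
    - (ν - ρ ^ 3) * l * (k * V₁ t + (η - k * t) * V₂ t + l * V₃ t)) t

/-- `(k² + l²)^{1/2}`. -/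
def kap (k l : ℝ) : ℝ := √(k ^ 2 + l ^ 2)

/-- The weight `(p / (k² + l²))^{1/8}`. All the weights below are powers of it. -/
def gw (k l η t : ℝ) : ℝ := (symb k l η t / (k ^ 2 + l ^ 2)) ^ (1 / 8 : ℝ)

section Weights

variable {k l η : ℝ}

theorem kap_sq (k l : ℝ) : kap k l ^ 2 = k ^ 2 + l ^ 2 := Real.sq_sqrt (by positivity)

theorem one_le_kap (hk : 1 ≤ |k|) : 1 ≤ kap k l := by
  rw [kap, Real.one_le_sqrt]
  have : 1 ≤ k ^ 2 := by rw [← sq_abs]; nlinarith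
  linarith [sq_nonneg l]

theorem abs_k_le_kap : |k| ≤ kap k l := by
  rw [kap]; exact Real.abs_le_sqrt (by linarith [sq_nonneg l])

theorem abs_l_le_kap : |l| ≤ kap k l := by
  rw [kap]; exact Real.abs_le_sqrt (by linarith [sq_nonneg k])

theorem symb_eq (k l η t : ℝ) : symb k l η t = kap k l ^ 2 + (η - k * t) ^ 2 := by
  rw [kap_sq, symb]

theorem symb_pos (hk : 1 ≤ |k|) (t : ℝ) : 0 < symb k l η t := by
  rw [symb_eq]
  have : 1 ≤ kap k l := one_le_kap hk
  positivity

theorem gw_pow (hk : 1 ≤ |k|) (t : ℝ) : gw k l η t ^ 8 = symb k l η t / (k ^ 2 + l ^ 2) := by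
  rw [gw, ← Real.rpow_natCast, ← Real.rpow_mul]
  · norm_num
  · exact div_nonneg (symb_pos hk t).le (by positivity)

theorem symb_eq_gw (hk : 1 ≤ |k|) (t : ℝ) :
    symb k l η t = kap k l ^ 2 * gw k l η t ^ 8 := by
  have := one_le_kap (l := l) hk
  have h : k ^ 2 + l ^ 2 ≠ 0 := by rw [← kap_sq]; positivity
  rw [gw_pow hk, kap_sq]; field_simp

theorem one_le_gw (hk : 1 ≤ |k|) (t : ℝ) : 1 ≤ gw k l η t := by
  have := one_le_kap (l := l) hk
  have h : 0 < k ^ 2 + l ^ 2 := by rw [← kap_sq]; positivity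
  apply Real.one_le_rpow _ (by norm_num)
  rw [one_le_div h, symb]
  linarith [sq_nonneg (η - k * t)]

theorem hasDerivAt_sub_mul (t : ℝ) : HasDerivAt (fun t => η - k * t) (-k) t := by
  simpa using ((hasDerivAt_id t).const_mul k).const_sub η

theorem hasDerivAt_symb (t : ℝ) :
    HasDerivAt (symb k l η) (-2 * k * (η - k * t)) t := by
  have h := ((hasDerivAt_sub_mul (k := k) (η := η) t).pow 2).const_add (k ^ 2 + l ^ 2)
  refine h.congr_deriv ?_
  simp; ring

/-- The logarithmic derivative `p' / p`. -/
def rlog (k l η t : ℝ) : ℝ := -2 * k * (η - k * t) / symb k l η t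

theorem hasDerivAt_gw (hk : 1 ≤ |k|) (t : ℝ) :
    HasDerivAt (gw k l η) (gw k l η t * rlog k l η t / 8) t := by
  have hκ := one_le_kap (l := l) hk
  have h0 : 0 < k ^ 2 + l ^ 2 := by rw [← kap_sq]; positivity
  have hp := symb_pos (l := l) (η := η) hk t
  have h1 : 0 < symb k l η t / (k ^ 2 + l ^ 2) := by positivity
  have h := (((hasDerivAt_symb (k := k) (l := l) (η := η) t).div_const (k ^ 2 + l ^ 2)).rpow_const
    (p := 1 / 8) (Or.inl h1.ne'))
  refine h.congr_deriv ?_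
  rw [Real.rpow_sub h1, Real.rpow_one, gw, rlog]
  field_simp

/-- The weight `(k² + l²)^{1/8} p^{-1/8}`. -/
def uw (k l η t : ℝ) : ℝ := (gw k l η t)⁻¹

theorem uw_pos (hk : 1 ≤ |k|) (t : ℝ) : 0 < uw k l η t :=
  inv_pos.2 (by have := one_le_gw (l := l) (η := η) hk t; linarith)

theorem uw_le_one (hk : 1 ≤ |k|) (t : ℝ) : uw k l η t ≤ 1 :=
  inv_le_one_of_one_le₀ (one_le_gw hk t)

theorem uw_mul_gw (hk : 1 ≤ |k|) (t : ℝ) : uw k l η t * gw k l η t = 1 :=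
  inv_mul_cancel₀ (by have := one_le_gw (l := l) (η := η) hk t; positivity)

theorem hasDerivAt_uw (hk : 1 ≤ |k|) (t : ℝ) :
    HasDerivAt (uw k l η) (-(uw k l η t * rlog k l η t / 8)) t := by
  have hg : gw k l η t ≠ 0 := by
    have := one_le_gw (l := l) (η := η) hk t; positivity
  refine ((hasDerivAt_gw (l := l) (η := η) hk t).inv hg).congr_deriv ?_
  rw [uw]; field_simp

/-- `p^{-1/2}`. -/
def Pw (k l η t : ℝ) : ℝ := uw k l η t ^ 4 / kap k l

theorem Pw_mul_kap (hk : 1 ≤ |k|) (t : ℝ) : Pw k l η t * kap k l = uw k l η t ^ 4 :=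
  div_mul_cancel₀ _ (by have := one_le_kap (l := l) hk; positivity)

theorem Pw_pos (hk : 1 ≤ |k|) (t : ℝ) : 0 < Pw k l η t := by
  have := one_le_kap (l := l) hk
  have := uw_pos (l := l) (η := η) hk t
  rw [Pw]; positivity

theorem symb_mul_Pw (hk : 1 ≤ |k|) (t : ℝ) : symb k l η t * Pw k l η t ^ 2 = 1 := by
  have hκ := one_le_kap (l := l) hk
  have h := uw_mul_gw (l := l) (η := η) hk t
  rw [symb_eq_gw hk, Pw]
  field_simp
  calc _ = (uw k l η t * gw k l η t) ^ 8 := by ring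
    _ = 1 := by rw [h, one_pow]

theorem abs_freq_mul_Pw_le (hk : 1 ≤ |k|) (t : ℝ) : |η - k * t| * Pw k l η t ≤ 1 := by
  have hP := Pw_pos (l := l) (η := η) hk t
  have h : (|η - k * t| * Pw k l η t) ^ 2 ≤ 1 := by
    rw [mul_pow, sq_abs, ← symb_mul_Pw (l := l) (η := η) hk t, symb]
    apply mul_le_mul_of_nonneg_right _ (by positivity)
    linarith [sq_nonneg k, sq_nonneg l]
  nlinarith [mul_nonneg (abs_nonneg (η - k * t)) hP.le]

/-- `|k| / (k² + l²)^{1/2}`. -/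
def aw (k l : ℝ) : ℝ := |k| / kap k l

theorem abs_k_eq (hk : 1 ≤ |k|) : |k| = aw k l * kap k l :=
  (div_mul_cancel₀ _ (by have := one_le_kap (l := l) hk; positivity)).symm

theorem aw_nonneg : 0 ≤ aw k l := div_nonneg (abs_nonneg _) (Real.sqrt_nonneg _)

theorem aw_le_one : aw k l ≤ 1 :=
  div_le_one_of_le₀ abs_k_le_kap (Real.sqrt_nonneg _)

theorem abs_k_mul_Pw (hk : 1 ≤ |k|) (t : ℝ) : |k| * Pw k l η t = aw k l * uw k l η t ^ 4 := by
  rw [← Pw_mul_kap hk, abs_k_eq (l := l) hk]; ring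

/-- `|k (η - k t)| / p ≤ a u⁴`. -/
theorem abs_k_freq_div_le (hk : 1 ≤ |k|) (t : ℝ) :
    |k * (η - k * t)| / symb k l η t ≤ aw k l * uw k l η t ^ 4 := by
  have h1 := abs_freq_mul_Pw_le (l := l) (η := η) hk t
  have h2 := abs_k_mul_Pw (l := l) (η := η) hk t
  have hp := symb_pos (l := l) (η := η) hk t
  have h3 := symb_mul_Pw (l := l) (η := η) hk t
  have h4 : |k * (η - k * t)| / symb k l η t
      = (|k| * Pw k l η t) * (|η - k * t| * Pw k l η t) := by
    rw [abs_mul, div_eq_iff hp.ne']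
    linear_combination (-|k| * |η - k * t|) * h3
  rw [h4, h2]
  have := aw_nonneg (k := k) (l := l)
  have := uw_pos (l := l) (η := η) hk t
  exact mul_le_of_le_one_right (by positivity) h1

theorem abs_rlog_le (hk : 1 ≤ |k|) (t : ℝ) : |rlog k l η t| ≤ 2 * aw k l * uw k l η t ^ 4 := by
  have h := abs_k_freq_div_le (l := l) (η := η) hk t
  have hp := symb_pos (l := l) (η := η) hk t
  have h1 : |rlog k l η t| = 2 * (|k * (η - k * t)| / symb k l η t) := by
    rw [rlog, abs_div, abs_of_pos hp, mul_assoc, abs_mul]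
    norm_num; ring
  rw [h1]; linarith

/-- The coefficient of the adiabatic correction to the energy of the acoustic waves: away from the
critical time it equals `p' / (2 p)` up to lower order terms. -/
def bw (ε k l η t : ℝ) : ℝ := -(k * (η - k * t)) / (symb k l η t + 4 * ε * (k ^ 2 + l ^ 2))

/-- The derivative of `bw`. -/
def dbw (ε k l η t : ℝ) : ℝ := k ^ 2 / (symb k l η t + 4 * ε * (k ^ 2 + l ^ 2))
  - 2 * (k * (η - k * t)) ^ 2 / (symb k l η t + 4 * ε * (k ^ 2 + l ^ 2)) ^ 2

theorem hasDerivAt_bw {ε : ℝ} (hε : 0 < ε) (hk : 1 ≤ |k|) (t : ℝ) :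
    HasDerivAt (bw ε k l η) (dbw ε k l η t) t := by
  have hp := symb_pos (l := l) (η := η) hk t
  have h0 : symb k l η t + 4 * ε * (k ^ 2 + l ^ 2) ≠ 0 := by positivity
  have h := (((hasDerivAt_sub_mul (k := k) (η := η) t).const_mul k).neg).div
    ((hasDerivAt_symb (k := k) (l := l) (η := η) t).add_const (4 * ε * (k ^ 2 + l ^ 2))) h0
  refine h.congr_deriv ?_
  rw [dbw]
  simp only [Pi.neg_apply]
  field_simp

theorem abs_bw_le {ε : ℝ} (hε : 0 < ε) (hk : 1 ≤ |k|) (t : ℝ) :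
    |bw ε k l η t| ≤ aw k l * uw k l η t ^ 4 := by
  have hp := symb_pos (l := l) (η := η) hk t
  have h0 : 0 ≤ 4 * ε * (k ^ 2 + l ^ 2) := by positivity
  refine le_trans ?_ (abs_k_freq_div_le hk t)
  rw [bw, abs_div, abs_neg, abs_of_pos (by positivity : 0 < symb k l η t + _)]
  exact div_le_div_of_nonneg_left (abs_nonneg _) hp (by linarith)

theorem abs_bw_mul_le {ε : ℝ} (hε : 0 < ε) (hk : 1 ≤ |k|) (t : ℝ) :
    |bw ε k l η t| * ε * Pw k l η t ≤ 1 / 4 := by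
  have hp := symb_pos (l := l) (η := η) hk t
  have hκ := one_le_kap (l := l) hk
  have h0 : 0 < 4 * ε * (k ^ 2 + l ^ 2) := by rw [← kap_sq]; positivity
  have h1 := abs_freq_mul_Pw_le (l := l) (η := η) hk t
  have hP := Pw_pos (l := l) (η := η) hk t
  have h2 : |bw ε k l η t| ≤ |k * (η - k * t)| / (4 * ε * (k ^ 2 + l ^ 2)) := by
    rw [bw, abs_div, abs_neg, abs_of_pos (by positivity : 0 < symb k l η t + _)]
    exact div_le_div_of_nonneg_left (abs_nonneg _) h0 (by linarith)
  have h3 : |bw ε k l η t| * ε * Pw k l η t ≤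
      |k * (η - k * t)| / (4 * ε * (k ^ 2 + l ^ 2)) * ε * Pw k l η t := by gcongr
  refine h3.trans ?_
  have h4 : |k * (η - k * t)| / (4 * ε * (k ^ 2 + l ^ 2)) * ε * Pw k l η t
      = (|k| / kap k l ^ 2) * (|η - k * t| * Pw k l η t) / 4 := by
    rw [kap_sq, abs_mul]; field_simp
  rw [h4]
  have h5 : |k| / kap k l ^ 2 ≤ 1 := by
    apply div_le_one_of_le₀ _ (by positivity)
    nlinarith [abs_k_le_kap (k := k) (l := l)]
  have h6 : (|k| / kap k l ^ 2) * (|η - k * t| * Pw k l η t) ≤ 1 :=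
    mul_le_one₀ h5 (by positivity) h1
  linarith

theorem k_sq_div_symb_le (hk : 1 ≤ |k|) (t : ℝ) :
    k ^ 2 / symb k l η t ≤ aw k l * uw k l η t ^ 8 := by
  have hp := symb_pos (l := l) (η := η) hk t
  have h3 := symb_mul_Pw (l := l) (η := η) hk t
  have h4 : k ^ 2 / symb k l η t = (|k| * Pw k l η t) ^ 2 := by
    rw [mul_pow, sq_abs, div_eq_iff hp.ne']
    linear_combination (-k ^ 2) * h3
  rw [h4, abs_k_mul_Pw hk]
  have := aw_nonneg (k := k) (l := l)
  have := uw_pos (l := l) (η := η) hk t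
  calc (aw k l * uw k l η t ^ 4) ^ 2 = aw k l * (aw k l * uw k l η t ^ 8) := by ring
    _ ≤ 1 * (aw k l * uw k l η t ^ 8) := by gcongr; exact aw_le_one
    _ = _ := one_mul _

theorem abs_dbw_le {ε : ℝ} (hε : 0 < ε) (hk : 1 ≤ |k|) (t : ℝ) :
    |dbw ε k l η t| ≤ aw k l * uw k l η t ^ 8 := by
  have hp := symb_pos (l := l) (η := η) hk t
  refine le_trans ?_ (k_sq_div_symb_le hk t)
  set q := symb k l η t + 4 * ε * (k ^ 2 + l ^ 2) with hq
  have hpq : symb k l η t ≤ q := by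
    have : 0 ≤ 4 * ε * (k ^ 2 + l ^ 2) := by positivity
    linarith
  have hq0 : 0 < q := by linarith
  have h1 : (k * (η - k * t)) ^ 2 / q ^ 2 ≤ k ^ 2 / q := by
    rw [div_le_div_iff₀ (by positivity) hq0]
    have : (η - k * t) ^ 2 ≤ q := by
      rw [symb] at hpq; linarith [sq_nonneg k, sq_nonneg l]
    calc (k * (η - k * t)) ^ 2 * q = k ^ 2 * (η - k * t) ^ 2 * q := by ring
      _ ≤ k ^ 2 * q * q := by gcongr
      _ = _ := by ring
  have h2 : k ^ 2 / q ≤ k ^ 2 / symb k l η t :=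
    div_le_div_of_nonneg_left (sq_nonneg k) hp hpq
  have h3 : 0 ≤ (k * (η - k * t)) ^ 2 / q ^ 2 := by positivity
  rw [dbw, ← hq, abs_le, mul_div_assoc]
  constructor <;> linarith

theorem abs_bw_sub_le {ε : ℝ} (hε : 0 < ε) (hk : 1 ≤ |k|) (t : ℝ) :
    |bw ε k l η t - rlog k l η t / 2| ≤ 4 * ε * aw k l * uw k l η t ^ 8 := by
  have hp := symb_pos (l := l) (η := η) hk t
  have hκ := one_le_kap (l := l) hk
  set q := symb k l η t + 4 * ε * (k ^ 2 + l ^ 2) with hq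
  have hpq : symb k l η t ≤ q := by
    have : 0 ≤ 4 * ε * (k ^ 2 + l ^ 2) := by positivity
    linarith
  have hq0 : 0 < q := by linarith
  have h1 : bw ε k l η t - rlog k l η t / 2
      = (k * (η - k * t)) / symb k l η t * (4 * ε * kap k l ^ 2 / q) := by
    rw [bw, rlog, ← hq, kap_sq]
    field_simp
    rw [hq]; ring
  have hu := uw_pos (l := l) (η := η) hk t
  have ha := aw_nonneg (k := k) (l := l)
  have h2 : kap k l ^ 2 / q ≤ uw k l η t ^ 8 := by
    rw [div_le_iff₀ hq0]
    have h3 := uw_mul_gw (l := l) (η := η) hk t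
    calc kap k l ^ 2 = kap k l ^ 2 * (uw k l η t * gw k l η t) ^ 8 := by rw [h3]; ring
      _ = uw k l η t ^ 8 * symb k l η t := by rw [symb_eq_gw hk]; ring
      _ ≤ _ := by gcongr
  have h4 : uw k l η t ^ 4 ≤ 1 := pow_le_one₀ hu.le (uw_le_one hk t)
  have h5 : |4 * ε * kap k l ^ 2 / q| = 4 * ε * (kap k l ^ 2 / q) := by
    rw [abs_of_nonneg (by positivity), mul_div_assoc]
  rw [h1, abs_mul, abs_div, abs_of_pos hp, h5]
  calc _ ≤ (aw k l * uw k l η t ^ 4) * (4 * ε * uw k l η t ^ 8) := by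
        gcongr; exact abs_k_freq_div_le hk t
    _ ≤ (aw k l * 1) * (4 * ε * uw k l η t ^ 8) := by gcongr
    _ = _ := by ring

/-- The part of the decay rate `ρ` which the dissipation `ρ³ p` fails to reach near the critical
time `η / k`. -/
def nw (ρ k η t : ℝ) : ℝ := ρ / (1 + (ρ * (t - η / k)) ^ 2)

theorem nw_nonneg {ρ : ℝ} (hρ : 0 < ρ) (t : ℝ) : 0 ≤ nw ρ k η t := by rw [nw]; positivity

theorem sub_mul_eq (hk : 1 ≤ |k|) (t : ℝ) : η - k * t = k * (η / k - t) := by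
  have : k ≠ 0 := by rintro rfl; simp at hk; linarith
  field_simp

theorem sub_nw_le {ρ : ℝ} (hρ : 0 < ρ) (hk : 1 ≤ |k|) (t : ℝ) :
    ρ - nw ρ k η t ≤ ρ ^ 3 * symb k l η t := by
  have h1 : (t - η / k) ^ 2 ≤ symb k l η t := by
    rw [symb, sub_mul_eq hk, mul_pow]
    have : 1 ≤ k ^ 2 := by rw [← sq_abs]; nlinarith
    nlinarith [sq_nonneg l, sq_nonneg (η / k - t)]
  have h2 : ρ - nw ρ k η t ≤ ρ ^ 3 * (t - η / k) ^ 2 := by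
    rw [nw, sub_le_iff_le_add, ← sub_le_iff_le_add', le_div_iff₀ (by positivity)]
    have : 0 ≤ ρ * (ρ * (t - η / k)) ^ 4 := by positivity
    nlinarith
  exact h2.trans (mul_le_mul_of_nonneg_left h1 (by positivity))

/-- The coefficient of the errors in the energy estimates. It has a bounded antiderivative `Fw`,
uniformly in all the parameters. -/
def fw (ρ k l η t : ℝ) : ℝ := aw k l * uw k l η t ^ 5 + nw ρ k η t

theorem fw_nonneg {ρ : ℝ} (hρ : 0 < ρ) (hk : 1 ≤ |k|) (t : ℝ) : 0 ≤ fw ρ k l η t := by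
  have := nw_nonneg (k := k) (η := η) hρ t
  have := aw_nonneg (k := k) (l := l)
  have := uw_pos (l := l) (η := η) hk t
  rw [fw]; positivity

/-- An antiderivative of `fw`. -/
def Fw (ρ k l η t : ℝ) : ℝ :=
  -(k / |k|) * ghost ((η - k * t) / kap k l) + Real.arctan (ρ * (t - η / k))

theorem hasDerivAt_Fw {ρ : ℝ} (hk : 1 ≤ |k|) (t : ℝ) :
    HasDerivAt (Fw ρ k l η) (fw ρ k l η t) t := by
  have hκ := one_le_kap (l := l) hk
  have h1 := ((hasDerivAt_ghost ((η - k * t) / kap k l)).comp t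
    ((hasDerivAt_sub_mul (k := k) (η := η) t).div_const (kap k l))).const_mul (-(k / |k|))
  have h2 : HasDerivAt (fun t => ρ * (t - η / k)) (ρ * 1) t :=
    ((hasDerivAt_id t).sub_const (η / k)).const_mul ρ
  refine (h1.add h2.arctan).congr_deriv ?_
  have h3 : 1 + ((η - k * t) / kap k l) ^ 2 = gw k l η t ^ 8 := by
    rw [gw_pow hk, symb, ← kap_sq]; field_simp
  have hg := one_le_gw (l := l) (η := η) hk t
  have h4 : (1 + ((η - k * t) / kap k l) ^ 2) ^ (-(5 / 8) : ℝ) = uw k l η t ^ 5 := by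
    rw [h3, uw, ← Real.rpow_natCast, ← Real.rpow_mul (by positivity), inv_pow,
      ← Real.rpow_natCast, ← Real.rpow_neg (by positivity)]
    norm_num
  have h5 : k / |k| * k = |k| := by
    have : |k| ≠ 0 := by positivity
    field_simp; rw [sq_abs]
  have h6 : -(k / |k|) * (uw k l η t ^ 5 * (-k / kap k l)) = aw k l * uw k l η t ^ 5 := by
    rw [aw]
    linear_combination (uw k l η t ^ 5 / kap k l) * h5
  rw [h4, h6, fw, nw]
  ring

theorem exists_abs_Fw_le : ∃ M : ℝ, 0 ≤ M ∧ ∀ ρ k l η t : ℝ, 1 ≤ |k| → |Fw ρ k l η t| ≤ M := by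
  obtain ⟨M, hM, h⟩ := exists_abs_ghost_le
  refine ⟨M + 2, by linarith, fun ρ k l η t hk => ?_⟩
  rw [Fw]
  refine (abs_add_le _ _).trans ?_
  have h1 : |-(k / |k|) * ghost ((η - k * t) / kap k l)| ≤ M := by
    rw [abs_mul, abs_neg, abs_div, abs_abs, div_self (by positivity), one_mul]
    exact h _
  have h2 : |Real.arctan (ρ * (t - η / k))| ≤ 2 := by
    have := Real.neg_pi_div_two_lt_arctan (ρ * (t - η / k))
    have := Real.arctan_lt_pi_div_two (ρ * (t - η / k))
    have := Real.pi_le_four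
    rw [abs_le]; constructor <;> linarith
  linarith

theorem rlog_nonpos (hk : 1 ≤ |k|) {t : ℝ} (ht : t ≤ η / k) : rlog k l η t ≤ 0 := by
  have hp := symb_pos (l := l) (η := η) hk t
  rw [rlog, sub_mul_eq hk]
  apply div_nonpos_of_nonpos_of_nonneg _ hp.le
  nlinarith [mul_nonneg (sq_nonneg k) (sub_nonneg.2 ht)]

theorem rlog_nonneg (hk : 1 ≤ |k|) {t : ℝ} (ht : η / k ≤ t) : 0 ≤ rlog k l η t := by
  have hp := symb_pos (l := l) (η := η) hk t
  rw [rlog, sub_mul_eq hk]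
  apply div_nonneg _ hp.le
  nlinarith [mul_nonneg (sq_nonneg k) (sub_nonneg.2 ht)]

end Weights

/-! ### The acoustic waves and the good unknown -/

/-- The velocity divergence divided by `p`. -/
def dvar (k l η : ℝ) (V₁ V₂ V₃ : ℝ → ℝ) (t : ℝ) : ℝ :=
  (k * V₁ t + (η - k * t) * V₂ t + l * V₃ t) / symb k l η t

/-- The good unknown: a combination of `Δ u² - ∂_y div u` and `∂ₓ b` which is driven, apart from its
dissipation, only by `μ ∂ₓ Δ b`. -/
def wvar (k l η : ℝ) (B V₁ V₂ V₃ : ℝ → ℝ) (t : ℝ) : ℝ :=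
  (η - k * t) * (k * V₁ t + (η - k * t) * V₂ t + l * V₃ t) - symb k l η t * V₂ t - k * B t

section

variable {ε ρ ν k l η : ℝ} {B V₁ V₂ V₃ : ℝ → ℝ}

theorem IsMode.hasDerivAt_B (h : IsMode ε ρ ν k l η B V₁ V₂ V₃) (hk : 1 ≤ |k|) (t : ℝ) :
    HasDerivAt B (-(symb k l η t * dvar k l η V₁ V₂ V₃ t)) t := by
  have hp := symb_pos (l := l) (η := η) hk t
  refine (h.B' t).congr_deriv ?_
  rw [dvar]; field_simp

theorem IsMode.hasDerivAt_div (h : IsMode ε ρ ν k l η B V₁ V₂ V₃) (t : ℝ) :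
    HasDerivAt (fun t => k * V₁ t + (η - k * t) * V₂ t + l * V₃ t)
      (-2 * k * V₂ t + symb k l η t * B t / ε ^ 2
        - ν * symb k l η t * (k * V₁ t + (η - k * t) * V₂ t + l * V₃ t)) t := by
  refine ((((h.V₁' t).const_mul k).add ((hasDerivAt_sub_mul (k := k) (η := η) t).mul (h.V₂' t))).add
    ((h.V₃' t).const_mul l)).congr_deriv ?_
  rw [symb]; ring

theorem IsMode.hasDerivAt_dvar (h : IsMode ε ρ ν k l η B V₁ V₂ V₃) (hk : 1 ≤ |k|) (t : ℝ) :
    HasDerivAt (dvar k l η V₁ V₂ V₃) (B t / ε ^ 2 - ν * symb k l η t * dvar k l η V₁ V₂ V₃ t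
      + 2 * (k * wvar k l η B V₁ V₂ V₃ t + k ^ 2 * B t) / symb k l η t ^ 2) t := by
  have hp := symb_pos (l := l) (η := η) hk t
  refine ((h.hasDerivAt_div t).div (hasDerivAt_symb t) hp.ne').congr_deriv ?_
  rw [dvar, wvar]
  field_simp
  ring

theorem IsMode.hasDerivAt_wvar (h : IsMode ε ρ ν k l η B V₁ V₂ V₃) (t : ℝ) :
    HasDerivAt (wvar k l η B V₁ V₂ V₃)
      (-(ρ ^ 3 * symb k l η t) * (wvar k l η B V₁ V₂ V₃ t + k * B t)) t := by
  refine ((((hasDerivAt_sub_mul (k := k) (η := η) t).mul (h.hasDerivAt_div t)).sub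
    ((hasDerivAt_symb t).mul (h.V₂' t))).sub ((h.B' t).const_mul k)).congr_deriv ?_
  rw [wvar]
  ring

/-- The energy of the acoustic waves, without its lower order corrections. -/
def ener (ε k l η : ℝ) (B V₁ V₂ V₃ : ℝ → ℝ) (t : ℝ) : ℝ :=
  (B t / ε) ^ 2 + symb k l η t * dvar k l η V₁ V₂ V₃ t ^ 2

/-- The energy of the acoustic waves. The term with `bw` accounts for the adiabatic change of their
frequency `p^{1/2} / ε`, the term with `ρ` for the damping of `B`. -/
def energ (ε ρ k l η : ℝ) (B V₁ V₂ V₃ : ℝ → ℝ) (t : ℝ) : ℝ :=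
  ener ε k l η B V₁ V₂ V₃ t + (bw ε k l η t - ρ) * B t * dvar k l η V₁ V₂ V₃ t

/-- The energy of the acoustic waves together with the good unknown. -/
def fullEner (ε ρ k l η : ℝ) (B V₁ V₂ V₃ : ℝ → ℝ) (t : ℝ) : ℝ :=
  kap k l ^ 4 * gw k l η t ^ 14 * energ ε ρ k l η B V₁ V₂ V₃ t + wvar k l η B V₁ V₂ V₃ t ^ 2

theorem ener_le_energ (hp : Admissible ε ρ ν) (hk : 1 ≤ |k|) (t : ℝ) :
    3 / 4 * ener ε k l η B V₁ V₂ V₃ t ≤ energ ε ρ k l η B V₁ V₂ V₃ t ∧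
    energ ε ρ k l η B V₁ V₂ V₃ t ≤ 5 / 4 * ener ε k l η B V₁ V₂ V₃ t := by
  have hε := hp.ε_pos
  have hρ := hp.ρ_pos
  set d := dvar k l η V₁ V₂ V₃ t with hd
  set P := Pw k l η t with hP
  have hP0 : 0 < P := Pw_pos hk t
  have hpP : symb k l η t * P ^ 2 = 1 := symb_mul_Pw hk t
  have hP1 : P ≤ 1 := by
    have h1 := Pw_mul_kap (l := l) (η := η) hk t
    have h2 := one_le_kap (l := l) hk
    have h3 : uw k l η t ^ 4 ≤ 1 := pow_le_one₀ (uw_pos hk t).le (uw_le_one hk t)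
    rw [← hP] at h1
    nlinarith
  set b := B t / ε with hb
  have hB : B t = ε * b := by rw [hb]; field_simp
  set δ := d / P with hδ
  have hdδ : d = P * δ := by rw [hδ]; field_simp
  have hE : ener ε k l η B V₁ V₂ V₃ t = b ^ 2 + δ ^ 2 := by
    rw [ener, ← hd, hdδ]; linear_combination δ ^ 2 * hpP
  have hcross : |(bw ε k l η t - ρ) * B t * d| ≤ (b ^ 2 + δ ^ 2) / 4 := by
    have hbδ : |b * δ| ≤ (b ^ 2 + δ ^ 2) / 2 := by
      rw [abs_le]; constructor <;> linarith [sq_nonneg (b + δ), sq_nonneg (b - δ)]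
    have h2 : (bw ε k l η t - ρ) * B t * d = ((bw ε k l η t - ρ) * (ε * P)) * (b * δ) := by
      rw [hB, hdδ]; ring
    have h3 : |(bw ε k l η t - ρ) * (ε * P)| ≤ 1 / 2 := by
      rw [abs_mul, abs_of_pos (mul_pos hε hP0)]
      have h4 : |bw ε k l η t - ρ| ≤ |bw ε k l η t| + ρ := by
        have := abs_sub (bw ε k l η t) ρ
        rwa [abs_of_pos hρ] at this
      have h5 : ρ * (ε * P) ≤ 1 / 4 := by
        rw [← mul_assoc]
        exact (mul_le_of_le_one_right (by positivity) hP1).trans hp.ρε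
      have h6 : |bw ε k l η t - ρ| * (ε * P) ≤ (|bw ε k l η t| + ρ) * (ε * P) :=
        mul_le_mul_of_nonneg_right h4 (by positivity)
      have h7 := abs_bw_mul_le (l := l) (η := η) hε hk t
      rw [← hP] at h7
      linarith
    rw [h2]
    exact (abs_mul_le_mul h3 hbδ).trans (by linarith)
  have := abs_le.1 hcross
  rw [energ, ← hd, hE]
  constructor <;> linarith

theorem ener_nonneg (hk : 1 ≤ |k|) (t : ℝ) : 0 ≤ ener ε k l η B V₁ V₂ V₃ t := by
  have := symb_pos (l := l) (η := η) hk t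
  rw [ener]; positivity

/-- The derivative of the energy, in the variables `b = B / ε` and `δ = p^{1/2} d`. -/
theorem IsMode.hasDerivAt_energ (h : IsMode ε ρ ν k l η B V₁ V₂ V₃) (hε : 0 < ε) (hk : 1 ≤ |k|)
    (t : ℝ) :
    ∃ b δ e', B t = ε * b ∧ dvar k l η V₁ V₂ V₃ t = Pw k l η t * δ ∧
      energ ε ρ k l η B V₁ V₂ V₃ t =
        b ^ 2 + δ ^ 2 + (bw ε k l η t - ρ) * (ε * b) * (Pw k l η t * δ) ∧
      HasDerivAt (energ ε ρ k l η B V₁ V₂ V₃) e' t ∧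
      e' = rlog k l η t * δ ^ 2 - 2 * ν * symb k l η t * δ ^ 2
        + 4 * Pw k l η t ^ 2 * (k * wvar k l η B V₁ V₂ V₃ t + k ^ 2 * (ε * b)) * (Pw k l η t * δ)
        + dbw ε k l η t * (ε * b) * (Pw k l η t * δ) + (bw ε k l η t - ρ) * (b ^ 2 - δ ^ 2)
        - (bw ε k l η t - ρ) * ν * symb k l η t * (ε * b) * (Pw k l η t * δ)
        + 2 * (bw ε k l η t - ρ) * Pw k l η t ^ 4 * (ε * b)
          * (k * wvar k l η B V₁ V₂ V₃ t + k ^ 2 * (ε * b)) := by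
  have hp := symb_pos (l := l) (η := η) hk t
  have hP0 : 0 < Pw k l η t := Pw_pos hk t
  have hpP : symb k l η t * Pw k l η t ^ 2 = 1 := symb_mul_Pw hk t
  have hB := h.hasDerivAt_B hk t
  have hd := h.hasDerivAt_dvar hk t
  have hB' : B t = ε * (B t / ε) := by field_simp
  have hd' : dvar k l η V₁ V₂ V₃ t = Pw k l η t * (dvar k l η V₁ V₂ V₃ t / Pw k l η t) := by
    field_simp
  have hE := ((((hB.div_const ε).pow 2).add
    ((hasDerivAt_symb (k := k) (l := l) (η := η) t).mul (hd.pow 2))).add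
    ((((hasDerivAt_bw (l := l) (η := η) hε hk t).sub_const ρ).mul hB).mul hd))
  refine ⟨B t / ε, dvar k l η V₁ V₂ V₃ t / Pw k l η t, _, hB', hd', ?_, hE, ?_⟩
  · rw [energ, ener, ← hd', ← hB']
    generalize dvar k l η V₁ V₂ V₃ t = d
    have h3 : symb k l η t * d ^ 2 = (d / Pw k l η t) ^ 2 := by
      rw [div_pow, eq_div_iff (by positivity)]; linear_combination d ^ 2 * hpP
    rw [h3]
  · have hr : rlog k l η t = -2 * k * (η - k * t) * Pw k l η t ^ 2 := by
      rw [rlog, div_eq_iff hp.ne']; linear_combination (2 * k * (η - k * t)) * hpP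
    have hsy : symb k l η t = 1 / Pw k l η t ^ 2 := by
      rw [eq_div_iff (by positivity)]; exact hpP
    rw [hr]
    simp only [Pi.mul_apply, Pi.pow_apply, Nat.cast_ofNat, Nat.add_one_sub_one, pow_one]
    rw [hsy]
    field_simp
    ring

/-- The constant in front of the integrable errors in the energy estimate. -/
def errC (ε : ℝ) : ℝ := 10 + 40 * ε + 20 * ε ^ 2

/-- The differential inequality for `p^{α - 7/4}` times the full energy. The conditions on `α` say
that the weight is admissible for the sign of `p'`: `α = 7/4` is used before the critical time,
where `p' ≤ 0`, and `α = -1/2` after it. -/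
theorem IsMode.hasDerivAt_fullEner (h : IsMode ε ρ ν k l η B V₁ V₂ V₃) (hp : Admissible ε ρ ν)
    (hk : 1 ≤ |k|) (t : ℝ) {α : ℝ} (hα : |α| ≤ 7 / 4) (hαr : (α + 1 / 2) * rlog k l η t ≤ 0)
    (hαr' : (α - 7 / 4) * rlog k l η t ≤ 0) :
    ∃ X', HasDerivAt (fullEner ε ρ k l η B V₁ V₂ V₃) X' t ∧
      X' + (α - 7 / 4) * rlog k l η t * fullEner ε ρ k l η B V₁ V₂ V₃ t ≤
        (-(2 / 5 * ρ) + errC ε * fw ρ k l η t) * fullEner ε ρ k l η B V₁ V₂ V₃ t := by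
  obtain ⟨b, δ, e', hB, hd, he, hE, he'⟩ := h.hasDerivAt_energ hp.ε_pos hk t
  have hw := h.hasDerivAt_wvar t
  have hg := hasDerivAt_gw (l := l) (η := η) hk t
  refine ⟨_, (((hg.pow 14).const_mul (kap k l ^ 4)).mul hE).add (hw.pow 2), ?_⟩
  have hνp : 4 / 3 * (ρ - nw ρ k η t) ≤ ν * symb k l η t := by
    have h1 := sub_nw_le (l := l) (η := η) hp.ρ_pos hk t
    have h2 := mul_le_mul_of_nonneg_right hp.le_ν (symb_pos (l := l) (η := η) hk t).le
    linarith
  have hν : 0 < ν := by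
    have := hp.le_ν
    have := pow_pos hp.ρ_pos 3
    linarith
  have key := weighted_energy_ineq (b := b) (δ := δ) (w := wvar k l η B V₁ V₂ V₃ t) hp.ε_pos
    hp.ρ_pos hp.ρ_le hp.ρε hν hp.ν_le hp.ρν (aw_nonneg (k := k) (l := l)) aw_le_one
    (uw_pos (l := l) (η := η) hk t) (uw_mul_gw hk t) (one_le_kap hk) (Pw_mul_kap hk t)
    (symb_mul_Pw hk t) (abs_k_eq hk) (abs_rlog_le hk t) hα hαr hαr' (abs_bw_le hp.ε_pos hk t)
    (abs_bw_mul_le hp.ε_pos hk t) (uw_le_one hk t) (abs_dbw_le hp.ε_pos hk t)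
    (nw_nonneg hp.ρ_pos t) (abs_bw_sub_le hp.ε_pos hk t) hνp (sub_nw_le hp.ρ_pos hk t)
  rw [← he] at key
  have hX : fullEner ε ρ k l η B V₁ V₂ V₃ t
      = kap k l ^ 4 * gw k l η t ^ 14 * energ ε ρ k l η B V₁ V₂ V₃ t
        + wvar k l η B V₁ V₂ V₃ t ^ 2 := rfl
  rw [hX, errC, fw]
  refine le_trans (le_of_eq ?_) key
  simp only [Pi.pow_apply, hB]
  rw [he']
  ring

end

/-! ### Decay of the acoustic waves -/

section

variable {ε ρ ν k l η : ℝ} {B V₁ V₂ V₃ : ℝ → ℝ}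

/-- The square `p(0)² (|B(0)|² + |V(0)|²)` of the size of two derivatives of the data. -/
def dataSq (k l η : ℝ) (B V₁ V₂ V₃ : ℝ → ℝ) : ℝ :=
  symb k l η 0 ^ 2 * (B 0 ^ 2 + V₁ 0 ^ 2 + V₂ 0 ^ 2 + V₃ 0 ^ 2)

theorem dataSq_nonneg : 0 ≤ dataSq k l η B V₁ V₂ V₃ := by rw [dataSq]; positivity

theorem div_sq_le (t : ℝ) : (k * V₁ t + (η - k * t) * V₂ t + l * V₃ t) ^ 2 ≤
    symb k l η t * (V₁ t ^ 2 + V₂ t ^ 2 + V₃ t ^ 2) := by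
  rw [symb]
  linarith [sq_nonneg (k * V₂ t - (η - k * t) * V₁ t), sq_nonneg (k * V₃ t - l * V₁ t),
    sq_nonneg ((η - k * t) * V₃ t - l * V₂ t)]

theorem one_le_symb (hk : 1 ≤ |k|) (t : ℝ) : 1 ≤ symb k l η t := by
  rw [symb, ← sq_abs k]; nlinarith [sq_nonneg l, sq_nonneg (η - k * t)]

theorem ener_zero_le (hε : 0 < ε) (hk : 1 ≤ |k|) : ener ε k l η B V₁ V₂ V₃ 0 ≤
    (1 / ε ^ 2 + 1) * (B 0 ^ 2 + V₁ 0 ^ 2 + V₂ 0 ^ 2 + V₃ 0 ^ 2) := by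
  have hp := symb_pos (l := l) (η := η) hk 0
  have h1 : symb k l η 0 * dvar k l η V₁ V₂ V₃ 0 ^ 2 ≤ V₁ 0 ^ 2 + V₂ 0 ^ 2 + V₃ 0 ^ 2 := by
    have h2 := div_sq_le (k := k) (l := l) (η := η) (V₁ := V₁) (V₂ := V₂) (V₃ := V₃) 0
    have h3 : symb k l η 0 * dvar k l η V₁ V₂ V₃ 0 ^ 2 =
        (k * V₁ 0 + (η - k * 0) * V₂ 0 + l * V₃ 0) ^ 2 / symb k l η 0 := by
      rw [dvar]; field_simp
    rw [h3, div_le_iff₀ hp]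
    linarith
  have h2 : (B 0 / ε) ^ 2 = 1 / ε ^ 2 * B 0 ^ 2 := by field_simp
  rw [ener, h2]
  have h3 : 0 ≤ 1 / ε ^ 2 * (V₁ 0 ^ 2 + V₂ 0 ^ 2 + V₃ 0 ^ 2) := by positivity
  linarith [sq_nonneg (B 0)]

theorem wvar_zero_sq_le (hk : 1 ≤ |k|) :
    wvar k l η B V₁ V₂ V₃ 0 ^ 2 ≤ 6 * dataSq k l η B V₁ V₂ V₃ := by
  have hp := one_le_symb (l := l) (η := η) hk 0
  have h2 := div_sq_le (k := k) (l := l) (η := η) (V₁ := V₁) (V₂ := V₂) (V₃ := V₃) 0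
  set p := symb k l η 0 with hpd
  set D := k * V₁ 0 + (η - k * 0) * V₂ 0 + l * V₃ 0 with hD
  have hs : (η - k * 0) ^ 2 ≤ p := by rw [hpd, symb]; linarith [sq_nonneg k, sq_nonneg l]
  have hks : k ^ 2 ≤ p ^ 2 := by
    have : k ^ 2 ≤ p := by rw [hpd, symb]; linarith [sq_nonneg (η - k * 0), sq_nonneg l]
    nlinarith
  have h3 : ((η - k * 0) * D) ^ 2 ≤ p ^ 2 * (V₁ 0 ^ 2 + V₂ 0 ^ 2 + V₃ 0 ^ 2) := by
    rw [mul_pow]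
    calc _ ≤ p * (p * (V₁ 0 ^ 2 + V₂ 0 ^ 2 + V₃ 0 ^ 2)) := by gcongr
      _ = _ := by ring
  have h4 : (k * B 0) ^ 2 ≤ p ^ 2 * B 0 ^ 2 := by rw [mul_pow]; gcongr
  have h5 : wvar k l η B V₁ V₂ V₃ 0 = (η - k * 0) * D - p * V₂ 0 - k * B 0 := by
    rw [wvar]
  have h6 : (p * V₂ 0) ^ 2 = p ^ 2 * V₂ 0 ^ 2 := mul_pow _ _ _
  have h7 : ((η - k * 0) * D - p * V₂ 0 - k * B 0) ^ 2 ≤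
      3 * (((η - k * 0) * D) ^ 2 + (p * V₂ 0) ^ 2 + (k * B 0) ^ 2) := by
    generalize (η - k * 0) * D = x
    generalize p * V₂ 0 = y
    generalize k * B 0 = z
    linarith [sq_nonneg (x + y), sq_nonneg (x + z), sq_nonneg (y - z)]
  rw [h5, dataSq, ← hpd]
  have h8 : 0 ≤ p ^ 2 * V₁ 0 ^ 2 := by positivity
  have h9 : 0 ≤ p ^ 2 * V₂ 0 ^ 2 := by positivity
  have h10 : 0 ≤ p ^ 2 * V₃ 0 ^ 2 := by positivity
  have h11 : 0 ≤ p ^ 2 * B 0 ^ 2 := by positivity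
  linarith

/-- The weight of the energy is controlled by two derivatives of the data. -/
theorem kap_gw_le (hk : 1 ≤ |k|) (t : ℝ) : kap k l ^ 4 * gw k l η t ^ 14 ≤ symb k l η t ^ 2 := by
  have hg := one_le_gw (l := l) (η := η) hk t
  rw [symb_eq_gw hk, mul_pow, ← pow_mul, ← pow_mul]
  apply mul_le_mul_of_nonneg_left (pow_le_pow_right₀ hg (by norm_num)) (by positivity)

theorem fullEner_nonneg (hp : Admissible ε ρ ν) (hk : 1 ≤ |k|) (t : ℝ) :
    0 ≤ fullEner ε ρ k l η B V₁ V₂ V₃ t := by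
  have h := (ener_le_energ (l := l) (η := η) (B := B) (V₁ := V₁) (V₂ := V₂) (V₃ := V₃) hp hk t).1
  have h1 : 0 ≤ ener ε k l η B V₁ V₂ V₃ t := ener_nonneg hk t
  have h2 : 0 ≤ energ ε ρ k l η B V₁ V₂ V₃ t := by linarith
  have hg := one_le_gw (l := l) (η := η) hk t
  rw [fullEner]; positivity

theorem fullEner_zero_le (hp : Admissible ε ρ ν) (hk : 1 ≤ |k|) :
    fullEner ε ρ k l η B V₁ V₂ V₃ 0 ≤
      (5 / 4 * (1 / ε ^ 2 + 1) + 6) * dataSq k l η B V₁ V₂ V₃ := by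
  have h1 := (ener_le_energ (l := l) (η := η) (B := B) (V₁ := V₁) (V₂ := V₂) (V₃ := V₃) hp hk 0).2
  have h2 := ener_zero_le (l := l) (η := η) (B := B) (V₁ := V₁) (V₂ := V₂) (V₃ := V₃) hp.ε_pos hk
  have h3 := wvar_zero_sq_le (l := l) (η := η) (B := B) (V₁ := V₁) (V₂ := V₂) (V₃ := V₃) hk
  have h4 := kap_gw_le (l := l) (η := η) hk 0
  have h5 : 0 ≤ ener ε k l η B V₁ V₂ V₃ 0 := ener_nonneg hk 0
  have hg := one_le_gw (l := l) (η := η) hk 0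
  have hε := hp.ε_pos
  have h6 : kap k l ^ 4 * gw k l η 0 ^ 14 * energ ε ρ k l η B V₁ V₂ V₃ 0 ≤
      5 / 4 * (1 / ε ^ 2 + 1) * dataSq k l η B V₁ V₂ V₃ := by
    calc _ ≤ kap k l ^ 4 * gw k l η 0 ^ 14 * (5 / 4 * ener ε k l η B V₁ V₂ V₃ 0) := by gcongr
      _ ≤ symb k l η 0 ^ 2 * (5 / 4 * ((1 / ε ^ 2 + 1) *
          (B 0 ^ 2 + V₁ 0 ^ 2 + V₂ 0 ^ 2 + V₃ 0 ^ 2))) := by gcongr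
      _ = _ := by rw [dataSq]; ring
  rw [fullEner]
  linarith

/-- Before the critical time `η / k` the full energy decays. -/
theorem IsMode.fullEner_le_of_le_crit (h : IsMode ε ρ ν k l η B V₁ V₂ V₃) (hp : Admissible ε ρ ν)
    (hk : 1 ≤ |k|) {M : ℝ} (hM : ∀ ρ k l η t : ℝ, 1 ≤ |k| → |Fw ρ k l η t| ≤ M) {t : ℝ}
    (ht : 0 ≤ t) (htc : t ≤ η / k) :
    fullEner ε ρ k l η B V₁ V₂ V₃ t ≤ Real.exp (2 * (errC ε * M)) *
      fullEner ε ρ k l η B V₁ V₂ V₃ 0 * Real.exp (-(1 / 3 * ρ * t)) := by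
  have hC : 0 ≤ errC ε := by have := hp.ε_pos; rw [errC]; positivity
  have hder : ∀ s ∈ Icc 0 t, ∃ X', HasDerivAt (fullEner ε ρ k l η B V₁ V₂ V₃) X' s ∧
      X' ≤ (-(2 / 5 * ρ) + errC ε * fw ρ k l η s) * fullEner ε ρ k l η B V₁ V₂ V₃ s := by
    intro s hs
    have hr := rlog_nonpos (l := l) (η := η) hk (hs.2.trans htc)
    obtain ⟨X', h1, h2⟩ := h.hasDerivAt_fullEner hp hk s (α := 7 / 4) (by norm_num [abs_of_pos])
      (by linarith) (by linarith)
    exact ⟨X', h1, by linarith⟩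
  choose! X' h1 h2 using hder
  have := exp_decay_of_hasDerivAt_le (X := fullEner ε ρ k l η B V₁ V₂ V₃) (X' := X')
    (F := fun s => errC ε * Fw ρ k l η s) (f := fun s => errC ε * fw ρ k l η s)
    (q := 1 / 3) (q₁ := 2 / 5) (A := 0) (M := errC ε * M) hp.ρ_pos (by norm_num) le_rfl ht
    h1 (fun s _ => (hasDerivAt_Fw hk s).const_mul _)
    (fun s _ => mul_nonneg hC (fw_nonneg hp.ρ_pos hk s))
    (fun s _ => by
      rw [abs_mul, abs_of_nonneg hC]; exact mul_le_mul_of_nonneg_left (hM ρ k l η s hk) hC)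
    (fullEner_nonneg hp hk 0) (fun s hs => by simpa using h2 s hs)
  simpa using this

/-- After the critical time `η / k` the full energy decays once it is multiplied by `u¹⁸`, which is
a constant multiple of `p^{-9/4}`. -/
theorem IsMode.fullEner_le_of_crit_le (h : IsMode ε ρ ν k l η B V₁ V₂ V₃) (hp : Admissible ε ρ ν)
    (hk : 1 ≤ |k|) {M : ℝ} (hM : ∀ ρ k l η t : ℝ, 1 ≤ |k| → |Fw ρ k l η t| ≤ M) {t₀ t : ℝ}
    (htc : η / k ≤ t₀) (ht : t₀ ≤ t) :
    uw k l η t ^ 18 * fullEner ε ρ k l η B V₁ V₂ V₃ t ≤ Real.exp (2 * (errC ε * M)) *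
      (Real.exp (1 / 3 * ρ * t₀) * (uw k l η t₀ ^ 18 * fullEner ε ρ k l η B V₁ V₂ V₃ t₀))
        * Real.exp (-(1 / 3 * ρ * t)) := by
  have hC : 0 ≤ errC ε := by have := hp.ε_pos; rw [errC]; positivity
  have hder : ∀ s ∈ Icc t₀ t, ∃ X',
      HasDerivAt (fun s => uw k l η s ^ 18 * fullEner ε ρ k l η B V₁ V₂ V₃ s) X' s ∧
      X' ≤ (-(2 / 5 * ρ) + errC ε * fw ρ k l η s) *
        (uw k l η s ^ 18 * fullEner ε ρ k l η B V₁ V₂ V₃ s) := by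
    intro s hs
    have hr := rlog_nonneg (l := l) (η := η) hk (htc.trans hs.1)
    obtain ⟨X', h1, h2⟩ := h.hasDerivAt_fullEner hp hk s (α := -1 / 2)
      (by norm_num [abs_of_neg]) (by linarith) (by linarith)
    refine ⟨_, ((hasDerivAt_uw (l := l) (η := η) hk s).pow 18).mul h1, ?_⟩
    have hu := uw_pos (l := l) (η := η) hk s
    have h3 := mul_le_mul_of_nonneg_left h2 (pow_pos hu 18).le
    refine le_trans (le_of_eq ?_) (h3.trans (le_of_eq ?_))
    · simp only [Pi.pow_apply]; push_cast; ring
    · ring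
  choose! X' h1 h2 using hder
  have h0 : 0 ≤ uw k l η t₀ ^ 18 * fullEner ε ρ k l η B V₁ V₂ V₃ t₀ :=
    mul_nonneg (pow_pos (uw_pos hk t₀) 18).le (fullEner_nonneg hp hk t₀)
  have := exp_decay_of_hasDerivAt_le
    (X := fun s => uw k l η s ^ 18 * fullEner ε ρ k l η B V₁ V₂ V₃ s) (X' := X')
    (F := fun s => errC ε * Fw ρ k l η s) (f := fun s => errC ε * fw ρ k l η s)
    (q := 1 / 3) (q₁ := 2 / 5) (A := 0) (M := errC ε * M) hp.ρ_pos (by norm_num) le_rfl ht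
    h1 (fun s _ => (hasDerivAt_Fw hk s).const_mul _)
    (fun s _ => mul_nonneg hC (fw_nonneg hp.ρ_pos hk s))
    (fun s _ => by
      rw [abs_mul, abs_of_nonneg hC]; exact mul_le_mul_of_nonneg_left (hM ρ k l η s hk) hC)
    h0 (fun s hs => by simpa using h2 s hs)
  simpa using this

theorem symb_le (t : ℝ) (ht : 0 ≤ t) : symb k l η t ≤ 2 * (1 + t) ^ 2 * symb k l η 0 := by
  have h1 : (η - k * t) ^ 2 ≤ 2 * η ^ 2 + 2 * (k ^ 2 * t ^ 2) := by
    linarith [sq_nonneg (η + k * t)]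
  have h2 : 0 ≤ t * (k ^ 2 + l ^ 2 + η ^ 2) := by positivity
  have h3 : 0 ≤ t ^ 2 * (l ^ 2 + η ^ 2) := by positivity
  simp only [symb, mul_zero, sub_zero]
  linarith [sq_nonneg k, sq_nonneg l, sq_nonneg η]

theorem gw_pow_four_le (hk : 1 ≤ |k|) {t : ℝ} (ht : 0 ≤ t) :
    gw k l η t ^ 4 * uw k l η 0 ^ 4 ≤ 2 * (1 + t) := by
  have hκ := one_le_kap (l := l) hk
  have hg0 := uw_mul_gw (l := l) (η := η) hk 0
  have hu := uw_pos (l := l) (η := η) hk 0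
  have h2 : gw k l η t ^ 8 ≤ 2 * (1 + t) ^ 2 * gw k l η 0 ^ 8 := by
    have h1 := symb_le (k := k) (l := l) (η := η) t ht
    rw [symb_eq_gw hk, symb_eq_gw hk] at h1
    have hκ2 : 0 < kap k l ^ 2 := by positivity
    nlinarith
  have h3 : (gw k l η t ^ 4 * uw k l η 0 ^ 4) ^ 2 ≤ (2 * (1 + t)) ^ 2 := by
    calc (gw k l η t ^ 4 * uw k l η 0 ^ 4) ^ 2 = gw k l η t ^ 8 * uw k l η 0 ^ 8 := by ring
      _ ≤ 2 * (1 + t) ^ 2 * gw k l η 0 ^ 8 * uw k l η 0 ^ 8 := by gcongr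
      _ = 2 * (1 + t) ^ 2 * (uw k l η 0 * gw k l η 0) ^ 8 := by ring
      _ ≤ (2 * (1 + t)) ^ 2 := by rw [hg0]; nlinarith [sq_nonneg (1 + t)]
  exact le_of_sq_le_sq h3 (by positivity)

theorem gw_pow_four_le_of_crit (hk : 1 ≤ |k|) {t : ℝ} (htc : 0 ≤ η / k) (ht : η / k ≤ t) :
    gw k l η t ^ 4 ≤ 1 + t := by
  have hκ := one_le_kap (l := l) hk
  have hκ2 : 0 < kap k l ^ 2 := by positivity
  have h1 : symb k l η t ≤ kap k l ^ 2 * (1 + t) ^ 2 := by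
    rw [symb_eq, sub_mul_eq hk]
    have h2 : (η / k - t) ^ 2 ≤ t ^ 2 := by nlinarith
    have h3 : k ^ 2 ≤ kap k l ^ 2 := by rw [kap_sq]; linarith [sq_nonneg l]
    have h4 : (k * (η / k - t)) ^ 2 ≤ kap k l ^ 2 * t ^ 2 := by rw [mul_pow]; gcongr
    have h5 : 0 ≤ kap k l ^ 2 * t := mul_nonneg hκ2.le (htc.trans ht)
    linarith
  rw [symb_eq_gw hk] at h1
  have h3 : (gw k l η t ^ 4) ^ 2 ≤ (1 + t) ^ 2 := by
    rw [← pow_mul]; exact le_of_mul_le_mul_left h1 hκ2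
  exact le_of_sq_le_sq h3 (by linarith)

theorem uw_crit (hk : 1 ≤ |k|) : uw k l η (η / k) = 1 := by
  have hκ := one_le_kap (l := l) hk
  have h0 : k ^ 2 + l ^ 2 ≠ 0 := by rw [← kap_sq]; positivity
  rw [uw, gw, symb, sub_mul_eq hk, sub_self, mul_zero, zero_pow two_ne_zero, add_zero, div_self h0,
    Real.one_rpow, inv_one]

end

/-- The energy of the acoustic waves grows at most like `g⁴ ~ p^{1/2}`. The factor `y` records the
gain from the smallness of the data at a large frequency `η` with `η / k < 0`, or from the decay
of `p` before the critical time. -/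
theorem exists_ener_le (ε : ℝ) (hε : 0 < ε) : ∃ C : ℝ, 0 ≤ C ∧ ∀ ρ ν k l η : ℝ,
    ∀ B V₁ V₂ V₃ : ℝ → ℝ, Admissible ε ρ ν → 1 ≤ |k| → IsMode ε ρ ν k l η B V₁ V₂ V₃ →
    ∀ t, 0 ≤ t →
      (∃ y, 0 ≤ y ∧ y ≤ 1 ∧ gw k l η t ^ 4 * y ≤ 2 * (1 + t) ∧
        gw k l η t ^ 8 * y ≤ 4 * (1 + t) ^ 2 ∧
        kap k l ^ 4 * ener ε k l η B V₁ V₂ V₃ t ≤ C * dataSq k l η B V₁ V₂ V₃ *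
          Real.exp (-(1 / 3 * ρ * t)) * (gw k l η t ^ 4 * y)) ∧
      (t ≤ η / k → wvar k l η B V₁ V₂ V₃ t ^ 2 ≤ C * dataSq k l η B V₁ V₂ V₃ *
          Real.exp (-(1 / 3 * ρ * t))) := by
  obtain ⟨M, hM0, hM⟩ := exists_abs_Fw_le
  set K := Real.exp (2 * (errC ε * M)) with hK
  have hK1 : 1 ≤ K := by
    rw [hK, Real.one_le_exp_iff, errC]; positivity
  set C₀ := 5 / 4 * (1 / ε ^ 2 + 1) + 6 with hC₀
  have hC₀0 : 0 ≤ C₀ := by positivity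
  have hC : 0 ≤ 4 / 3 * K ^ 2 * C₀ := by positivity
  refine ⟨4 / 3 * K ^ 2 * C₀, hC, fun ρ ν k l η B V₁ V₂ V₃ hp hk h t ht => ?_⟩
  set N := dataSq k l η B V₁ V₂ V₃ with hN
  have hN0 : 0 ≤ N := dataSq_nonneg
  have hu := uw_pos (l := l) (η := η) hk t
  have hu1 := uw_le_one (l := l) (η := η) hk t
  have hg := one_le_gw (l := l) (η := η) hk t
  have hug := uw_mul_gw (l := l) (η := η) hk t
  set E := Real.exp (-(1 / 3 * ρ * t)) with hE
  have hE0 : 0 < E := Real.exp_pos _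
  have hKK : K ≤ K ^ 2 := by nlinarith
  have h0 : fullEner ε ρ k l η B V₁ V₂ V₃ 0 ≤ C₀ * N := fullEner_zero_le hp hk
  have hen : 3 / 4 * ener ε k l η B V₁ V₂ V₃ t ≤ energ ε ρ k l η B V₁ V₂ V₃ t :=
    (ener_le_energ hp hk t).1
  have hfull : kap k l ^ 4 * gw k l η t ^ 14 * (3 / 4 * ener ε k l η B V₁ V₂ V₃ t)
      ≤ fullEner ε ρ k l η B V₁ V₂ V₃ t := by
    rw [fullEner]
    have : kap k l ^ 4 * gw k l η t ^ 14 * (3 / 4 * ener ε k l η B V₁ V₂ V₃ t) ≤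
      kap k l ^ 4 * gw k l η t ^ 14 * energ ε ρ k l η B V₁ V₂ V₃ t := by gcongr
    linarith [sq_nonneg (wvar k l η B V₁ V₂ V₃ t)]
  -- the weight `u¹⁸` turns the bound on `fullEner` into one with `g⁴`
  have hconv : ∀ y Z : ℝ, uw k l η t ^ 18 * fullEner ε ρ k l η B V₁ V₂ V₃ t ≤ Z * y →
      kap k l ^ 4 * ener ε k l η B V₁ V₂ V₃ t ≤ 4 / 3 * Z * (gw k l η t ^ 4 * y) := by
    intro y Z hZ
    have h1 : uw k l η t ^ 18 * gw k l η t ^ 18 = 1 := by rw [← mul_pow, hug, one_pow]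
    have h2 : kap k l ^ 4 * ener ε k l η B V₁ V₂ V₃ t = 4 / 3 * (gw k l η t ^ 4 * (uw k l η t ^ 18 *
        (kap k l ^ 4 * gw k l η t ^ 14 * (3 / 4 * ener ε k l η B V₁ V₂ V₃ t)))) := by
      linear_combination (-(kap k l ^ 4 * ener ε k l η B V₁ V₂ V₃ t)) * h1
    have h3 : uw k l η t ^ 18 * (kap k l ^ 4 * gw k l η t ^ 14 *
        (3 / 4 * ener ε k l η B V₁ V₂ V₃ t)) ≤ Z * y :=
      (mul_le_mul_of_nonneg_left hfull (by positivity)).trans hZ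
    rw [h2]
    calc _ ≤ 4 / 3 * (gw k l η t ^ 4 * (Z * y)) := by gcongr
      _ = _ := by ring
  have hpre : t ≤ η / k → fullEner ε ρ k l η B V₁ V₂ V₃ t ≤ K ^ 2 * C₀ * N * E := by
    intro htc
    calc _ ≤ K * fullEner ε ρ k l η B V₁ V₂ V₃ 0 * E :=
          h.fullEner_le_of_le_crit hp hk hM ht htc
      _ ≤ K ^ 2 * (C₀ * N) * E := by
          gcongr
          exact fullEner_nonneg hp hk 0
      _ = _ := by ring
  have hw : t ≤ η / k →
      wvar k l η B V₁ V₂ V₃ t ^ 2 ≤ 4 / 3 * K ^ 2 * C₀ * N * E := by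
    intro htc
    have h2 := hpre htc
    have h3 : wvar k l η B V₁ V₂ V₃ t ^ 2 ≤ fullEner ε ρ k l η B V₁ V₂ V₃ t := by
      rw [fullEner]
      have h4 : 0 ≤ ener ε k l η B V₁ V₂ V₃ t := ener_nonneg hk t
      have h5 : 0 ≤ energ ε ρ k l η B V₁ V₂ V₃ t := by linarith
      have : 0 ≤ kap k l ^ 4 * gw k l η t ^ 14 * energ ε ρ k l η B V₁ V₂ V₃ t := by positivity
      linarith
    have h4 : 0 ≤ K ^ 2 * C₀ * N * E := by positivity
    linarith
  refine ⟨?_, hw⟩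
  rcases le_total t (η / k) with htc | htc
  · have h2 := hpre htc
    refine ⟨uw k l η t ^ 18, by positivity, pow_le_one₀ hu.le hu1, ?_, ?_, ?_⟩
    · have h3 : gw k l η t ^ 4 * uw k l η t ^ 18 =
          (uw k l η t * gw k l η t) ^ 4 * uw k l η t ^ 14 := by
        ring
      rw [h3, hug, one_pow, one_mul]
      have := pow_le_one₀ (n := 14) hu.le hu1
      linarith
    · have h3 : gw k l η t ^ 8 * uw k l η t ^ 18 =
          (uw k l η t * gw k l η t) ^ 8 * uw k l η t ^ 10 := by
        ring
      rw [h3, hug, one_pow, one_mul]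
      have := pow_le_one₀ (n := 10) hu.le hu1
      nlinarith
    · refine (hconv (uw k l η t ^ 18) (K ^ 2 * C₀ * N * E) ?_).trans (le_of_eq (by ring))
      rw [mul_comm]
      gcongr
  -- after the critical time, the estimate starts at that time if it is positive, else at time `0`
  · rcases le_total 0 (η / k) with h0c | h0c
    · have h1 := h.fullEner_le_of_le_crit hp hk hM h0c le_rfl
      have h2 := h.fullEner_le_of_crit_le hp hk hM le_rfl htc
      rw [uw_crit hk, one_pow, one_mul] at h2
      have hee : Real.exp (1 / 3 * ρ * (η / k)) * Real.exp (-(1 / 3 * ρ * (η / k))) = 1 := by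
        rw [← Real.exp_add]; simp
      refine ⟨1, zero_le_one, le_rfl, ?_, ?_, ?_⟩
      · have := gw_pow_four_le_of_crit (l := l) hk h0c htc
        linarith
      · have := gw_pow_four_le_of_crit (l := l) hk h0c htc
        calc gw k l η t ^ 8 * 1 = (gw k l η t ^ 4) ^ 2 := by ring
          _ ≤ (1 + t) ^ 2 := by gcongr
          _ ≤ _ := by nlinarith [sq_nonneg (1 + t)]
      · refine (hconv 1 (K ^ 2 * C₀ * N * E) ?_).trans (le_of_eq (by ring))
        calc _ ≤ _ := h2
          _ ≤ K * (Real.exp (1 / 3 * ρ * (η / k)) * (K * fullEner ε ρ k l η B V₁ V₂ V₃ 0 *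
              Real.exp (-(1 / 3 * ρ * (η / k))))) * E := by gcongr
          _ = K ^ 2 * fullEner ε ρ k l η B V₁ V₂ V₃ 0 * E := by
              linear_combination (K ^ 2 * fullEner ε ρ k l η B V₁ V₂ V₃ 0 * E) * hee
          _ ≤ K ^ 2 * (C₀ * N) * E := by gcongr
          _ = _ := by ring
    · have h2 := h.fullEner_le_of_crit_le hp hk hM h0c ht
      have hu0 := uw_pos (l := l) (η := η) hk 0
      have hu01 := uw_le_one (l := l) (η := η) hk 0
      have h4 := gw_pow_four_le (l := l) (η := η) hk ht
      refine ⟨uw k l η 0 ^ 18, by positivity, pow_le_one₀ hu0.le hu01, ?_, ?_, ?_⟩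
      · refine le_trans ?_ h4
        gcongr ?_ * ?_
        exact pow_le_pow_of_le_one hu0.le hu01 (by norm_num)
      · calc _ ≤ gw k l η t ^ 8 * uw k l η 0 ^ 8 := by
              gcongr ?_ * ?_
              exact pow_le_pow_of_le_one hu0.le hu01 (by norm_num)
          _ = (gw k l η t ^ 4 * uw k l η 0 ^ 4) ^ 2 := by ring
          _ ≤ (2 * (1 + t)) ^ 2 := by gcongr
          _ = _ := by ring
      · refine (hconv (uw k l η 0 ^ 18) (K ^ 2 * C₀ * N * E) ?_).trans (le_of_eq (by ring))
        calc _ ≤ _ := h2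
          _ = K * (uw k l η 0 ^ 18 * fullEner ε ρ k l η B V₁ V₂ V₃ 0) * E := by simp [hK, hE]
          _ ≤ K ^ 2 * (uw k l η 0 ^ 18 * (C₀ * N)) * E := by
              gcongr
              exact mul_nonneg (by positivity) (fullEner_nonneg hp hk 0)
          _ = _ := by ring

/-! ### Decay of the velocity -/

section

variable {ε ρ ν k l η : ℝ} {B V₁ V₂ V₃ : ℝ → ℝ}

/-- The rate `1/3` is lowered to `3/10` to absorb a factor `(ρ (1 + t))²`. -/
theorem growth_le (hρ : 0 < ρ) (hρ1 : ρ ≤ 1) {t : ℝ} (ht : 0 ≤ t) :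
    (ρ * (1 + t)) ^ 2 * Real.exp (-(1 / 3 * ρ * t)) ≤ 3600 * Real.exp (-(3 / 10 * ρ * t)) ∧
    ρ * (1 + t) * Real.exp (-(1 / 3 * ρ * t)) ≤ 3600 * Real.exp (-(3 / 10 * ρ * t)) := by
  set x := ρ * t with hx
  have hx0 : 0 ≤ x := by positivity
  have h1 : Real.exp (-(3 / 10 * ρ * t)) = Real.exp (x / 60) ^ 2 * Real.exp (-(1 / 3 * ρ * t)) := by
    rw [← Real.exp_nat_mul, ← Real.exp_add, hx]; congr 1; push_cast; ring
  have h2 : 1 + x ≤ 60 * Real.exp (x / 60) := by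
    have := Real.add_one_le_exp (x / 60)
    linarith
  have h3 : (1 + x) ^ 2 ≤ 3600 * Real.exp (x / 60) ^ 2 := by
    calc (1 + x) ^ 2 ≤ (60 * Real.exp (x / 60)) ^ 2 := by gcongr
      _ = _ := by ring
  have h4 : ρ * (1 + t) ≤ 1 + x := by rw [hx]; linarith
  have h5 : (ρ * (1 + t)) ^ 2 ≤ (1 + x) ^ 2 := by gcongr
  have h6 : 1 + x ≤ (1 + x) ^ 2 := by nlinarith
  rw [h1, ← mul_assoc]
  exact ⟨mul_le_mul_of_nonneg_right (by linarith) (Real.exp_pos _).le,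
    mul_le_mul_of_nonneg_right (by linarith) (Real.exp_pos _).le⟩

theorem exp_third_le (hρ : 0 < ρ) {t : ℝ} (ht : 0 ≤ t) :
    Real.exp (-(1 / 3 * ρ * t)) ≤ Real.exp (-(3 / 10 * ρ * t)) := by
  apply Real.exp_le_exp.2
  have : 0 ≤ ρ * t := by positivity
  linarith

theorem B_sq_le (hε : 0 < ε) (hk : 1 ≤ |k|) (t : ℝ) :
    B t ^ 2 ≤ ε ^ 2 * ener ε k l η B V₁ V₂ V₃ t := by
  have hp := symb_pos (l := l) (η := η) hk t
  have h1 : B t ^ 2 = ε ^ 2 * (B t / ε) ^ 2 := by field_simp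
  rw [h1, ener]
  have : 0 ≤ symb k l η t * dvar k l η V₁ V₂ V₃ t ^ 2 := by positivity
  exact mul_le_mul_of_nonneg_left (by linarith) (by positivity)

theorem inv_symb (hk : 1 ≤ |k|) (t : ℝ) :
    (symb k l η t)⁻¹ = uw k l η t ^ 8 / kap k l ^ 2 := by
  have hκ := one_le_kap (l := l) hk
  have hg := one_le_gw (l := l) (η := η) hk t
  rw [symb_eq_gw hk, uw]; field_simp

end

/-- The good unknown grows at most like `g²`. -/
theorem exists_wvar_le (ε : ℝ) (hε : 0 < ε) : ∃ C : ℝ, 0 ≤ C ∧ ∀ ρ ν k l η : ℝ,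
    ∀ B V₁ V₂ V₃ : ℝ → ℝ, Admissible ε ρ ν → 1 ≤ |k| → IsMode ε ρ ν k l η B V₁ V₂ V₃ →
    ∀ t, 0 ≤ t → wvar k l η B V₁ V₂ V₃ t ^ 2 * uw k l η t ^ 4 ≤
      C * dataSq k l η B V₁ V₂ V₃ * Real.exp (-(3 / 10 * ρ * t)) := by
  obtain ⟨C, hC, hmain⟩ := exists_ener_le ε hε
  obtain ⟨M, hM0, hM⟩ := exists_abs_Fw_le
  set A := 14400 * ε ^ 2 * C with hA
  have hA0 : 0 ≤ A := by positivity
  set C₂ := C + Real.exp (2 * M) * (C + 6 + A * (3 * M + 1 / (1 - 3 / 10))) with hC₂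
  have hC₂1 : Real.exp (2 * M) * (C + 6 + A * (3 * M + 1 / (1 - 3 / 10))) ≤ C₂ := by linarith
  have hC₂2 : C ≤ C₂ := by
    have : 0 ≤ Real.exp (2 * M) * (C + 6 + A * (3 * M + 1 / (1 - 3 / 10))) := by
      have : (0 : ℝ) ≤ 1 / (1 - 3 / 10) := by norm_num
      positivity
    linarith
  refine ⟨C₂, hC.trans hC₂2, fun ρ ν k l η B V₁ V₂ V₃ hp hk h t ht => ?_⟩
  have hρ := hp.ρ_pos
  set N := dataSq k l η B V₁ V₂ V₃ with hN
  have hN0 : 0 ≤ N := dataSq_nonneg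
  rcases le_total t (η / k) with htc | htc
  · have h1 := (hmain ρ ν k l η B V₁ V₂ V₃ hp hk h t ht).2 htc
    have hu := uw_pos (l := l) (η := η) hk t
    calc _ ≤ wvar k l η B V₁ V₂ V₃ t ^ 2 :=
          mul_le_of_le_one_right (sq_nonneg _) (pow_le_one₀ hu.le (uw_le_one hk t))
      _ ≤ _ := h1
      _ ≤ C₂ * N * Real.exp (-(3 / 10 * ρ * t)) :=
          mul_le_mul (by gcongr) (exp_third_le hρ ht) (Real.exp_pos _).le (by positivity)
  -- the initial time of the estimate after the critical time
  set t₁ := max (η / k) 0 with ht₁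
  have ht₁0 : 0 ≤ t₁ := le_max_right _ _
  have ht₁c : η / k ≤ t₁ := le_max_left _ _
  have ht₁t : t₁ ≤ t := max_le htc ht
  have hw₁ : Real.exp (3 / 10 * ρ * t₁) * wvar k l η B V₁ V₂ V₃ t₁ ^ 2 ≤ (C + 6) * N := by
    rcases le_total (η / k) 0 with h0 | h0
    · have h1 := wvar_zero_sq_le (l := l) (η := η) (B := B) (V₁ := V₁) (V₂ := V₂) (V₃ := V₃) hk
      rw [ht₁, max_eq_right h0, mul_zero, Real.exp_zero, one_mul]
      have : 0 ≤ C * N := by positivity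
      linarith
    · have h1 := (hmain ρ ν k l η B V₁ V₂ V₃ hp hk h t₁ ht₁0).2 (by rw [ht₁, max_eq_left h0])
      have h2 := exp_third_le hρ ht₁0
      have h3 : Real.exp (3 / 10 * ρ * t₁) * Real.exp (-(3 / 10 * ρ * t₁)) = 1 := by
        rw [← Real.exp_add]; simp
      calc _ ≤ Real.exp (3 / 10 * ρ * t₁) * (C * N * Real.exp (-(3 / 10 * ρ * t₁))) := by
            gcongr
            exact h1.trans (mul_le_mul_of_nonneg_left h2 (by positivity))
        _ = C * N := by linear_combination C * N * h3
        _ ≤ _ := by linarith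
  have hder : ∀ s ∈ Icc t₁ t, ∃ X',
      HasDerivAt (fun s => wvar k l η B V₁ V₂ V₃ s ^ 2 * uw k l η s ^ 4) X' s ∧
      X' ≤ (-(1 * ρ) + fw ρ k l η s) * (wvar k l η B V₁ V₂ V₃ s ^ 2 * uw k l η s ^ 4)
        + A * N * (ρ + fw ρ k l η s) * Real.exp (-(3 / 10 * ρ * s)) := by
    intro s hs
    have hs0 : 0 ≤ s := ht₁0.trans hs.1
    have hr := rlog_nonneg (l := l) (η := η) hk (ht₁c.trans hs.1)
    refine ⟨_, ((h.hasDerivAt_wvar s).pow 2).mul ((hasDerivAt_uw (l := l) (η := η) hk s).pow 4), ?_⟩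
    have hu := uw_pos (l := l) (η := η) hk s
    have hug := uw_mul_gw (l := l) (η := η) hk s
    have hps := symb_pos (l := l) (η := η) hk s
    have hf := fw_nonneg (l := l) (η := η) hρ hk s
    have hnf : nw ρ k η s ≤ fw ρ k l η s := by
      rw [fw]
      have := aw_nonneg (k := k) (l := l)
      have : 0 ≤ aw k l * uw k l η s ^ 5 := by positivity
      linarith
    have hρp := sub_nw_le (l := l) (η := η) hρ hk s
    obtain ⟨y, hy0, hy1, hy2, hy3, hy4⟩ := (hmain ρ ν k l η B V₁ V₂ V₃ hp hk h s hs0).1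
    have hBs := B_sq_le (l := l) (η := η) (B := B) (V₁ := V₁) (V₂ := V₂) (V₃ := V₃) hε hk s
    have hgr := (growth_le hρ hp.ρ_le hs0).1
    have hen : 0 ≤ ener ε k l η B V₁ V₂ V₃ s := ener_nonneg hk s
    set w := wvar k l η B V₁ V₂ V₃ s with hw
    set u := uw k l η s with hu'
    set p := symb k l η s with hp'
    set N' := C * N with hN'
    have hforce : ρ ^ 3 * p * k ^ 2 * B s ^ 2 * u ^ 4 ≤
        A * N * ρ * Real.exp (-(3 / 10 * ρ * s)) := by
      have hk2 : k ^ 2 ≤ kap k l ^ 2 := by rw [kap_sq]; linarith [sq_nonneg l]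
      have hpg : p = kap k l ^ 2 * gw k l η s ^ 8 := symb_eq_gw hk s
      have hgu : gw k l η s ^ 8 * u ^ 4 = gw k l η s ^ 4 := by
        linear_combination (gw k l η s ^ 4 * ((u * gw k l η s) ^ 3 + (u * gw k l η s) ^ 2
          + u * gw k l η s + 1)) * hug
      have hg := one_le_gw (l := l) (η := η) hk s
      calc ρ ^ 3 * p * k ^ 2 * B s ^ 2 * u ^ 4
          ≤ ρ ^ 3 * p * kap k l ^ 2 * (ε ^ 2 * ener ε k l η B V₁ V₂ V₃ s) * u ^ 4 := by gcongr
        _ = ρ ^ 3 * ε ^ 2 * (kap k l ^ 4 * ener ε k l η B V₁ V₂ V₃ s) *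
            (gw k l η s ^ 8 * u ^ 4) := by rw [hpg]; ring
        _ ≤ ρ ^ 3 * ε ^ 2 * (N' * Real.exp (-(1 / 3 * ρ * s)) * (gw k l η s ^ 4 * y)) *
            (gw k l η s ^ 8 * u ^ 4) := by gcongr
        _ = ρ ^ 3 * ε ^ 2 * N' * Real.exp (-(1 / 3 * ρ * s)) * (gw k l η s ^ 8 * y) := by
            rw [hgu]; ring
        _ ≤ ρ ^ 3 * ε ^ 2 * N' * Real.exp (-(1 / 3 * ρ * s)) * (4 * (1 + s) ^ 2) := by gcongr
        _ = 4 * ρ * ε ^ 2 * N' * ((ρ * (1 + s)) ^ 2 * Real.exp (-(1 / 3 * ρ * s))) := by ring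
        _ ≤ 4 * ρ * ε ^ 2 * N' * (3600 * Real.exp (-(3 / 10 * ρ * s))) := by gcongr
        _ = _ := by rw [hA, hN']; ring
    have h1 : 2 * w * (-(ρ ^ 3 * p) * (w + k * B s)) ≤
        -(ρ ^ 3 * p) * w ^ 2 + ρ ^ 3 * p * k ^ 2 * B s ^ 2 := by
      have := mul_nonneg (mul_pos (pow_pos hρ 3) hps).le (sq_nonneg (w + k * B s))
      linarith
    have h2 : -(ρ ^ 3 * p) * w ^ 2 ≤ (-(1 * ρ) + fw ρ k l η s) * w ^ 2 := by
      apply mul_le_mul_of_nonneg_right _ (sq_nonneg _); linarith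
    have h3 := mul_le_mul_of_nonneg_right (h1.trans (add_le_add_left h2 _)) (pow_pos hu 4).le
    have h4 : 0 ≤ A * N * fw ρ k l η s * Real.exp (-(3 / 10 * ρ * s)) := by positivity
    have h5 : 0 ≤ rlog k l η s * (w ^ 2 * u ^ 4) := by positivity
    simp only [Pi.pow_apply, ← hw]
    push_cast
    linarith
  choose! X' h1 h2 using hder
  have hu₁ := uw_pos (l := l) (η := η) hk t₁
  have := exp_decay_of_hasDerivAt_le
    (X := fun s => wvar k l η B V₁ V₂ V₃ s ^ 2 * uw k l η s ^ 4) (X' := X')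
    (F := fun s => Fw ρ k l η s) (f := fun s => fw ρ k l η s)
    (q := 3 / 10) (q₁ := 1) (A := A * N) (M := M) hρ (by norm_num) (by positivity) ht₁t
    h1 (fun s _ => hasDerivAt_Fw hk s) (fun s _ => fw_nonneg hρ hk s)
    (fun s _ => hM ρ k l η s hk) (by positivity) h2
  refine this.trans (mul_le_mul_of_nonneg_right ?_ (Real.exp_pos _).le)
  have h3 : Real.exp (3 / 10 * ρ * t₁) * (wvar k l η B V₁ V₂ V₃ t₁ ^ 2 * uw k l η t₁ ^ 4) ≤
      (C + 6) * N := by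
    refine le_trans ?_ hw₁
    gcongr
    exact mul_le_of_le_one_right (sq_nonneg _) (pow_le_one₀ hu₁.le (uw_le_one hk t₁))
  calc _ ≤ Real.exp (2 * M) * ((C + 6) * N + A * N * (3 * M + 1 / (1 - 3 / 10))) := by gcongr
    _ = Real.exp (2 * M) * (C + 6 + A * (3 * M + 1 / (1 - 3 / 10))) * N := by ring
    _ ≤ _ := by gcongr

section

variable {ε ρ ν k l η : ℝ} {B V₁ V₂ V₃ : ℝ → ℝ}

/-- The vertical component of the vorticity, corrected by a multiple of the density. The correction
integrates by parts in time the oscillating forcing by the divergence. -/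
def zvar (k l η : ℝ) (B V₁ V₃ : ℝ → ℝ) (t : ℝ) : ℝ :=
  k * V₃ t - l * V₁ t + l * ((η - k * t) / symb k l η t) * B t

theorem IsMode.hasDerivAt_zvar (h : IsMode ε ρ ν k l η B V₁ V₂ V₃) (hk : 1 ≤ |k|) (t : ℝ) :
    HasDerivAt (zvar k l η B V₁ V₃) (-(ρ ^ 3 * symb k l η t) * zvar k l η B V₁ V₃ t
      + ρ ^ 3 * l * (η - k * t) * B t - l * wvar k l η B V₁ V₂ V₃ t / symb k l η t
      - 2 * l * k * kap k l ^ 2 * B t / symb k l η t ^ 2) t := by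
  have hp := symb_pos (l := l) (η := η) hk t
  refine ((((h.V₃' t).const_mul k).sub ((h.V₁' t).const_mul l)).add
    ((((hasDerivAt_sub_mul (k := k) (η := η) t).div (hasDerivAt_symb (l := l) t) hp.ne').const_mul
      l).mul (h.B' t))).congr_deriv ?_
  have hκ : kap k l ^ 2 = symb k l η t - (η - k * t) ^ 2 := by rw [symb_eq]; ring
  rw [zvar, wvar, hκ]
  simp only [Pi.div_apply]
  field_simp
  ring

theorem zvar_zero_sq_le (hk : 1 ≤ |k|) :
    zvar k l η B V₁ V₃ 0 ^ 2 ≤ 6 * dataSq k l η B V₁ V₂ V₃ := by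
  have hp := one_le_symb (l := l) (η := η) hk 0
  set p := symb k l η 0 with hpd
  set s := η - k * 0 with hs
  have hkl : k ^ 2 + l ^ 2 ≤ p := by rw [hpd, symb]; linarith [sq_nonneg s]
  have hpp : p ≤ p ^ 2 := by nlinarith
  have h1 : (k * V₃ 0 - l * V₁ 0) ^ 2 ≤ p ^ 2 * (V₁ 0 ^ 2 + V₃ 0 ^ 2) := by
    calc _ ≤ (k ^ 2 + l ^ 2) * (V₁ 0 ^ 2 + V₃ 0 ^ 2) := by
          linarith [sq_nonneg (k * V₁ 0 + l * V₃ 0)]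
      _ ≤ _ := by gcongr; linarith
  have h2 : (l * (s / p) * B 0) ^ 2 ≤ p ^ 2 * B 0 ^ 2 := by
    have h3 : (l * (s / p)) ^ 2 ≤ 1 := by
      rw [mul_pow, div_pow, ← mul_div_assoc, div_le_one (by positivity)]
      have h4 : l ^ 2 ≤ p := by linarith [sq_nonneg k]
      have h5 : s ^ 2 ≤ p := by rw [hpd, symb]; linarith [sq_nonneg k, sq_nonneg l]
      calc l ^ 2 * s ^ 2 ≤ p * p := by gcongr
        _ = _ := by ring
    rw [mul_pow]
    exact mul_le_mul_of_nonneg_right (by linarith) (sq_nonneg _)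
  rw [zvar, dataSq, ← hpd, ← hs]
  generalize k * V₃ 0 - l * V₁ 0 = x at *
  generalize l * (s / p) * B 0 = z at *
  have h8 : 0 ≤ p ^ 2 * V₁ 0 ^ 2 := by positivity
  have h9 : 0 ≤ p ^ 2 * V₂ 0 ^ 2 := by positivity
  have h10 : 0 ≤ p ^ 2 * V₃ 0 ^ 2 := by positivity
  have h11 : 0 ≤ p ^ 2 * B 0 ^ 2 := by positivity
  linarith [sq_nonneg (x - z)]

theorem one_le_aw_mul_kap (hk : 1 ≤ |k|) : 1 ≤ aw k l * kap k l := by rwa [← abs_k_eq hk]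

/-- The forcing terms in the equation of `zvar`. -/
theorem zvar_forcing_le {ζ w b : ℝ} (hρ : 0 < ρ) (hk : 1 ≤ |k|) (t : ℝ) :
    2 * ζ * (-(ρ ^ 3 * symb k l η t) * ζ + ρ ^ 3 * l * (η - k * t) * b - l * w / symb k l η t
      - 2 * l * k * kap k l ^ 2 * b / symb k l η t ^ 2) ≤
    -(ρ ^ 3 * symb k l η t) * ζ ^ 2 + 3 * (aw k l * uw k l η t ^ 5) * ζ ^ 2
      + ρ ^ 3 * kap k l ^ 2 * b ^ 2
      + aw k l * uw k l η t ^ 5 * (w ^ 2 * uw k l η t ^ 4 + 2 * (b ^ 2 * uw k l η t ^ 4)) := by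
  have hp := symb_pos (l := l) (η := η) hk t
  have hκ := one_le_kap (l := l) hk
  have hinv := inv_symb (l := l) (η := η) hk t
  have hu := uw_pos (l := l) (η := η) hk t
  have hu1 := uw_le_one (l := l) (η := η) hk t
  have haκ := one_le_aw_mul_kap (l := l) hk
  have hka := abs_k_eq (l := l) hk
  have ha := aw_nonneg (k := k) (l := l)
  have hl := abs_l_le_kap (k := k) (l := l)
  set p := symb k l η t with hpd
  set u := uw k l η t with hud
  set a := aw k l with had
  set κ := kap k l with hκd
  set s := η - k * t with hs
  have hau : 0 ≤ a * u ^ 5 := by positivity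
  have t1 : 2 * ζ * (ρ ^ 3 * l * s * b) ≤ ρ ^ 3 * p * ζ ^ 2 + ρ ^ 3 * κ ^ 2 * b ^ 2 := by
    have h1 : s ^ 2 * ζ ^ 2 ≤ p * ζ ^ 2 := by
      apply mul_le_mul_of_nonneg_right _ (sq_nonneg _)
      rw [hpd, symb]; linarith [sq_nonneg k, sq_nonneg l]
    have h2 : l ^ 2 * b ^ 2 ≤ κ ^ 2 * b ^ 2 := by
      apply mul_le_mul_of_nonneg_right _ (sq_nonneg _)
      rw [hκd, kap_sq]; linarith [sq_nonneg k]
    have h3 : 2 * ζ * (l * s * b) ≤ p * ζ ^ 2 + κ ^ 2 * b ^ 2 := by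
      linarith [sq_nonneg (s * ζ - l * b)]
    have := mul_le_mul_of_nonneg_left h3 (pow_pos hρ 3).le
    linarith
  have t2 : 2 * ζ * (-(l * w / p)) ≤ a * u ^ 5 * (ζ ^ 2 + w ^ 2 * u ^ 4) := by
    have h1 : 2 * ζ * (-(l * w / p)) = -(l / κ ^ 2) * (u ^ 5 * (2 * ζ * (w * u ^ 3))) := by
      rw [div_eq_mul_inv, hinv]; ring
    have h2 : |-(l / κ ^ 2)| ≤ a := by
      rw [abs_neg, abs_div, abs_of_pos (by positivity : 0 < κ ^ 2), div_le_iff₀ (by positivity)]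
      calc |l| ≤ κ * 1 := by linarith
        _ ≤ κ * (a * κ) := by gcongr
        _ = _ := by ring
    have h3 : |u ^ 5 * (2 * ζ * (w * u ^ 3))| ≤ u ^ 5 * (ζ ^ 2 + w ^ 2 * u ^ 4) := by
      rw [abs_mul, abs_of_pos (by positivity)]
      gcongr
      have h4 : w ^ 2 * u ^ 6 ≤ w ^ 2 * u ^ 4 :=
        mul_le_mul_of_nonneg_left (pow_le_pow_of_le_one hu.le hu1 (by norm_num)) (sq_nonneg _)
      rw [abs_le]; constructor <;>
        linarith [sq_nonneg (ζ + w * u ^ 3), sq_nonneg (ζ - w * u ^ 3)]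
    rw [h1]
    exact (mul_le_mul_of_abs_le h2 h3).trans (le_of_eq (by ring))
  have t3 : 2 * ζ * (-(2 * l * k * κ ^ 2 * b / p ^ 2)) ≤
      a * u ^ 5 * (2 * (ζ ^ 2 + b ^ 2 * u ^ 4)) := by
    have h1 : 2 * ζ * (-(2 * l * k * κ ^ 2 * b / p ^ 2)) =
        -(l * k / κ ^ 2) * (u ^ 5 * (4 * ζ * (b * u ^ 11))) := by
      rw [div_eq_mul_inv, ← inv_pow, hinv]; field_simp; ring
    have h2 : |-(l * k / κ ^ 2)| ≤ a := by
      rw [abs_neg, abs_div, abs_of_pos (by positivity : 0 < κ ^ 2), div_le_iff₀ (by positivity),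
        abs_mul, hka]
      calc |l| * (a * κ) ≤ κ * (a * κ) := by gcongr
        _ = _ := by ring
    have h3 : |u ^ 5 * (4 * ζ * (b * u ^ 11))| ≤ u ^ 5 * (2 * (ζ ^ 2 + b ^ 2 * u ^ 4)) := by
      rw [abs_mul, abs_of_pos (by positivity)]
      gcongr
      have h4 : b ^ 2 * u ^ 22 ≤ b ^ 2 * u ^ 4 :=
        mul_le_mul_of_nonneg_left (pow_le_pow_of_le_one hu.le hu1 (by norm_num)) (sq_nonneg _)
      rw [abs_le]; constructor <;>
        linarith [sq_nonneg (ζ + b * u ^ 11), sq_nonneg (ζ - b * u ^ 11)]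
    rw [h1]
    exact (mul_le_mul_of_abs_le h2 h3).trans (le_of_eq (by ring))
  linarith

end

/-- The corrected vorticity decays without growth: all its forcing terms have integrable
coefficients. -/
theorem exists_zvar_le (ε : ℝ) (hε : 0 < ε) : ∃ C : ℝ, 0 ≤ C ∧ ∀ ρ ν k l η : ℝ,
    ∀ B V₁ V₂ V₃ : ℝ → ℝ, Admissible ε ρ ν → 1 ≤ |k| → IsMode ε ρ ν k l η B V₁ V₂ V₃ →
    ∀ t, 0 ≤ t → zvar k l η B V₁ V₃ t ^ 2 ≤
      C * dataSq k l η B V₁ V₂ V₃ * Real.exp (-(3 / 10 * ρ * t)) := by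
  obtain ⟨C, hC, hmain⟩ := exists_ener_le ε hε
  obtain ⟨C₂, hC₂, hw⟩ := exists_wvar_le ε hε
  obtain ⟨M, hM0, hM⟩ := exists_abs_Fw_le
  set A := 7200 * ε ^ 2 * C + (C₂ + 2 * (ε ^ 2 * C)) with hA
  have hA0 : 0 ≤ A := by positivity
  have h10 : (0 : ℝ) ≤ 1 / (1 - 3 / 10) := by norm_num
  refine ⟨Real.exp (2 * (3 * M)) * (6 + A * (3 * (3 * M) + 1 / (1 - 3 / 10))), by positivity,
    fun ρ ν k l η B V₁ V₂ V₃ hp hk h t ht => ?_⟩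
  have hρ := hp.ρ_pos
  set N := dataSq k l η B V₁ V₂ V₃ with hN
  have hN0 : 0 ≤ N := dataSq_nonneg
  have hder : ∀ s ∈ Icc 0 t, ∃ X', HasDerivAt (fun s => zvar k l η B V₁ V₃ s ^ 2) X' s ∧
      X' ≤ (-(1 * ρ) + 3 * fw ρ k l η s) * (zvar k l η B V₁ V₃ s ^ 2)
        + A * N * (ρ + 3 * fw ρ k l η s) * Real.exp (-(3 / 10 * ρ * s)) := by
    intro s hs
    refine ⟨_, (h.hasDerivAt_zvar hk s).pow 2, ?_⟩
    have hs0 : 0 ≤ s := hs.1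
    have hu := uw_pos (l := l) (η := η) hk s
    have hug := uw_mul_gw (l := l) (η := η) hk s
    have hf := fw_nonneg (l := l) (η := η) hρ hk s
    have hn := nw_nonneg (k := k) (η := η) hρ s
    have ha := aw_nonneg (k := k) (l := l)
    have hfdef : fw ρ k l η s = aw k l * uw k l η s ^ 5 + nw ρ k η s := rfl
    have hρp := sub_nw_le (l := l) (η := η) hρ hk s
    obtain ⟨y, hy0, hy1, hy2, hy3, hy4⟩ := (hmain ρ ν k l η B V₁ V₂ V₃ hp hk h s hs0).1
    have hBs := B_sq_le (l := l) (η := η) (B := B) (V₁ := V₁) (V₂ := V₂) (V₃ := V₃) hε hk s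
    have hgr := (growth_le hρ hp.ρ_le hs0).2
    have hen : 0 ≤ ener ε k l η B V₁ V₂ V₃ s := ener_nonneg hk s
    have hws := hw ρ ν k l η B V₁ V₂ V₃ hp hk h s hs0
    have hκ := one_le_kap (l := l) hk
    have key := zvar_forcing_le (l := l) (η := η) (ζ := zvar k l η B V₁ V₃ s)
      (w := wvar k l η B V₁ V₂ V₃ s) (b := B s) hρ hk s
    set E := Real.exp (-(3 / 10 * ρ * s)) with hE
    have hEpos : 0 < E := Real.exp_pos _
    have hκen : ener ε k l η B V₁ V₂ V₃ s ≤ kap k l ^ 4 * ener ε k l η B V₁ V₂ V₃ s :=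
      le_mul_of_one_le_left hen (one_le_pow₀ hκ)
    have h1 : ρ ^ 3 * kap k l ^ 2 * B s ^ 2 ≤ 7200 * ε ^ 2 * C * N * ρ * E := by
      have hρ2 : ρ ^ 3 ≤ ρ ^ 2 := pow_le_pow_of_le_one hρ.le hp.ρ_le (by norm_num)
      calc ρ ^ 3 * kap k l ^ 2 * B s ^ 2 ≤
          ρ ^ 2 * kap k l ^ 4 * (ε ^ 2 * ener ε k l η B V₁ V₂ V₃ s) := by
            gcongr; first | exact hκ | norm_num
        _ = ρ ^ 2 * ε ^ 2 * (kap k l ^ 4 * ener ε k l η B V₁ V₂ V₃ s) := by ring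
        _ ≤ ρ ^ 2 * ε ^ 2 * (C * N * Real.exp (-(1 / 3 * ρ * s)) * (2 * (1 + s))) := by
            refine mul_le_mul_of_nonneg_left (hy4.trans ?_) (by positivity)
            gcongr
        _ = 2 * ρ * ε ^ 2 * (C * N) * (ρ * (1 + s) * Real.exp (-(1 / 3 * ρ * s))) := by ring
        _ ≤ 2 * ρ * ε ^ 2 * (C * N) * (3600 * E) := by gcongr
        _ = _ := by ring
    have h2 : B s ^ 2 * uw k l η s ^ 4 ≤ ε ^ 2 * C * N * E := by
      have hgu : gw k l η s ^ 4 * uw k l η s ^ 4 = 1 := by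
        rw [← mul_pow, mul_comm, hug, one_pow]
      calc B s ^ 2 * uw k l η s ^ 4 ≤
          ε ^ 2 * (C * N * Real.exp (-(1 / 3 * ρ * s)) * (gw k l η s ^ 4 * y)) *
            uw k l η s ^ 4 := by
            gcongr
            exact hBs.trans (mul_le_mul_of_nonneg_left (hκen.trans hy4) (by positivity))
        _ = ε ^ 2 * (C * N * Real.exp (-(1 / 3 * ρ * s)) * y) := by
            linear_combination (ε ^ 2 * (C * N * Real.exp (-(1 / 3 * ρ * s)) * y)) * hgu
        _ ≤ ε ^ 2 * (C * N * E * 1) := by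
            gcongr
            exact exp_third_le hρ hs0
        _ = _ := by ring
    have h3 : aw k l * uw k l η s ^ 5 * (wvar k l η B V₁ V₂ V₃ s ^ 2 * uw k l η s ^ 4
        + 2 * (B s ^ 2 * uw k l η s ^ 4)) ≤
        fw ρ k l η s * ((C₂ + 2 * (ε ^ 2 * C)) * N * E) := by
      have h4 : aw k l * uw k l η s ^ 5 ≤ fw ρ k l η s := by rw [hfdef]; linarith
      apply mul_le_mul h4 _ (by positivity) hf
      linarith
    have h5 : 0 ≤ zvar k l η B V₁ V₃ s ^ 2 := sq_nonneg _
    have h6 : 0 ≤ (7200 * ε ^ 2 * C) * N * (3 * fw ρ k l η s) * E := by positivity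
    have h7 : 0 ≤ (C₂ + 2 * (ε ^ 2 * C)) * N * (ρ + 2 * fw ρ k l η s) * E := by positivity
    have h8 : -(ρ ^ 3 * symb k l η s) * zvar k l η B V₁ V₃ s ^ 2 +
        3 * (aw k l * uw k l η s ^ 5) * zvar k l η B V₁ V₃ s ^ 2 ≤
        (-(1 * ρ) + 3 * fw ρ k l η s) * (zvar k l η B V₁ V₃ s ^ 2) := by
      rw [← add_mul]
      apply mul_le_mul_of_nonneg_right _ h5
      rw [hfdef]; linarith
    have h9 : A * N * (ρ + 3 * fw ρ k l η s) * E = 7200 * ε ^ 2 * C * N * ρ * E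
        + fw ρ k l η s * ((C₂ + 2 * (ε ^ 2 * C)) * N * E)
        + (7200 * ε ^ 2 * C) * N * (3 * fw ρ k l η s) * E
        + (C₂ + 2 * (ε ^ 2 * C)) * N * (ρ + 2 * fw ρ k l η s) * E := by rw [hA]; ring
    rw [h9]
    push_cast
    rw [pow_one]
    linarith
  choose! X' h1 h2 using hder
  have := exp_decay_of_hasDerivAt_le
    (X := fun s => zvar k l η B V₁ V₃ s ^ 2) (X' := X')
    (F := fun s => 3 * Fw ρ k l η s) (f := fun s => 3 * fw ρ k l η s)
    (q := 3 / 10) (q₁ := 1) (A := A * N) (M := 3 * M) hρ (by norm_num) (by positivity) ht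
    h1 (fun s _ => (hasDerivAt_Fw hk s).const_mul 3)
    (fun s _ => mul_nonneg (by norm_num) (fw_nonneg hρ hk s))
    (fun s _ => by
      rw [abs_mul, abs_of_pos (by norm_num : (0 : ℝ) < 3)]
      exact mul_le_mul_of_nonneg_left (hM ρ k l η s hk) (by norm_num)) (sq_nonneg _) h2
  refine this.trans (mul_le_mul_of_nonneg_right ?_ (Real.exp_pos _).le)
  have h3 : zvar k l η B V₁ V₃ 0 ^ 2 ≤ 6 * N := zvar_zero_sq_le hk
  rw [mul_zero, Real.exp_zero, one_mul]
  calc _ ≤ Real.exp (2 * (3 * M)) * (6 * N + A * N * (3 * (3 * M) + 1 / (1 - 3 / 10))) := by gcongr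
    _ = _ := by ring

/-- The bounds for one frequency. The velocity is recovered from the energy `ener` of the acoustic
waves, the good unknown `wvar` and the vorticity `zvar`. Only `B` and `V₂` lose a power of `ρ`: they
see the growth `1 + t` of the energy, and `ρ (1 + t)` is absorbed by the exponential. In `V₁` and
`V₃` the divergence comes with a factor `(k² + l²) / p`, which compensates for that growth. -/
theorem exists_mode_le (ε : ℝ) (hε : 0 < ε) : ∃ C : ℝ, 0 ≤ C ∧ ∀ ρ ν k l η : ℝ,
    ∀ B V₁ V₂ V₃ : ℝ → ℝ, Admissible ε ρ ν → 1 ≤ |k| → IsMode ε ρ ν k l η B V₁ V₂ V₃ →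
    ∀ t, 0 ≤ t →
      ρ * B t ^ 2 ≤ C * dataSq k l η B V₁ V₂ V₃ * Real.exp (-(3 / 10 * ρ * t)) ∧
      V₁ t ^ 2 ≤ C * dataSq k l η B V₁ V₂ V₃ * Real.exp (-(3 / 10 * ρ * t)) ∧
      ρ * V₂ t ^ 2 ≤ C * dataSq k l η B V₁ V₂ V₃ * Real.exp (-(3 / 10 * ρ * t)) ∧
      V₃ t ^ 2 ≤ C * dataSq k l η B V₁ V₂ V₃ * Real.exp (-(3 / 10 * ρ * t)) := by
  obtain ⟨C, hC, hmain⟩ := exists_ener_le ε hε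
  obtain ⟨C₂, hC₂, hw⟩ := exists_wvar_le ε hε
  obtain ⟨C₃, hC₃, hz⟩ := exists_zvar_le ε hε
  refine ⟨3 * (7200 * C + 7200 * (ε ^ 2 * C) + C₂) + 3 * (C + ε ^ 2 * C + C₂) +
    2 * (C₃ + ε ^ 2 * C), by positivity, fun ρ ν k l η B V₁ V₂ V₃ hp hk h t ht => ?_⟩
  have hρ := hp.ρ_pos
  have hρ1 := hp.ρ_le
  obtain ⟨y, hy0, hy1, hy2, hy3, hy4⟩ := (hmain ρ ν k l η B V₁ V₂ V₃ hp hk h t ht).1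
  have hws := hw ρ ν k l η B V₁ V₂ V₃ hp hk h t ht
  have hzs := hz ρ ν k l η B V₁ V₂ V₃ hp hk h t ht
  set N := dataSq k l η B V₁ V₂ V₃ with hN
  have hN0 : 0 ≤ N := dataSq_nonneg
  have hgr := (growth_le hρ hp.ρ_le ht).2
  have hE3 := exp_third_le hρ ht
  set E := Real.exp (-(3 / 10 * ρ * t)) with hE
  set E' := Real.exp (-(1 / 3 * ρ * t)) with hE'
  have hE'0 : 0 < E' := Real.exp_pos _
  have hE0 : 0 < E := Real.exp_pos _
  have hBs := B_sq_le (l := l) (η := η) (B := B) (V₁ := V₁) (V₂ := V₂) (V₃ := V₃) hε hk t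
  have hen : 0 ≤ ener ε k l η B V₁ V₂ V₃ t := ener_nonneg hk t
  have hκ := one_le_kap (l := l) hk
  have hκen : ener ε k l η B V₁ V₂ V₃ t ≤ kap k l ^ 4 * ener ε k l η B V₁ V₂ V₃ t :=
    le_mul_of_one_le_left hen (one_le_pow₀ hκ)
  have hu := uw_pos (l := l) (η := η) hk t
  have hu1 := uw_le_one (l := l) (η := η) hk t
  have hug := uw_mul_gw (l := l) (η := η) hk t
  have hps := symb_pos (l := l) (η := η) hk t
  have hps1 := one_le_symb (l := l) (η := η) hk t
  have hinv := inv_symb (l := l) (η := η) hk t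
  have hka2 : k ^ 2 / symb k l η t ≤ uw k l η t ^ 8 :=
    (k_sq_div_symb_le hk t).trans (mul_le_of_le_one_left (by positivity) aw_le_one)
  have hdef1 : ener ε k l η B V₁ V₂ V₃ t
      = (B t / ε) ^ 2 + symb k l η t * dvar k l η V₁ V₂ V₃ t ^ 2 := rfl
  have hdD : k * V₁ t + (η - k * t) * V₂ t + l * V₃ t =
      symb k l η t * dvar k l η V₁ V₂ V₃ t := by rw [dvar]; field_simp
  have hwdef : wvar k l η B V₁ V₂ V₃ t = (η - k * t) * (symb k l η t * dvar k l η V₁ V₂ V₃ t)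
      - symb k l η t * V₂ t - k * B t := by rw [wvar, hdD]
  have hzdef : zvar k l η B V₁ V₃ t
      = k * V₃ t - l * V₁ t + l * ((η - k * t) / symb k l η t) * B t := rfl
  set e := ener ε k l η B V₁ V₂ V₃ t with he
  set d := dvar k l η V₁ V₂ V₃ t with hd
  set w := wvar k l η B V₁ V₂ V₃ t with hwd
  set ζ := zvar k l η B V₁ V₃ t with hζ
  have hpk : symb k l η t = kap k l ^ 2 + (η - k * t) ^ 2 := symb_eq k l η t
  have hκ2 : kap k l ^ 2 = k ^ 2 + l ^ 2 := kap_sq k l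
  set p := symb k l η t with hpd
  set u := uw k l η t with hud
  set g := gw k l η t with hgd
  set κ := kap k l with hκd
  set s := η - k * t with hs
  -- the energy, with and without the weight
  have hρe : ρ * e ≤ 7200 * C * N * E := by
    calc ρ * e ≤ ρ * (C * N * E' * (2 * (1 + t))) := by
          refine mul_le_mul_of_nonneg_left ((hκen.trans hy4).trans ?_) hρ.le
          gcongr
      _ = 2 * (C * N) * (ρ * (1 + t) * E') := by ring
      _ ≤ 2 * (C * N) * (3600 * E) := by gcongr
      _ = _ := by ring
  have hκu : κ ^ 4 * e * u ^ 4 ≤ C * N * E := by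
    have hgu : g ^ 4 * u ^ 4 = 1 := by rw [← mul_pow, mul_comm, hug, one_pow]
    calc κ ^ 4 * e * u ^ 4 ≤ C * N * E' * (g ^ 4 * y) * u ^ 4 := by gcongr
      _ = C * N * E' * y := by linear_combination (C * N * E' * y) * hgu
      _ ≤ C * N * E * 1 := by gcongr
      _ = _ := mul_one _
  have hBu : B t ^ 2 * u ^ 4 ≤ ε ^ 2 * C * N * E := by
    calc B t ^ 2 * u ^ 4 ≤ ε ^ 2 * (κ ^ 4 * e) * u ^ 4 := by
          gcongr
          exact hBs.trans (mul_le_mul_of_nonneg_left hκen (by positivity))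
      _ = ε ^ 2 * (κ ^ 4 * e * u ^ 4) := by ring
      _ ≤ ε ^ 2 * (C * N * E) := by gcongr
      _ = _ := by ring
  have hρB : ρ * B t ^ 2 ≤ 7200 * (ε ^ 2 * C) * N * E := by
    calc ρ * B t ^ 2 ≤ ρ * (ε ^ 2 * e) := by gcongr
      _ = ε ^ 2 * (ρ * e) := by ring
      _ ≤ ε ^ 2 * (7200 * C * N * E) := by gcongr
      _ = _ := by ring
  have hu84 : u ^ 8 ≤ u ^ 4 := pow_le_pow_of_le_one hu.le hu1 (by norm_num)
  have hpd2 : p * d ^ 2 ≤ e := by rw [hdef1]; linarith [sq_nonneg (B t / ε)]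
  have hs2 : s ^ 2 ≤ p := by rw [hpk]; linarith [sq_nonneg κ]
  have hpinv : 0 < p⁻¹ := inv_pos.2 hps
  have hpp : p * p⁻¹ = 1 := mul_inv_cancel₀ hps.ne'
  have hwp : w ^ 2 * p⁻¹ ≤ C₂ * N * E := by
    refine le_trans ?_ hws
    gcongr
    rw [hinv]
    exact (div_le_self (by positivity) (one_le_pow₀ hκ)).trans hu84
  have hkBp : k ^ 2 * p⁻¹ * B t ^ 2 ≤ ε ^ 2 * C * N * E := by
    refine le_trans ?_ hBu
    rw [mul_comm]
    gcongr
    rw [← div_eq_mul_inv]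
    exact hka2.trans hu84
  have hspp : s ^ 2 * p⁻¹ ≤ 1 := by rw [← hpp]; gcongr
  have hpi1 : p⁻¹ ≤ 1 := inv_le_one_of_one_le₀ hps1
  have three : ∀ x y z : ℝ, (x + y + z) ^ 2 ≤ 3 * (x ^ 2 + y ^ 2 + z ^ 2) := fun x y z => by
    linarith [sq_nonneg (x - y), sq_nonneg (x - z), sq_nonneg (y - z)]
  have hCNE : 0 ≤ C * N * E := by positivity
  have hCNE1 : 0 ≤ ε ^ 2 * C * N * E := by positivity
  have hCNE2 : 0 ≤ C₂ * N * E := by positivity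
  have hCNE3 : 0 ≤ C₃ * N * E := by positivity
  -- `Y = k V₁ + l V₃` and `z = k V₃ - l V₁` determine `V₁` and `V₃`
  have hY : (k * V₁ t + l * V₃ t) ^ 2 ≤ 3 * (C + ε ^ 2 * C + C₂) * N * E := by
    have h1 : k * V₁ t + l * V₃ t = κ ^ 2 * d + s * p⁻¹ * (k * B t) + s * p⁻¹ * w := by
      have h2 : κ ^ 2 = p - s ^ 2 := by rw [hpk]; ring
      rw [hwdef, h2]
      linear_combination hdD + (-s ^ 2 * d + s * V₂ t) * hpp
    have h3 : (κ ^ 2 * d) ^ 2 ≤ C * N * E := by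
      refine le_trans ?_ hκu
      have h4 : (κ ^ 2 * d) ^ 2 = κ ^ 4 * (p * d ^ 2) * p⁻¹ := by
        linear_combination (-κ ^ 4 * d ^ 2) * hpp
      rw [h4]
      gcongr
      rw [hinv]
      exact (div_le_self (by positivity) (one_le_pow₀ hκ)).trans hu84
    have h5 : (s * p⁻¹ * (k * B t)) ^ 2 ≤ ε ^ 2 * C * N * E := by
      refine le_trans ?_ hkBp
      calc _ = s ^ 2 * p⁻¹ * (k ^ 2 * p⁻¹ * B t ^ 2) := by ring
        _ ≤ 1 * (k ^ 2 * p⁻¹ * B t ^ 2) := by gcongr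
        _ = _ := one_mul _
    have h6 : (s * p⁻¹ * w) ^ 2 ≤ C₂ * N * E := by
      refine le_trans ?_ hwp
      calc _ = s ^ 2 * p⁻¹ * (w ^ 2 * p⁻¹) := by ring
        _ ≤ 1 * (w ^ 2 * p⁻¹) := by gcongr
        _ = _ := one_mul _
    rw [h1]
    have := three (κ ^ 2 * d) (s * p⁻¹ * (k * B t)) (s * p⁻¹ * w)
    linarith
  have hz' : (k * V₃ t - l * V₁ t) ^ 2 ≤ 2 * (C₃ + ε ^ 2 * C) * N * E := by
    have h1 : k * V₃ t - l * V₁ t = ζ - l * (s / p) * B t := by rw [hzdef]; ring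
    have h2 : (l * (s / p) * B t) ^ 2 ≤ ε ^ 2 * C * N * E := by
      refine le_trans ?_ hBu
      have h3 : l ^ 2 * p⁻¹ ≤ u ^ 8 := by
        have h4 : κ ^ 2 * p⁻¹ = u ^ 8 := by rw [hinv]; field_simp
        rw [← h4, hκ2]
        gcongr
        linarith [sq_nonneg k]
      calc _ = s ^ 2 * p⁻¹ * (l ^ 2 * p⁻¹) * B t ^ 2 := by rw [div_eq_mul_inv]; ring
        _ ≤ 1 * u ^ 4 * B t ^ 2 := by
            gcongr
            exact h3.trans hu84
        _ = _ := by ring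
    rw [h1]
    linarith [sq_nonneg (ζ + l * (s / p) * B t)]
  have hsum : κ ^ 2 * (V₁ t ^ 2 + V₃ t ^ 2) =
      (k * V₁ t + l * V₃ t) ^ 2 + (k * V₃ t - l * V₁ t) ^ 2 := by rw [hκ2]; ring
  have h13 : V₁ t ^ 2 + V₃ t ^ 2 ≤ κ ^ 2 * (V₁ t ^ 2 + V₃ t ^ 2) :=
    le_mul_of_one_le_left (by positivity) (one_le_pow₀ hκ)
  have hV2 : ρ * V₂ t ^ 2 ≤ 3 * (7200 * C + 7200 * (ε ^ 2 * C) + C₂) * N * E := by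
    have h1 : V₂ t = s * d + -(k * p⁻¹ * B t) + -(p⁻¹ * w) := by
      rw [hwdef]; linear_combination (s * d - V₂ t) * hpp
    have h2 : ρ * (s * d) ^ 2 ≤ 7200 * C * N * E := by
      refine le_trans ?_ hρe
      gcongr
      rw [mul_pow]
      exact (mul_le_mul_of_nonneg_right hs2 (sq_nonneg _)).trans hpd2
    have h3 : ρ * (-(k * p⁻¹ * B t)) ^ 2 ≤ 7200 * (ε ^ 2 * C) * N * E := by
      refine le_trans ?_ hρB
      refine mul_le_mul_of_nonneg_left ?_ hρ.le
      have h4 : k ^ 2 * p⁻¹ ≤ 1 := by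
        rw [← hpp]; gcongr; rw [hpk, hκ2]; linarith [sq_nonneg l, sq_nonneg s]
      calc _ = k ^ 2 * p⁻¹ * p⁻¹ * B t ^ 2 := by ring
        _ ≤ 1 * 1 * B t ^ 2 := by gcongr
        _ = _ := by ring
    have h5 : ρ * (-(p⁻¹ * w)) ^ 2 ≤ C₂ * N * E := by
      refine le_trans ?_ hwp
      calc _ = ρ * p⁻¹ * (w ^ 2 * p⁻¹) := by ring
        _ ≤ 1 * 1 * (w ^ 2 * p⁻¹) := by gcongr
        _ = _ := by ring
    have h6 := mul_le_mul_of_nonneg_left (three (s * d) (-(k * p⁻¹ * B t)) (-(p⁻¹ * w))) hρ.le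
    rw [← h1] at h6
    linarith
  refine ⟨?_, ?_, ?_, ?_⟩
  · linarith
  · linarith [sq_nonneg (V₃ t)]
  · linarith
  · linarith [sq_nonneg (V₁ t)]

open Filter Topology FourierTransform
open scoped BoundedContinuousFunction

/-! ### Distributions on the line and the Fourier transform -/

section Schwartz

open SchwartzMap

/-- Complex-valued test functions `θ ∈ C_c^∞(ℝ)`. -/
structure IsTestLine (θ : ℝ → ℂ) : Prop where
  smooth : ContDiff ℝ ∞ θ
  compact : HasCompactSupport θ

/-- The space `L²(ℝ; ℂ)`. -/
abbrev LineL2 : Type := Lp ℂ 2 (volume : Measure ℝ)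

lemma IsTestLine.deriv {θ : ℝ → ℂ} (h : IsTestLine θ) : IsTestLine (deriv θ) :=
  ⟨(contDiff_infty_iff_deriv.1 h.1).2, h.2.deriv⟩

lemma IsTestLine.mul_left {θ : ℝ → ℂ} (h : IsTestLine θ) {a : ℝ → ℂ} (ha : ContDiff ℝ ∞ a) :
    IsTestLine (fun y => a y * θ y) :=
  ⟨ha.mul h.1, h.2.mul_left⟩

lemma IsTestLine.add {θ η : ℝ → ℂ} (h : IsTestLine θ) (h' : IsTestLine η) :
    IsTestLine (fun y => θ y + η y) :=
  ⟨h.1.add h'.1, h.2.add h'.2⟩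

lemma IsTestLine.memLp {θ : ℝ → ℂ} (h : IsTestLine θ) : MemLp θ 2 volume :=
  h.1.continuous.memLp_of_hasCompactSupport h.2

lemma integrable_mul_coe {θ : ℝ → ℂ} (h : MemLp θ 2 volume) (F : LineL2) :
    Integrable (fun y => θ y * F y) :=
  h.integrable_mul (Lp.memLp F)

lemma integral_mul_coe_add {θ₀ θ₁ θ₂ : ℝ → ℂ} (h₀ : MemLp θ₀ 2 volume) (h₁ : MemLp θ₁ 2 volume)
    (h₂ : MemLp θ₂ 2 volume) (F₀ F₁ F₂ : LineL2) :
    ∫ y, (θ₀ y * F₀ y + θ₁ y * F₁ y + θ₂ y * F₂ y) =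
      (∫ y, θ₀ y * F₀ y) + (∫ y, θ₁ y * F₁ y) + ∫ y, θ₂ y * F₂ y := by
  have i := integrable_mul_coe h₀ F₀
  have j := integrable_mul_coe h₁ F₁
  have ij : Integrable (fun y => θ₀ y * F₀ y + θ₁ y * F₁ y) := i.add j
  rw [integral_add ij (integrable_mul_coe h₂ F₂), integral_add i j]

lemma exists_isTestLine : ∃ χ, IsTestLine χ ∧ χ 0 = 1 := by
  have χ : ContDiffBump (0 : ℝ) := ⟨1, 2, one_pos, one_lt_two⟩
  have h1 : HasCompactSupport (Complex.ofReal ∘ χ) :=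
    χ.hasCompactSupport.comp_left Complex.ofReal_zero
  have h2 : ContDiff ℝ ∞ (Complex.ofRealCLM ∘ χ) := Complex.ofRealCLM.contDiff.comp χ.contDiff
  refine ⟨Complex.ofReal ∘ χ, ⟨h2, h1⟩, ?_⟩
  simp [χ.one_of_mem_closedBall (Metric.mem_closedBall_self χ.rIn_pos.le)]

/-- Differential identities of order two against `C_c^∞` functions extend to Schwartz functions,
by cutting off. -/
lemma integral_schwartz_eq_zero (F₀ F₁ F₂ : LineL2)
    (h : ∀ ψ, IsTestLine ψ →
      ∫ y, (ψ y * F₀ y + deriv ψ y * F₁ y + deriv (deriv ψ) y * F₂ y) = 0) (ψ : 𝓢(ℝ, ℂ)) :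
    ∫ y, (ψ y * F₀ y + deriv ψ y * F₁ y + deriv (deriv ψ) y * F₂ y) = 0 := by
  obtain ⟨χ, hχT, hχ0⟩ := exists_isTestLine
  obtain ⟨C₀, hC₀⟩ := hχT.1.continuous.bounded_above_of_compact_support hχT.2
  obtain ⟨C₁, hC₁⟩ := hχT.deriv.1.continuous.bounded_above_of_compact_support hχT.deriv.2
  obtain ⟨C₂, hC₂⟩ :=
    hχT.deriv.deriv.1.continuous.bounded_above_of_compact_support hχT.deriv.deriv.2
  have hC₀0 := (norm_nonneg _).trans (hC₀ 0)
  have hC₁0 := (norm_nonneg _).trans (hC₁ 0)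
  have hC₂0 := (norm_nonneg _).trans (hC₂ 0)
  set ψ' : 𝓢(ℝ, ℂ) := derivCLM ℂ ℂ ψ
  set ψ'' : 𝓢(ℝ, ℂ) := derivCLM ℂ ℂ ψ'
  have hψ' : ∀ y, HasDerivAt ψ (ψ' y) y := fun y => ψ.differentiableAt.hasDerivAt
  have hψ'' : ∀ y, HasDerivAt ψ' (ψ'' y) y := fun y => ψ'.differentiableAt.hasDerivAt
  have hd1 : deriv ψ = ψ' := funext fun y => (hψ' y).deriv
  have hd2 : deriv ψ' = ψ'' := funext fun y => (hψ'' y).deriv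
  have hχ' : ∀ y, HasDerivAt χ (deriv χ y) y := fun y =>
    (hχT.1.differentiable (by simp) y).hasDerivAt
  have hχ'' : ∀ y, HasDerivAt (deriv χ) (deriv (deriv χ) y) y := fun y =>
    (hχT.deriv.1.differentiable (by simp) y).hasDerivAt
  have hsc : ∀ r y : ℝ, HasDerivAt (fun y : ℝ => r * y) r y := fun r y => by
    simpa using (hasDerivAt_id y).const_mul r
  have hcut1 : ∀ r y : ℝ, HasDerivAt (fun y => χ (r * y)) ((r : ℂ) * deriv χ (r * y)) y :=
    fun r y => by simpa [Function.comp_def] using (hχ' (r * y)).scomp y (hsc r y)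
  have hcut2 : ∀ r y : ℝ,
      HasDerivAt (fun y => deriv χ (r * y)) ((r : ℂ) * deriv (deriv χ) (r * y)) y :=
    fun r y => by simpa [Function.comp_def] using (hχ'' (r * y)).scomp y (hsc r y)
  have hP1 : ∀ r : ℝ, deriv (fun y => χ (r * y) * ψ y) =
      fun y => (r : ℂ) * deriv χ (r * y) * ψ y + χ (r * y) * ψ' y := fun r =>
    funext fun y => ((hcut1 r y).mul (hψ' y)).deriv
  have hP2 : ∀ r : ℝ, deriv (deriv (fun y => χ (r * y) * ψ y)) =
      fun y => ((r : ℂ) * (r * deriv (deriv χ) (r * y)) * ψ y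
        + (r : ℂ) * deriv χ (r * y) * ψ' y)
        + ((r : ℂ) * deriv χ (r * y) * ψ' y + χ (r * y) * ψ'' y) := fun r => by
    rw [hP1]
    exact funext fun y => ((((hcut2 r y).const_mul (r : ℂ)).mul (hψ' y)).add
      ((hcut1 r y).mul (hψ'' y))).deriv
  set r : ℕ → ℝ := fun n => 1 / ((n : ℝ) + 1) with hr
  have hr0 : Tendsto r atTop (𝓝 0) := tendsto_one_div_add_atTop_nhds_zero_nat
  have hrn : ∀ n, 0 < r n := fun n => by simp only [hr]; positivity
  have hr1 : ∀ n, r n ≤ 1 := fun n => by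
    simp only [hr]; rw [div_le_one (by positivity)]; simp
  have htest : ∀ n, IsTestLine (fun y => χ (r n * y) * ψ y) := fun n => by
    refine ⟨(hχT.1.comp (by fun_prop)).mul ψ.smooth', HasCompactSupport.mul_right ?_⟩
    exact hχT.2.comp_homeomorph (Homeomorph.mulLeft₀ (r n) (hrn n).ne')
  have hlim : Tendsto (fun n => ∫ y, ((χ (r n * y) * ψ y) * F₀ y
      + deriv (fun y => χ (r n * y) * ψ y) y * F₁ y
      + deriv (deriv (fun y => χ (r n * y) * ψ y)) y * F₂ y)) atTop
      (𝓝 (∫ y, (ψ y * F₀ y + ψ' y * F₁ y + ψ'' y * F₂ y))) := by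
    have hi : ∀ (g : 𝓢(ℝ, ℂ)) (F : LineL2), Integrable (fun y => ‖g y‖ * ‖F y‖) := fun g F => by
      simpa using (integrable_mul_coe (g.memLp 2) F).norm
    refine tendsto_integral_of_dominated_convergence
      (fun y => C₀ * (‖ψ y‖ * ‖F₀ y‖) + (C₁ * (‖ψ y‖ * ‖F₁ y‖) + C₀ * (‖ψ' y‖ * ‖F₁ y‖))
        + ((C₂ * (‖ψ y‖ * ‖F₂ y‖) + C₁ * (‖ψ' y‖ * ‖F₂ y‖))
          + (C₁ * (‖ψ' y‖ * ‖F₂ y‖) + C₀ * (‖ψ'' y‖ * ‖F₂ y‖)))) ?_ ?_ ?_ ?_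
    · intro n
      have h1 := (htest n)
      exact ((integrable_mul_coe h1.memLp F₀).add (integrable_mul_coe h1.deriv.memLp F₁)).add
        (integrable_mul_coe h1.deriv.deriv.memLp F₂) |>.aestronglyMeasurable
    · exact (((hi _ _).const_mul _).add (((hi _ _).const_mul _).add ((hi _ _).const_mul _))).add
        ((((hi _ _).const_mul _).add ((hi _ _).const_mul _)).add
          (((hi _ _).const_mul _).add ((hi _ _).const_mul _)))
    · intro n
      refine Eventually.of_forall fun y => ?_
      rw [hP2, hP1]
      have hrN : ‖(r n : ℂ)‖ ≤ 1 := by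
        rw [Complex.norm_real, Real.norm_of_nonneg (hrn n).le]; exact hr1 n
      have b0 : ∀ x : ℂ, ‖χ (r n * y) * x‖ ≤ C₀ * ‖x‖ := fun x => by
        rw [norm_mul]; gcongr; exact hC₀ _
      have b1 : ∀ x : ℂ, ‖(r n : ℂ) * deriv χ (r n * y) * x‖ ≤ C₁ * ‖x‖ := fun x => by
        rw [norm_mul, norm_mul]; gcongr
        exact (mul_le_of_le_one_left (norm_nonneg _) hrN).trans (hC₁ _)
      have b2 : ∀ x : ℂ, ‖(r n : ℂ) * (r n * deriv (deriv χ) (r n * y)) * x‖ ≤ C₂ * ‖x‖ :=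
        fun x => by
          rw [norm_mul, norm_mul, norm_mul]; gcongr
          exact (mul_le_of_le_one_left (by positivity) hrN).trans
            ((mul_le_of_le_one_left (norm_nonneg _) hrN).trans (hC₂ _))
      refine (norm_add₃_le).trans (add_le_add (add_le_add ?_ ?_) ?_)
      · rw [norm_mul, ← mul_assoc]; gcongr; exact b0 _
      · rw [norm_mul, ← mul_assoc, ← mul_assoc, ← add_mul]; gcongr
        exact (norm_add_le _ _).trans (add_le_add (b1 _) (b0 _))
      · simp only [← mul_assoc]
        rw [norm_mul, ← add_mul, ← add_mul, ← add_mul]; gcongr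
        refine (norm_add_le _ _).trans (add_le_add ((norm_add_le _ _).trans (add_le_add ?_ (b1 _)))
          ((norm_add_le _ _).trans (add_le_add (b1 _) (b0 _))))
        simpa only [← mul_assoc] using b2 (ψ y)
    · refine Eventually.of_forall fun y => ?_
      have hry : Tendsto (fun n => r n * y) atTop (𝓝 0) := by simpa using hr0.mul_const y
      have hrc : Tendsto (fun n => (r n : ℂ)) atTop (𝓝 0) := by
        simpa [Function.comp_def] using (Complex.continuous_ofReal.tendsto 0).comp hr0
      have l0 : Tendsto (fun n => χ (r n * y)) atTop (𝓝 1) := by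
        rw [← hχ0]; exact (hχT.1.continuous.tendsto 0).comp hry
      have l1 : Tendsto (fun n => deriv χ (r n * y)) atTop (𝓝 (deriv χ 0)) :=
        (hχT.deriv.1.continuous.tendsto 0).comp hry
      have l2 : Tendsto (fun n => deriv (deriv χ) (r n * y)) atTop (𝓝 (deriv (deriv χ) 0)) :=
        (hχT.deriv.deriv.1.continuous.tendsto 0).comp hry
      have m1 := hrc.mul l1
      have m2 := hrc.mul (hrc.mul l2)
      have := (((l0.mul_const (ψ y)).mul_const (F₀ y)).add
        (((m1.mul_const (ψ y)).add (l0.mul_const (ψ' y))).mul_const (F₁ y))).add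
        ((((m2.mul_const (ψ y)).add (m1.mul_const (ψ' y))).add
          ((m1.mul_const (ψ' y)).add (l0.mul_const (ψ'' y)))).mul_const (F₂ y))
      simp only [zero_mul, one_mul, zero_add] at this
      simp only [hP2]
      simpa only [hP1] using this
  have hz : ∀ n, (∫ y, ((χ (r n * y) * ψ y) * F₀ y
      + deriv (fun y => χ (r n * y) * ψ y) y * F₁ y
      + deriv (deriv (fun y => χ (r n * y) * ψ y)) y * F₂ y)) = 0 := fun n => h _ (htest n)
  simp only [hz] at hlim
  rw [hd1, hd2]
  exact tendsto_nhds_unique hlim tendsto_const_nhds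

lemma integral_fourier_mul (G : 𝓢(ℝ, ℂ)) (F : LineL2) :
    ∫ y, (𝓕 G) y * F y = ∫ ξ, G ξ * (𝓕 F : LineL2) ξ := by
  have h := congrArg (fun T => T G) (Lp.fourier_toTemperedDistribution_eq F)
  simpa only [TemperedDistribution.fourier_apply, Lp.toTemperedDistribution_apply,
    smul_eq_mul] using h

/-- A differential identity in the weak sense becomes an algebraic one for the Fourier
transforms. -/
theorem fourier_add_eq_zero (F₀ F₁ F₂ : LineL2)
    (h : ∀ ψ, IsTestLine ψ →
      ∫ y, (ψ y * F₀ y + deriv ψ y * F₁ y + deriv (deriv ψ) y * F₂ y) = 0) :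
    ∀ᵐ ξ : ℝ, (𝓕 F₀ : LineL2) ξ + -(2 * Real.pi * Complex.I * ξ) * (𝓕 F₁ : LineL2) ξ
      + (-(2 * Real.pi * Complex.I * ξ)) ^ 2 * (𝓕 F₂ : LineL2) ξ = 0 := by
  set a : ℝ → ℂ := fun ξ => -(2 * Real.pi * Complex.I * ξ) with ha
  have haD : ContDiff ℝ ∞ a := by
    have : ContDiff ℝ ∞ (fun x : ℝ => (x : ℂ)) := Complex.ofRealCLM.contDiff
    exact (contDiff_const.mul this).neg
  have hloc : ∀ F : LineL2, LocallyIntegrable F volume := fun F =>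
    (Lp.memLp F).locallyIntegrable one_le_two
  have hloc' : ∀ (b : ℝ → ℂ) (F : LineL2), Continuous b →
      LocallyIntegrable (fun ξ => b ξ * F ξ) volume := fun b F hb =>
    locallyIntegrableOn_univ.1 ((locallyIntegrableOn_univ.2 (hloc F)).continuousOn_mul
      hb.continuousOn isClosed_univ.isLocallyClosed)
  refine ae_eq_zero_of_integral_contDiff_smul_eq_zero
    (((hloc _).add (hloc' a _ haD.continuous)).add
      (hloc' (fun ξ => a ξ ^ 2) _ (haD.continuous.pow 2))) fun g hg hgs => ?_
  have hgT : IsTestLine (fun ξ => (g ξ : ℂ)) := by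
    have h1 : HasCompactSupport (Complex.ofReal ∘ g) := hgs.comp_left Complex.ofReal_zero
    have h2 : ContDiff ℝ ∞ (Complex.ofRealCLM ∘ g) := Complex.ofRealCLM.contDiff.comp hg
    exact ⟨h2, h1⟩
  have hder : ∀ θ (hθ : IsTestLine θ), deriv (𝓕 (hθ.2.toSchwartzMap hθ.1) : 𝓢(ℝ, ℂ)) =
      (𝓕 ((hθ.mul_left haD).2.toSchwartzMap (hθ.mul_left haD).1) : 𝓢(ℝ, ℂ)) := fun θ hθ => by
    rw [SchwartzMap.fourier_coe, SchwartzMap.fourier_coe]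
    have h1 : Integrable θ := hθ.1.continuous.integrable_of_hasCompactSupport hθ.2
    have h2 : Integrable (fun x : ℝ => x • θ x) :=
      (continuous_id.smul hθ.1.continuous).integrable_of_hasCompactSupport hθ.2.smul_left
    refine (Real.deriv_fourier h1 h2).trans ?_
    congr 1
    funext x
    simp only [HasCompactSupport.toSchwartzMap_toFun, ha, smul_eq_mul]
    ring
  set G₀ := hgT.2.toSchwartzMap hgT.1
  set G₁ := (hgT.mul_left haD).2.toSchwartzMap (hgT.mul_left haD).1 with hG₁
  set G₂ := ((hgT.mul_left haD).mul_left haD).2.toSchwartzMap ((hgT.mul_left haD).mul_left haD).1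
    with hG₂
  have h1 := integral_schwartz_eq_zero F₀ F₁ F₂ h (𝓕 G₀)
  rw [hder _ hgT, ← hG₁, hder _ (hgT.mul_left haD), ← hG₂] at h1
  rw [integral_mul_coe_add ((𝓕 G₀).memLp 2) ((𝓕 G₁).memLp 2) ((𝓕 G₂).memLp 2),
    integral_fourier_mul, integral_fourier_mul, integral_fourier_mul,
    ← integral_mul_coe_add (G₀.memLp 2) (G₁.memLp 2) (G₂.memLp 2)] at h1
  rw [← h1]
  refine integral_congr_ae (Eventually.of_forall fun ξ => ?_)
  simp only [G₀, G₁, G₂, HasCompactSupport.toSchwartzMap_toFun, Complex.real_smul, ha]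
  ring

end Schwartz

/-! ### Linear systems with multiplication operators -/

section LinearODE

variable {E : Type*} [NormedAddCommGroup E] [NormedSpace ℝ E]

/-- The terms of the Picard series of the linear equation `x' = A(t) x`, `x(0) = v`. -/
def picardTerm (A : ℝ → E →L[ℝ] E) (v : E) : ℕ → ℝ → E
  | 0 => fun _ => v
  | n + 1 => fun t => ∫ s in (0 : ℝ)..t, A s (picardTerm A v n s)

lemma continuous_picardTerm {A : ℝ → E →L[ℝ] E} (hA : Continuous A) (v : E) (n : ℕ) :
    Continuous (picardTerm A v n) := by
  induction n with
  | zero => exact continuous_const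
  | succ n ih =>
    exact intervalIntegral.continuous_primitive (μ := volume)
      (fun a b => (hA.clm_apply ih).intervalIntegrable a b) 0

lemma hasDerivAt_picardTerm [CompleteSpace E] {A : ℝ → E →L[ℝ] E} (hA : Continuous A)
    (v : E) (n : ℕ) (t : ℝ) :
    HasDerivAt (picardTerm A v (n + 1)) (A t (picardTerm A v n t)) t :=
  (hA.clm_apply (continuous_picardTerm hA v n)).integral_hasStrictDerivAt 0 t |>.hasDerivAt

lemma norm_picardTerm_le {A : ℝ → E →L[ℝ] E} (hA : Continuous A) (v : E) {K T : ℝ}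
    (hK : ∀ s, |s| ≤ T → ‖A s‖ ≤ K) (n : ℕ) {t : ℝ} (ht : |t| ≤ T) :
    ‖picardTerm A v n t‖ ≤ ‖v‖ * ((K * |t|) ^ n / n.factorial) := by
  have hK0 : 0 ≤ K := (norm_nonneg _).trans (hK 0 (by simpa using (abs_nonneg t).trans ht))
  induction n generalizing t with
  | zero => simp [picardTerm]
  | succ n ih =>
    have hsub : ∀ s ∈ uIoc 0 t, |s| ≤ |t| := fun s hs => by
      simpa using abs_sub_left_of_mem_uIcc (uIoc_subset_uIcc hs)
    calc ‖picardTerm A v (n + 1) t‖ ≤ ∫ s in uIoc 0 t, ‖A s (picardTerm A v n s)‖ :=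
          intervalIntegral.norm_integral_le_integral_norm_uIoc
      _ ≤ ∫ s in uIoc 0 t, ‖v‖ * K ^ (n + 1) / n.factorial * |s - 0| ^ n := by
          refine setIntegral_mono_on ?_ ?_ measurableSet_uIoc fun s hs => ?_
          · exact ((hA.clm_apply (continuous_picardTerm hA v n)).norm.intervalIntegrable
              0 t).def'
          · exact (Continuous.intervalIntegrable (by fun_prop) 0 t).def'
          · have hs' := (hsub s hs).trans ht
            calc _ ≤ ‖A s‖ * ‖picardTerm A v n s‖ := (A s).le_opNorm _
              _ ≤ K * (‖v‖ * ((K * |s|) ^ n / n.factorial)) := by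
                  gcongr
                  · exact hK s hs'
                  · exact ih hs'
              _ = _ := by rw [sub_zero, mul_pow]; ring
      _ = _ := by
          rw [integral_const_mul, integral_pow_abs_sub_uIoc, sub_zero, Nat.factorial_succ]
          push_cast
          rw [mul_pow]
          field_simp

/-- Global existence for linear ordinary differential equations with continuous coefficients. -/
theorem exists_linear_ode [CompleteSpace E] {A : ℝ → E →L[ℝ] E} (hA : Continuous A) (v : E) :
    ∃ x : ℝ → E, x 0 = v ∧ ∀ t, HasDerivAt x (A t (x t)) t := by
  have hbd : ∀ T : ℝ, ∃ K, ∀ s, |s| ≤ T → ‖A s‖ ≤ K := fun T => by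
    obtain ⟨K, hK⟩ := (isCompact_Icc (a := -T) (b := T)).exists_bound_of_continuousOn
      hA.continuousOn
    exact ⟨K, fun s hs => hK s (abs_le.1 hs)⟩
  have hsum : ∀ t, Summable fun n => picardTerm A v n t := fun t => by
    obtain ⟨K, hK⟩ := hbd |t|
    exact Summable.of_norm_bounded
      ((Real.summable_pow_div_factorial (K * |t|)).mul_left ‖v‖)
      fun n => norm_picardTerm_le hA v hK n le_rfl
  refine ⟨fun t => ∑' n, picardTerm A v n t, ?_, fun t => ?_⟩
  · change ∑' n, picardTerm A v n 0 = v
    rw [tsum_eq_single 0]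
    · rfl
    · intro n hn
      obtain ⟨m, rfl⟩ := Nat.exists_eq_succ_of_ne_zero hn
      simp [picardTerm]
  · obtain ⟨K, hK⟩ := hbd (|t| + 1)
    have hK0 : 0 ≤ K := (norm_nonneg _).trans (hK 0 (by simp; positivity))
    have hmem : t ∈ Metric.ball (0 : ℝ) (|t| + 1) := by simp
    have h := hasDerivAt_tsum_of_isPreconnected (𝕜 := ℝ) (t := Metric.ball (0 : ℝ) (|t| + 1))
      (g := fun n => picardTerm A v (n + 1)) (g' := fun n s => A s (picardTerm A v n s))
      (((Real.summable_pow_div_factorial (K * (|t| + 1))).mul_left ‖v‖).mul_left K)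
      Metric.isOpen_ball (convex_ball (0 : ℝ) _).isPreconnected
      (fun n s _ => hasDerivAt_picardTerm hA v n s)
      (fun n s hs => by
        have hs' : |s| ≤ |t| + 1 := by simpa using (Metric.mem_ball.1 hs).le
        refine ((A s).le_opNorm _).trans ?_
        gcongr
        · exact hK s hs'
        · refine (norm_picardTerm_le hA v hK n hs').trans ?_
          gcongr) hmem ((summable_nat_add_iff 1).2 (hsum t)) hmem
    have h2 : (fun s => ∑' n, picardTerm A v n s) =
        fun s => v + ∑' n, picardTerm A v (n + 1) s := funext fun s => by
      rw [(hsum s).tsum_eq_zero_add]; rfl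
    rw [h2]
    refine (h.const_add v).congr_deriv ?_
    rw [← (A t).map_tsum (hsum t)]
    exact congrArg (A t) (congrFun h2 t)

end LinearODE

section Propagator

variable {V : Type*} [NormedAddCommGroup V] [NormedSpace ℝ V]
  {R : Type*} [NormedAddCommGroup R] [NormedSpace ℝ R] {ι : Type*} [Fintype ι] [DecidableEq ι]

/-- The action on `ι → V` of a matrix with entries in `R`, where `R` acts on `V` by `p`. -/
def matOp (p : R →L[ℝ] V →L[ℝ] V) (m : ι → ι → R) : (ι → V) →L[ℝ] (ι → V) :=
  ∑ i, ∑ j, (ContinuousLinearMap.single ℝ (fun _ : ι => V) i).comp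
    ((p (m i j)).comp (ContinuousLinearMap.proj j))

lemma matOp_apply (p : R →L[ℝ] V →L[ℝ] V) (m : ι → ι → R) (x : ι → V) (i : ι) :
    matOp p m x i = ∑ j, p (m i j) (x j) := by
  simp only [matOp, sum_apply, Finset.sum_apply,
    ContinuousLinearMap.comp_apply, ContinuousLinearMap.single_apply,
    ContinuousLinearMap.proj_apply]
  rw [Finset.sum_eq_single i]
  · simp
  · intro b _ hb
    exact Finset.sum_eq_zero fun j _ => by simp [Pi.single_eq_of_ne hb.symm]
  · simp

lemma continuous_matOp (p : R →L[ℝ] V →L[ℝ] V) {m : ℝ → ι → ι → R}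
    (hm : ∀ i j, Continuous fun t => m t i j) : Continuous fun t => matOp p (m t) := by
  unfold matOp
  refine continuous_finsetSum _ fun i _ => continuous_finsetSum _ fun j _ => ?_
  exact continuous_const.clm_comp ((p.continuous.comp (hm i j)).clm_comp continuous_const)

end Propagator

/-- Uniqueness for linear equations on `[0, ∞)`. -/
lemma linear_ode_unique {E : Type*} [NormedAddCommGroup E] [NormedSpace ℝ E]
    {A : ℝ → E →L[ℝ] E} (hA : Continuous A) {x y : ℝ → E} (hx : Continuous x) (hy : Continuous y)
    (hx' : ∀ t, 0 ≤ t → HasDerivWithinAt x (A t (x t)) (Ici t) t)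
    (hy' : ∀ t, 0 ≤ t → HasDerivWithinAt y (A t (y t)) (Ici t) t) (h0 : x 0 = y 0)
    {T : ℝ} (hT : 0 ≤ T) : x T = y T := by
  obtain ⟨K, hK⟩ := (isCompact_Icc (a := (0 : ℝ)) (b := T)).exists_bound_of_continuousOn
    hA.continuousOn
  refine ODE_solution_unique_of_mem_Icc_right (v := fun t => A t) (s := fun _ => univ)
    (K := K.toNNReal) (fun t ht => ?_) hx.continuousOn (fun t ht => hx' t ht.1)
    (fun _ _ => mem_univ _) hy.continuousOn (fun t ht => hy' t ht.1) (fun _ _ => mem_univ _) h0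
    ⟨hT, le_rfl⟩
  refine ((A t).lipschitz.weaken ?_).lipschitzOnWith
  rw [← NNReal.coe_le_coe, coe_nnnorm]
  exact (hK t ⟨ht.1, ht.2.le⟩).trans (Real.le_coe_toNNReal K)

lemma coeFn_finset_sum {α ι : Type*} [MeasurableSpace α] {μ : Measure α} (s : Finset ι)
    (f : ι → Lp ℂ 2 μ) : (∑ j ∈ s, f j : Lp ℂ 2 μ) =ᵐ[μ] fun x => ∑ j ∈ s, f j x := by
  classical
  induction s using Finset.induction_on with
  | empty => exact Lp.coeFn_zero ℂ 2 μ
  | insert a s ha ih =>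
    rw [Finset.sum_insert ha]
    filter_upwards [Lp.coeFn_add (f a) (∑ j ∈ s, f j), ih] with x h1 h2
    rw [h1, Pi.add_apply, h2, Finset.sum_insert ha]

/-- Lebesgue measure on the band `[-R, R]`. -/
abbrev bandMeasure (R : ℝ) : Measure ℝ := volume.restrict (Icc (-R) R)

/-- The space `L²([-R, R]; ℂ)`. -/
abbrev BandL2 (R : ℝ) : Type := Lp ℂ 2 (bandMeasure R)

/-- Multiplication operators on `L²([-R, R])` by bounded continuous functions. -/
def mulOp (R : ℝ) : (ℝ →ᵇ ℝ) →L[ℝ] BandL2 R →L[ℝ] BandL2 R :=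
  ((ContinuousLinearMap.lsmul ℝ ℝ : ℝ →L[ℝ] ℂ →L[ℝ] ℂ).holderL (bandMeasure R) ∞ 2 2).comp
    (BoundedContinuousFunction.toLp ∞ (bandMeasure R) ℝ)

lemma coeFn_mulOp (R : ℝ) (φ : ℝ →ᵇ ℝ) (h : BandL2 R) :
    mulOp R φ h =ᵐ[bandMeasure R] fun ξ => (φ ξ : ℂ) * h ξ := by
  have h1 := (ContinuousLinearMap.lsmul ℝ ℝ : ℝ →L[ℝ] ℂ →L[ℝ] ℂ).coeFn_holder (r := 2)
    (BoundedContinuousFunction.toLp ∞ (bandMeasure R) ℝ φ) h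
  filter_upwards [h1, BoundedContinuousFunction.coeFn_toLp (p := ∞) (μ := bandMeasure R) ℝ φ]
    with ξ h2 h3
  refine h2.trans ?_
  rw [h3]
  simp

lemma mulOp_mul (R : ℝ) (φ χ : ℝ →ᵇ ℝ) (h : BandL2 R) :
    mulOp R (φ * χ) h = mulOp R φ (mulOp R χ h) := by
  apply Lp.ext
  filter_upwards [coeFn_mulOp R (φ * χ) h, coeFn_mulOp R φ (mulOp R χ h), coeFn_mulOp R χ h]
    with ξ h1 h2 h3
  rw [h1, h2, h3]
  simp [mul_assoc]

lemma mulOp_one (R : ℝ) (h : BandL2 R) : mulOp R 1 h = h := by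
  apply Lp.ext
  filter_upwards [coeFn_mulOp R 1 h] with ξ h1
  rw [h1]
  simp

lemma mulOp_smul (R : ℝ) (φ : ℝ →ᵇ ℝ) (c : ℂ) (h : BandL2 R) :
    mulOp R φ (c • h) = c • mulOp R φ h := by
  apply Lp.ext
  filter_upwards [coeFn_mulOp R φ (c • h), coeFn_mulOp R φ h, Lp.coeFn_smul c h,
    Lp.coeFn_smul c (mulOp R φ h)] with ξ h1 h2 h3 h4
  rw [h1, h3, h4, Pi.smul_apply, Pi.smul_apply, h2]
  simp only [smul_eq_mul]
  ring

/-- A solution in `L²([-R, R])` of a linear system whose coefficients are multiplication operators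
solves the system pointwise: it is the image of its initial value under the fundamental matrix,
which may be evaluated at a point. -/
theorem exists_pointwise_solution {ι : Type*} [Fintype ι] [DecidableEq ι] (R : ℝ)
    {m : ℝ → ι → ι → (ℝ →ᵇ ℝ)} (hm : ∀ i j, Continuous fun t => m t i j)
    {X : ℝ → ι → BandL2 R} (hX : Continuous X)
    (hX' : ∀ t, 0 ≤ t →
      HasDerivWithinAt X (fun i => ∑ j, mulOp R (m t i j) (X t j)) (Ici t) t)
    {T : ℝ} (hT : 0 ≤ T) :
    ∀ᵐ ξ ∂(bandMeasure R), ∃ y : ℝ → ι → ℂ,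
      (∀ t i, HasDerivAt (fun s => y s i) (∑ j, (m t i j ξ : ℂ) * y t j) t) ∧
      (∀ i, y 0 i = X 0 i ξ) ∧ ∀ i, y T i = X T i ξ := by
  -- `Φ j` is the `j`-th column of the fundamental matrix, with values in the algebra `ℝ →ᵇ ℝ`
  have hA := continuous_matOp (ContinuousLinearMap.mul ℝ (ℝ →ᵇ ℝ)) hm
  choose Φ hΦ0 hΦ' using fun j : ι => exists_linear_ode hA (Pi.single j 1)
  have hΦi : ∀ j i t, HasDerivAt (fun s => Φ j s i) (∑ a, m t i a * Φ j t a) t := fun j i t => by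
    refine ((hasDerivAt_pi.1 (hΦ' j t)) i).congr_deriv ?_
    rw [matOp_apply]
    rfl
  set Y : ℝ → ι → BandL2 R := fun t i => ∑ j, mulOp R (Φ j t i) (X 0 j) with hY
  have hY' : ∀ t, HasDerivAt Y (matOp (mulOp R) (m t) (Y t)) t := fun t => by
    refine hasDerivAt_pi.2 fun i => ?_
    have h1 : HasDerivAt (fun s => ∑ j, mulOp R (Φ j s i) (X 0 j))
        (∑ j, mulOp R (∑ a, m t i a * Φ j t a) (X 0 j)) t := by
      refine HasDerivAt.fun_sum fun j _ => ?_
      exact (((mulOp R).flip (X 0 j)).hasFDerivAt.comp_hasDerivAt t (hΦi j i t))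
    refine h1.congr_deriv ?_
    rw [matOp_apply]
    simp only [hY, map_sum, sum_apply, mulOp_mul]
    exact Finset.sum_comm
  have hYc : Continuous Y := continuous_iff_continuousAt.2 fun t => (hY' t).continuousAt
  have hY0 : Y 0 = X 0 := funext fun i => by
    simp only [hY, hΦ0]
    rw [Finset.sum_eq_single i]
    · simp [mulOp_one]
    · intro b _ hb
      simp [Pi.single_eq_of_ne hb.symm]
    · simp
  have hXY : Y T = X T := linear_ode_unique (continuous_matOp (mulOp R) hm) hYc hX
    (fun t _ => (hY' t).hasDerivWithinAt)
    (fun t ht => (hX' t ht).congr_deriv (funext fun i => (matOp_apply _ _ _ _).symm)) hY0 hT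
  have key : ∀ t, ∀ᵐ ξ ∂(bandMeasure R), ∀ i, Y t i ξ = ∑ j, (Φ j t i ξ : ℂ) * X 0 j ξ := by
    intro t
    refine ae_all_iff.2 fun i => ?_
    have h1 : ∀ᵐ ξ ∂(bandMeasure R), ∀ j,
        mulOp R (Φ j t i) (X 0 j) ξ = (Φ j t i ξ : ℂ) * X 0 j ξ :=
      ae_all_iff.2 fun j => coeFn_mulOp R _ _
    filter_upwards [h1, coeFn_finset_sum Finset.univ fun j => mulOp R (Φ j t i) (X 0 j)]
      with ξ h2 h3
    rw [hY, h3]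
    exact Finset.sum_congr rfl fun j _ => h2 j
  filter_upwards [key T] with ξ hξ
  refine ⟨fun t i => ∑ j, (Φ j t i ξ : ℂ) * X 0 j ξ, fun t i => ?_, fun i => ?_, fun i => ?_⟩
  · have h1 : HasDerivAt (fun s => ∑ j, (Φ j s i ξ : ℂ) * X 0 j ξ)
        (∑ j, ((∑ a, m t i a * Φ j t a : ℝ →ᵇ ℝ) ξ : ℂ) * X 0 j ξ) t := by
      refine HasDerivAt.fun_sum fun j _ => HasDerivAt.mul_const ?_ _
      have h2 : HasDerivAt (fun s => Φ j s i ξ) ((∑ a, m t i a * Φ j t a : ℝ →ᵇ ℝ) ξ) t :=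
        (BoundedContinuousFunction.evalCLM ℝ ξ : (ℝ →ᵇ ℝ) →L[ℝ] ℝ).hasFDerivAt.comp_hasDerivAt t
          (hΦi j i t)
      exact h2.ofReal_comp
    refine h1.congr_deriv ?_
    simp only [BoundedContinuousFunction.coe_sum, Finset.sum_apply,
      BoundedContinuousFunction.coe_mul, Pi.mul_apply, Complex.ofReal_sum, Complex.ofReal_mul,
      Finset.sum_mul, Finset.mul_sum, mul_assoc]
    exact Finset.sum_comm
  · change ∑ j, (Φ j 0 i ξ : ℂ) * X 0 j ξ = _
    rw [Finset.sum_eq_single i]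
    · simp [hΦ0]
    · intro b _ hb
      simp [hΦ0, Pi.single_eq_of_ne hb.symm]
    · simp
  · rw [← hXY, hξ]

/-! ### Evolution equations on a band of frequencies -/

/-- The Fourier transform followed by the restriction to the band `|ξ| ≤ R`. -/
def bandFourier (R : ℝ) : LineL2 →L[ℂ] BandL2 R :=
  (LpToLpRestrictCLM ℝ ℂ ℂ volume 2 (Icc (-R) R)).comp
    (Lp.fourierTransformₗᵢ ℝ ℂ).toContinuousLinearEquiv.toContinuousLinearMap

lemma coeFn_bandFourier (R : ℝ) (F : LineL2) :
    bandFourier R F =ᵐ[bandMeasure R] (𝓕 F : LineL2) :=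
  LpToLpRestrictCLM_coeFn ℂ (Icc (-R) R) (𝓕 F : LineL2)

/-- The angular frequency `2πξ`, truncated outside the band `|ξ| ≤ R`. -/
def freq (R : ℝ) : ℝ →ᵇ ℝ :=
  BoundedContinuousFunction.ofNormedAddCommGroup
    (fun ξ => 2 * Real.pi * max (-|R|) (min ξ |R|)) (by fun_prop) (2 * Real.pi * |R|) fun ξ => by
      rw [norm_mul, Real.norm_of_nonneg Real.two_pi_pos.le]
      gcongr
      rw [Real.norm_eq_abs, abs_le]
      exact ⟨le_max_left _ _, max_le (by linarith [abs_nonneg R]) (min_le_right _ _)⟩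

lemma freq_apply {R ξ : ℝ} (h : ξ ∈ Icc (-R) R) : freq R ξ = 2 * Real.pi * ξ := by
  have h1 : ξ ≤ |R| := h.2.trans (le_abs_self R)
  have h2 : -|R| ≤ ξ := (neg_le_neg (le_abs_self R)).trans h.1
  simp [freq, h1, h2]

lemma ae_freq (R : ℝ) : ∀ᵐ ξ ∂(bandMeasure R), freq R ξ = 2 * Real.pi * ξ :=
  (ae_restrict_mem measurableSet_Icc).mono fun _ h => freq_apply h

/-- On a band, the symbol of `∂_y` is the bounded multiplier `i freq R`; moving the derivatives from
the test function to `F₁`, `F₂` changes the sign of the term of order one. -/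
lemma bandFourier_add_eq_zero (R : ℝ) (F₀ F₁ F₂ : LineL2)
    (h : ∀ ψ, IsTestLine ψ →
      ∫ y, (ψ y * F₀ y + deriv ψ y * F₁ y + deriv (deriv ψ) y * F₂ y) = 0) :
    bandFourier R F₀ - Complex.I • mulOp R (freq R) (bandFourier R F₁)
      - mulOp R (freq R) (mulOp R (freq R) (bandFourier R F₂)) = 0 := by
  rw [← mulOp_mul]
  apply Lp.ext
  set G₁ := mulOp R (freq R) (bandFourier R F₁)
  set G₂ := mulOp R (freq R * freq R) (bandFourier R F₂)
  filter_upwards [ae_restrict_of_ae (fourier_add_eq_zero F₀ F₁ F₂ h), coeFn_bandFourier R F₀,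
    coeFn_bandFourier R F₁, coeFn_bandFourier R F₂, ae_freq R,
    coeFn_mulOp R (freq R) (bandFourier R F₁),
    coeFn_mulOp R (freq R * freq R) (bandFourier R F₂), Lp.coeFn_smul Complex.I G₁,
    Lp.coeFn_sub (bandFourier R F₀ - Complex.I • G₁) G₂,
    Lp.coeFn_sub (bandFourier R F₀) (Complex.I • G₁), Lp.coeFn_zero ℂ 2 (bandMeasure R)]
    with ξ h0 h1 h2 h3 h4 h5 h6 h7 h8 h9 h10
  rw [h8, Pi.sub_apply, h9, Pi.sub_apply, h7, Pi.smul_apply, h5, h6, h1, h2, h3, h10,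
    BoundedContinuousFunction.mul_apply, h4, Pi.zero_apply, ← h0]
  simp only [smul_eq_mul, Complex.ofReal_mul, Complex.ofReal_ofNat]
  linear_combination -(2 * Real.pi * ξ) ^ 2 * (𝓕 F₂ : LineL2) ξ * Complex.I_sq

/-- Integration against a fixed function, as a functional on `L²(ℝ)`. -/
def pairing {θ : ℝ → ℂ} (h : MemLp θ 2 volume) : LineL2 →L[ℂ] ℂ :=
  (ContinuousLinearMap.mul ℂ ℂ).lpPairing volume 2 2 h.toLp

lemma pairing_apply {θ : ℝ → ℂ} (h : MemLp θ 2 volume) (F : LineL2) :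
    pairing h F = ∫ y, θ y * F y := by
  rw [pairing, ContinuousLinearMap.lpPairing_eq_integral]
  refine integral_congr_ae ?_
  filter_upwards [h.coeFn_toLp] with y hy
  rw [hy]
  rfl

/-- A weak evolution equation on the line with terms of order at most two in `y` becomes a strong
evolution equation for the Fourier transform on each band. -/
theorem hasDerivWithinAt_bandFourier (R : ℝ) {w A₀ A₁ A₂ : ℝ → LineL2} (hw : Continuous w)
    (h₀ : Continuous A₀) (h₁ : Continuous A₁) (h₂ : Continuous A₂)
    (h : ∀ ψ, IsTestLine ψ → ∀ t, 0 ≤ t →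
      HasDerivWithinAt (fun s => ∫ y, ψ y * w s y)
        ((∫ y, ψ y * A₀ t y) + (∫ y, deriv ψ y * A₁ t y) + ∫ y, deriv (deriv ψ) y * A₂ t y)
        (Ici t) t) {t : ℝ} (ht : 0 ≤ t) :
    HasDerivWithinAt (fun s => bandFourier R (w s))
      (bandFourier R (A₀ t) - Complex.I • mulOp R (freq R) (bandFourier R (A₁ t))
        - mulOp R (freq R) (mulOp R (freq R) (bandFourier R (A₂ t)))) (Ici t) t := by
  set L₁ : LineL2 →L[ℝ] BandL2 R :=
    Complex.I • (mulOp R (freq R)).comp ((bandFourier R).restrictScalars ℝ) with hL₁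
  set L₂ : LineL2 →L[ℝ] BandL2 R :=
    (mulOp R (freq R)).comp ((mulOp R (freq R)).comp ((bandFourier R).restrictScalars ℝ)) with hL₂
  set L₀ : LineL2 →L[ℝ] BandL2 R := (bandFourier R).restrictScalars ℝ with hL₀
  have hint : ∀ s, 0 ≤ s → L₀ (w s) = L₀ (w 0) +
      ∫ r in (0 : ℝ)..s, (L₀ (A₀ r) - L₁ (A₁ r) - L₂ (A₂ r)) := by
    intro s hs
    have hI : ∀ {A : ℝ → LineL2}, Continuous A → IntervalIntegrable A volume 0 s :=
      fun hA => hA.intervalIntegrable 0 s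
    have hJ : ∀ {A : ℝ → LineL2} (L : LineL2 →L[ℝ] BandL2 R), Continuous A →
        IntervalIntegrable (fun r => L (A r)) volume 0 s :=
      fun L hA => (L.continuous.comp hA).intervalIntegrable 0 s
    -- integrated in time, the weak equation is a differential identity on the line
    have key := bandFourier_add_eq_zero R (w s - w 0 - ∫ r in (0 : ℝ)..s, A₀ r)
      (-∫ r in (0 : ℝ)..s, A₁ r) (-∫ r in (0 : ℝ)..s, A₂ r) fun ψ hψ => by
        rw [integral_mul_coe_add hψ.memLp hψ.deriv.memLp hψ.deriv.deriv.memLp,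
          ← pairing_apply hψ.memLp, ← pairing_apply hψ.deriv.memLp,
          ← pairing_apply hψ.deriv.deriv.memLp, map_sub, map_sub, map_neg, map_neg,
          ← ContinuousLinearMap.intervalIntegral_comp_comm _ (hI h₀),
          ← ContinuousLinearMap.intervalIntegral_comp_comm _ (hI h₁),
          ← ContinuousLinearMap.intervalIntegral_comp_comm _ (hI h₂)]
        have c₀ : Continuous fun r => pairing hψ.memLp (A₀ r) :=
          (pairing hψ.memLp).continuous.comp h₀
        have c₁ : Continuous fun r => pairing hψ.deriv.memLp (A₁ r) :=
          (pairing hψ.deriv.memLp).continuous.comp h₁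
        have c₂ : Continuous fun r => pairing hψ.deriv.deriv.memLp (A₂ r) :=
          (pairing hψ.deriv.deriv.memLp).continuous.comp h₂
        have c₀₁ : Continuous fun r => pairing hψ.memLp (A₀ r) + pairing hψ.deriv.memLp (A₁ r) :=
          c₀.add c₁
        have h1 := intervalIntegral.integral_eq_sub_of_hasDeriv_right
          (f := fun r => pairing hψ.memLp (w r))
          (f' := fun r => pairing hψ.memLp (A₀ r) + pairing hψ.deriv.memLp (A₁ r)
            + pairing hψ.deriv.deriv.memLp (A₂ r)) (a := 0) (b := s)
          ((pairing hψ.memLp).continuous.comp hw).continuousOn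
          (fun r hr => by
            have hr0 : 0 ≤ r := by
              rw [min_eq_left hs] at hr
              exact hr.1.le
            simp only [pairing_apply]
            exact (h ψ hψ r hr0).mono Ioi_subset_Ici_self)
          ((c₀₁.add c₂).intervalIntegrable 0 s)
        rw [intervalIntegral.integral_add (c₀₁.intervalIntegrable 0 s)
            (c₂.intervalIntegrable 0 s),
          intervalIntegral.integral_add (c₀.intervalIntegrable 0 s)
            (c₁.intervalIntegrable 0 s)] at h1
        linear_combination -h1
    have e0 : ∫ r in (0 : ℝ)..s, (L₀ (A₀ r) - L₁ (A₁ r) - L₂ (A₂ r)) =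
        L₀ (∫ r in (0 : ℝ)..s, A₀ r) - L₁ (∫ r in (0 : ℝ)..s, A₁ r)
          - L₂ (∫ r in (0 : ℝ)..s, A₂ r) := by
      rw [intervalIntegral.integral_sub ((hJ L₀ h₀).sub (hJ L₁ h₁)) (hJ L₂ h₂),
        intervalIntegral.integral_sub (hJ L₀ h₀) (hJ L₁ h₁),
        L₀.intervalIntegral_comp_comm (hI h₀), L₁.intervalIntegral_comp_comm (hI h₁),
        L₂.intervalIntegral_comp_comm (hI h₂)]
    have e1 : L₀ (w s - w 0 - ∫ r in (0 : ℝ)..s, A₀ r) - L₁ (-∫ r in (0 : ℝ)..s, A₁ r)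
        - L₂ (-∫ r in (0 : ℝ)..s, A₂ r) = 0 := key
    rw [map_sub, map_sub, map_neg, map_neg] at e1
    rw [e0, ← sub_eq_zero, ← e1]
    abel
  have hc : Continuous fun r => L₀ (A₀ r) - L₁ (A₁ r) - L₂ (A₂ r) :=
    ((L₀.continuous.comp h₀).sub (L₁.continuous.comp h₁)).sub (L₂.continuous.comp h₂)
  have hd := ((hc.integral_hasStrictDerivAt 0 t).hasDerivAt.const_add
    (L₀ (w 0))).hasDerivWithinAt (s := Ici t)
  exact hd.congr (fun s hs => hint s (ht.trans hs)) (hint t ht)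

/-! ### Parseval's identity in the periodic variables -/

lemma eLpNorm_two_sq {α E : Type*} [MeasurableSpace α] [NormedAddCommGroup E] (f : α → E)
    (μ : Measure α) : eLpNorm f 2 μ ^ 2 = ∫⁻ x, ‖f x‖ₑ ^ 2 ∂μ := by
  rw [eLpNorm_eq_lintegral_rpow_enorm_toReal two_ne_zero ENNReal.ofNat_ne_top,
    ← ENNReal.rpow_natCast, ← ENNReal.rpow_mul]
  simp

lemma memLp_two_iff {α E : Type*} [MeasurableSpace α] [NormedAddCommGroup E] {f : α → E}
    {μ : Measure α} : MemLp f 2 μ ↔ AEStronglyMeasurable f μ ∧ ∫⁻ x, ‖f x‖ₑ ^ 2 ∂μ < ⊤ := by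
  rw [← eLpNorm_two_sq, MemLp]
  simp

lemma lintegral_enorm_sq {α E : Type*} [MeasurableSpace α] [NormedAddCommGroup E] {f : α → E}
    {μ : Measure α} (hf : MemLp f 2 μ) :
    ∫⁻ x, ‖f x‖ₑ ^ 2 ∂μ = ENNReal.ofReal (∫ x, ‖f x‖ ^ 2 ∂μ) := by
  rw [ofReal_integral_eq_lintegral_ofReal (hf.integrable_norm_pow two_ne_zero)
    (Eventually.of_forall fun x => by positivity)]
  refine lintegral_congr fun x => ?_
  rw [← ofReal_norm, ENNReal.ofReal_pow (norm_nonneg _)]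

/-- The `k`-th Fourier coefficient, without normalization, of a function on the torus. -/
def circleCoef (g : Torus → ℂ) (k : ℤ) : ℂ := ∫ x, g x * fourier (-k) x

lemma circleCoef_eq (g : Torus → ℂ) (k : ℤ) :
    circleCoef g k = (2 * Real.pi : ℝ) * fourierCoeff g k := by
  rw [fourierCoeff, AddCircle.integral_haarAddCircle, circleCoef, Complex.real_smul,
    ← mul_assoc, ← Complex.ofReal_mul, mul_inv_cancel₀ Real.two_pi_pos.ne', Complex.ofReal_one,
    one_mul]
  simp only [smul_eq_mul, mul_comm]

/-- Parseval's identity on the torus. -/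
lemma parseval_circle {g : Torus → ℂ} (hg : MemLp g 2 volume) :
    ENNReal.ofReal (2 * Real.pi) * ∫⁻ x, ‖g x‖ₑ ^ 2 = ∑' k, ‖circleCoef g k‖ₑ ^ 2 := by
  have hh := memLp_haarAddCircle_iff.2 hg
  have h1 := hasSum_sq_fourierCoeff hh.toLp
  have h2 : ∫ t, ‖(hh.toLp : Torus → ℂ) t‖ ^ 2 ∂AddCircle.haarAddCircle =
      (2 * Real.pi)⁻¹ * ∫ t, ‖g t‖ ^ 2 := by
    refine Eq.trans ?_ (AddCircle.integral_haarAddCircle (f := fun t => ‖g t‖ ^ 2))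
    refine integral_congr_ae ?_
    filter_upwards [hh.coeFn_toLp] with t ht
    rw [ht]
  rw [h2] at h1
  simp only [fourierCoeff_congr_ae hh.coeFn_toLp] at h1
  have h3 := h1.mul_left ((2 * Real.pi) ^ 2)
  have h4 : ∀ k, (2 * Real.pi) ^ 2 * ‖fourierCoeff g k‖ ^ 2 = ‖circleCoef g k‖ ^ 2 := fun k => by
    rw [circleCoef_eq, norm_mul, mul_pow _ ‖fourierCoeff g k‖, Complex.norm_real,
      Real.norm_eq_abs, sq_abs]
  have h5 : (2 * Real.pi) ^ 2 * ((2 * Real.pi)⁻¹ * ∫ t, ‖g t‖ ^ 2) =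
      2 * Real.pi * ∫ t, ‖g t‖ ^ 2 := by
    field_simp
  simp only [h4, h5] at h3
  rw [lintegral_enorm_sq hg, ← ENNReal.ofReal_mul Real.two_pi_pos.le, ← h3.tsum_eq,
    ENNReal.ofReal_tsum_of_nonneg (fun _ => by positivity) h3.summable]
  refine tsum_congr fun k => ?_
  rw [← ofReal_norm, ENNReal.ofReal_pow (norm_nonneg _)]

/-- Parseval's identity for the oscillating part of a function on the torus. -/
lemma parseval_circle_sub_average {g : Torus → ℂ} (hg : MemLp g 2 volume) :
    ENNReal.ofReal (2 * Real.pi) * ∫⁻ x, ‖g x - ((2 * Real.pi)⁻¹ : ℝ) * ∫ x, g x‖ₑ ^ 2 =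
      ∑' k, if k = 0 then 0 else ‖circleCoef g k‖ₑ ^ 2 := by
  have hi : Integrable g := hg.integrable one_le_two
  set c : ℂ := (((2 * Real.pi)⁻¹ : ℝ) : ℂ) * ∫ x, g x with hc
  have hm : MemLp (fun x => g x - c) 2 volume := hg.sub (memLp_const c)
  have hfi : ∀ k : ℤ, Integrable (fun x : Torus => g x * fourier (-k) x) := fun k =>
    hi.mul_bdd (c := 1) (map_continuous (fourier (-k))).aestronglyMeasurable
      (Eventually.of_forall fun x => by rw [fourier_apply, Circle.norm_coe])
  have h1 : ∀ k : ℤ, circleCoef (fun x => g x - c) k = if k = 0 then 0 else circleCoef g k := by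
    intro k
    have h2 : circleCoef (fun x => g x - c) k =
        circleCoef g k - c * ∫ x : Torus, fourier (-k) x := by
      simp only [circleCoef, sub_mul]
      rw [integral_sub (hfi k) (Integrable.const_mul
        ((map_continuous (fourier (-k))).integrable_of_hasCompactSupport
          (HasCompactSupport.of_compactSpace _)) c), integral_const_mul]
    rw [h2]
    split_ifs with hk
    · subst hk
      have h3 : ∫ x : Torus, (fourier (-0) x : ℂ) = (2 * Real.pi : ℝ) := by
        simp [Measure.real, AddCircle.measure_univ, Real.pi_pos.le]
      rw [h3, circleCoef, hc]
      have h4 : ((2 * Real.pi : ℝ) : ℂ) ≠ 0 := by exact_mod_cast Real.two_pi_pos.ne'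
      rw [Complex.ofReal_inv]
      field_simp
      simp
    · have h3 : ∫ x : Torus, (fourier (-k) x : ℂ) = 0 := by
        have h4 := circleCoef_eq (fun _ => 1) k
        have h5 : (fun _ : Torus => (1 : ℂ)) = (_root_.fourier 0 : C(Torus, ℂ)) := by ext; simp
        rw [h5, fourierCoeff_fourier] at h4
        simpa [circleCoef, hk, Pi.single_apply, hk, Ne.symm hk] using h4
      rw [h3, mul_zero, sub_zero]
  rw [parseval_circle hm]
  refine tsum_congr fun k => ?_
  rw [h1]
  split_ifs <;> simp

section Product

variable {Y : Type*} [MeasurableSpace Y] {ν : Measure Y}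

/-- The `k`-th Fourier coefficient in the second variable. -/
def fiberCoef (k : ℤ) (F : Y × Torus → ℂ) (y : Y) : ℂ := circleCoef (fun x => F (y, x)) k

lemma ae_memLp_fiber [SFinite ν] {F : Y × Torus → ℂ} (hF : MemLp F 2 (ν.prod volume)) :
    ∀ᵐ y ∂ν, MemLp (fun x => F (y, x)) 2 volume := by
  obtain ⟨h1, h2⟩ := memLp_two_iff.1 hF
  have hm : AEMeasurable (fun p => ‖F p‖ₑ ^ 2) (ν.prod volume) := h1.enorm.pow_const 2
  rw [lintegral_prod _ hm] at h2
  filter_upwards [h1.prodMk_left, ae_lt_top' hm.lintegral_prod_right' h2.ne] with y h3 h4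
  exact memLp_two_iff.2 ⟨h3, h4⟩

lemma aestronglyMeasurable_fiberCoef {F : Y × Torus → ℂ} (hF : MemLp F 2 (ν.prod volume))
    (k : ℤ) : AEStronglyMeasurable (fiberCoef k F) ν := by
  have h1 : AEStronglyMeasurable (fun p : Y × Torus => F p * fourier (-k) p.2)
      (ν.prod volume) :=
    hF.1.mul (AEStronglyMeasurable.comp_snd (f := fun x : Torus => (fourier (-k) x : ℂ))
      (map_continuous (fourier (-k))).aestronglyMeasurable)
  exact h1.integral_prod_right'

lemma parseval_fiber [SFinite ν] {F : Y × Torus → ℂ} (hF : MemLp F 2 (ν.prod volume)) :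
    ENNReal.ofReal (2 * Real.pi) * ∫⁻ p, ‖F p‖ₑ ^ 2 ∂(ν.prod volume) =
      ∑' k, ∫⁻ y, ‖fiberCoef k F y‖ₑ ^ 2 ∂ν := by
  rw [lintegral_prod _ (hF.1.enorm.pow_const 2),
    ← lintegral_tsum fun k => (aestronglyMeasurable_fiberCoef hF k).enorm.pow_const 2,
    ← lintegral_const_mul' _ _ ENNReal.ofReal_ne_top]
  refine lintegral_congr_ae ?_
  filter_upwards [ae_memLp_fiber hF] with y hy
  exact parseval_circle hy

lemma parseval_fiber_sub_average [SFinite ν] {F : Y × Torus → ℂ} (hF : MemLp F 2 (ν.prod volume)) :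
    ENNReal.ofReal (2 * Real.pi) *
      ∫⁻ p, ‖F p - ((2 * Real.pi)⁻¹ : ℝ) * ∫ x, F (p.1, x)‖ₑ ^ 2 ∂(ν.prod volume) =
      ∑' k, if k = 0 then 0 else ∫⁻ y, ‖fiberCoef k F y‖ₑ ^ 2 ∂ν := by
  have hm : AEStronglyMeasurable (fun p : Y × Torus =>
      F p - (((2 * Real.pi)⁻¹ : ℝ) : ℂ) * ∫ x, F (p.1, x)) (ν.prod volume) :=
    hF.1.sub ((hF.1.integral_prod_right'.comp_fst).const_mul _)
  have h1 : ∀ k : ℤ, (if k = 0 then 0 else ∫⁻ y, ‖fiberCoef k F y‖ₑ ^ 2 ∂ν) =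
      ∫⁻ y, (if k = 0 then 0 else ‖fiberCoef k F y‖ₑ ^ 2) ∂ν := fun k => by
    split_ifs <;> simp
  simp only [h1]
  rw [lintegral_prod _ (hm.enorm.pow_const 2), ← lintegral_tsum fun k => ?_,
    ← lintegral_const_mul' _ _ ENNReal.ofReal_ne_top]
  · refine lintegral_congr_ae ?_
    filter_upwards [ae_memLp_fiber hF] with y hy
    exact parseval_circle_sub_average hy
  · split_ifs
    · exact aemeasurable_const
    · exact (aestronglyMeasurable_fiberCoef hF k).enorm.pow_const 2

lemma memLp_fiberCoef [SFinite ν] {F : Y × Torus → ℂ} (hF : MemLp F 2 (ν.prod volume)) (k : ℤ) :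
    MemLp (fiberCoef k F) 2 ν := by
  refine memLp_two_iff.2 ⟨aestronglyMeasurable_fiberCoef hF k, ?_⟩
  refine (ENNReal.le_tsum (f := fun k => ∫⁻ y, ‖fiberCoef k F y‖ₑ ^ 2 ∂ν) k).trans_lt ?_
  rw [← parseval_fiber hF]
  exact ENNReal.mul_lt_top ENNReal.ofReal_lt_top (memLp_two_iff.1 hF).2

end Product

/-- The Fourier coefficient of frequency `k` in `x` and `l` in `z`, as a function of `y`. -/
def coef (k l : ℤ) (f : Dom → ℂ) : ℝ → ℂ :=
  fiberCoef l (fiberCoef k fun p : (ℝ × Torus) × Torus => f p.swap)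

lemma memLp_swap {f : Dom → ℂ} (hf : MemLp f 2 volume) :
    MemLp (fun p : (ℝ × Torus) × Torus => f p.swap) 2 (volume.prod volume) :=
  hf.comp_measurePreserving Measure.measurePreserving_swap

lemma memLp_coef {f : Dom → ℂ} (hf : MemLp f 2 volume) (k l : ℤ) :
    MemLp (coef k l f) 2 volume :=
  memLp_fiberCoef (memLp_fiberCoef (memLp_swap hf) k) l

lemma parseval_fiberCoef {f : Dom → ℂ} (hf : MemLp f 2 volume) (k : ℤ) :
    ENNReal.ofReal (2 * Real.pi) *
      ∫⁻ q, ‖fiberCoef k (fun p : (ℝ × Torus) × Torus => f p.swap) q‖ₑ ^ 2 =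
      ∑' l, ∫⁻ y, ‖coef k l f y‖ₑ ^ 2 :=
  parseval_fiber (memLp_fiberCoef (memLp_swap hf) k)

/-- Parseval's identity for the nonzero frequencies in `x`. -/
theorem l2norm_nonzeroMode_sq {f : Dom → ℝ} (hf : MemLp f 2 volume) :
    ENNReal.ofReal (2 * Real.pi) ^ 2 * l2norm (nonzeroMode f) ^ 2 =
      ∑' k : ℤ, ∑' l : ℤ, if k = 0 then 0 else
        ∫⁻ y, ‖coef k l (fun p => (f p : ℂ)) y‖ₑ ^ 2 := by
  have hfc : MemLp (fun p => (f p : ℂ)) 2 volume := hf.ofReal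
  have h1 := parseval_fiber_sub_average (memLp_swap hfc)
  have h2 : l2norm (nonzeroMode f) ^ 2 = ∫⁻ p : (ℝ × Torus) × Torus,
      ‖(f p.swap : ℂ) - ((2 * Real.pi)⁻¹ : ℝ) * ∫ x, (f (Prod.swap (p.1, x)) : ℂ)‖ₑ ^ 2
        ∂(volume.prod volume) := by
    rw [l2norm, eLpNorm_two_sq]
    refine (lintegral_prod_swap (fun p : Torus × ℝ × Torus => ‖nonzeroMode f p‖ₑ ^ 2)).symm.trans ?_
    refine lintegral_congr fun p => ?_
    congr 1
    have h3 : (f p.swap : ℂ) - ((2 * Real.pi)⁻¹ : ℝ) * ∫ x, (f (Prod.swap (p.1, x)) : ℂ) =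
        ((nonzeroMode f p.swap : ℝ) : ℂ) := by
      rw [integral_complex_ofReal, nonzeroMode, xAverage]
      push_cast
      rfl
    rw [h3, ← ofReal_norm, ← ofReal_norm, Complex.norm_real]
  rw [h2, pow_two, mul_assoc, h1, ← ENNReal.tsum_mul_left]
  refine tsum_congr fun k => ?_
  split_ifs
  · simp
  · exact parseval_fiberCoef hfc k

lemma lintegral_coef_le {f : Dom → ℂ} (hf : MemLp f 2 volume) (k l : ℤ) :
    ∫⁻ y, ‖coef k l f y‖ₑ ^ 2 ≤ ENNReal.ofReal (2 * Real.pi) ^ 2 * ∫⁻ p, ‖f p‖ₑ ^ 2 := by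
  have h1 := parseval_fiber (memLp_swap hf)
  have h2 := parseval_fiber (memLp_fiberCoef (memLp_swap hf) k)
  have h3 : ∫⁻ p : (ℝ × Torus) × Torus, ‖f p.swap‖ₑ ^ 2 ∂(volume.prod volume) =
      ∫⁻ p, ‖f p‖ₑ ^ 2 :=
    lintegral_prod_swap (fun p : Torus × ℝ × Torus => ‖f p‖ₑ ^ 2)
  rw [h3] at h1
  calc _ ≤ ∑' l, ∫⁻ y, ‖coef k l f y‖ₑ ^ 2 :=
        ENNReal.le_tsum (f := fun l => ∫⁻ y, ‖coef k l f y‖ₑ ^ 2) l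
    _ = _ := h2.symm
    _ ≤ _ := by
        rw [pow_two, mul_assoc, h1]
        gcongr
        exact ENNReal.le_tsum (f := fun k => ∫⁻ q, ‖fiberCoef k
          (fun p : (ℝ × Torus) × Torus => f p.swap) q‖ₑ ^ 2) k

/-! ### Fourier coefficients in the periodic variables -/

/-- The test function `e^{-i(kx + lz)} θ(y)`. -/
def osc (k l : ℤ) (θ : ℝ → ℂ) (p : Dom) : ℂ :=
  fourier (-k) p.1 * θ p.2.1 * fourier (-l) p.2.2

/-- The partial derivatives in terms of the amplitude of `e^{-i(kx + lz)} θ(y)`. -/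
def lineD (k l : ℤ) (i : Fin 3) (θ : ℝ → ℂ) (y : ℝ) : ℂ :=
  if i = 0 then -(k * Complex.I) * θ y else if i = 1 then deriv θ y else -(l * Complex.I) * θ y

lemma IsTestLine.const_mul {θ : ℝ → ℂ} (h : IsTestLine θ) (c : ℂ) :
    IsTestLine (fun y => c * θ y) :=
  h.mul_left contDiff_const

lemma IsTestLine.lineD {θ : ℝ → ℂ} (h : IsTestLine θ) (k l : ℤ) (i : Fin 3) :
    IsTestLine (lineD k l i θ) := by
  unfold Couette.lineD
  fin_cases i
  · exact h.const_mul _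
  · exact h.deriv
  · exact h.const_mul _

lemma IsTestLine.differentiable {θ : ℝ → ℂ} (h : IsTestLine θ) : Differentiable ℝ θ :=
  h.smooth.differentiable (by simp)

lemma hasCompactSupport_osc {θ : ℝ → ℂ} (h : IsTestLine θ) (k l : ℤ) :
    HasCompactSupport (osc k l θ) := by
  refine HasCompactSupport.intro
    ((isCompact_univ (X := Torus)).prod (h.compact.isCompact.prod (isCompact_univ (X := Torus))))
    fun p hp => ?_
  have : p.2.1 ∉ tsupport θ := fun h' => hp ⟨mem_univ _, h', mem_univ _⟩
  simp [osc, image_eq_zero_of_notMem_tsupport this]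

lemma continuous_osc {θ : ℝ → ℂ} (h : IsTestLine θ) (k l : ℤ) : Continuous (osc k l θ) := by
  have h1 := h.smooth.continuous
  have h2 := map_continuous (fourier (-k) : C(Torus, ℂ))
  have h3 := map_continuous (fourier (-l) : C(Torus, ℂ))
  unfold osc
  fun_prop

lemma memLp_osc {θ : ℝ → ℂ} (h : IsTestLine θ) (k l : ℤ) : MemLp (osc k l θ) 2 volume :=
  (continuous_osc h k l).memLp_of_hasCompactSupport (hasCompactSupport_osc h k l)

lemma contDiff_osc {θ : ℝ → ℂ} (h : IsTestLine θ) (k l : ℤ) :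
    ContDiff ℝ ∞ fun q : ℝ × ℝ × ℝ => osc k l θ ((q.1 : Torus), q.2.1, (q.2.2 : Torus)) := by
  have h1 := h.smooth
  have h2 : ContDiff ℝ ∞ fun x : ℝ => (x : ℂ) := Complex.ofRealCLM.contDiff
  simp only [osc, fourier_coe_apply]
  fun_prop

lemma isTest_osc {θ : ℝ → ℂ} (h : IsTestLine θ) (k l : ℤ) (ℓ : ℂ →L[ℝ] ℝ) :
    IsTest fun p => ℓ (osc k l θ p) :=
  ⟨ℓ.contDiff.comp (contDiff_osc h k l), (hasCompactSupport_osc h k l).comp_left (map_zero ℓ)⟩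

lemma hasDerivAt_fourier_add (n : ℤ) (x : Torus) :
    HasDerivAt (fun s : ℝ => (fourier n (x + (s : Torus)) : ℂ)) (n * Complex.I * fourier n x)
      0 := by
  induction x using QuotientAddGroup.induction_on with | _ r
  have h1 : HasDerivAt (fun s : ℝ => (fourier n ((r + s : ℝ) : Torus) : ℂ))
      (2 * Real.pi * Complex.I * n / (2 * Real.pi : ℝ) * fourier n ((r + 0 : ℝ) : Torus)) 0 :=
    (hasDerivAt_fourier (2 * Real.pi) n (r + 0)).comp_const_add r 0
  refine h1.congr_deriv ?_
  have h2 : (Real.pi : ℂ) ≠ 0 := by exact_mod_cast Real.pi_ne_zero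
  rw [add_zero]
  push_cast
  field_simp

lemma hasDerivAt_osc {θ : ℝ → ℂ} (h : IsTestLine θ) (k l : ℤ) (i : Fin 3) (p : Dom) :
    HasDerivAt (fun s : ℝ => osc k l θ (p + axis i s)) (osc k l (lineD k l i θ) p) 0 := by
  have hθ : HasDerivAt (fun s : ℝ => θ (p.2.1 + s)) (deriv θ p.2.1) 0 := by
    have := (h.differentiable (p.2.1 + 0)).hasDerivAt.comp_const_add p.2.1 0
    rwa [add_zero] at this
  fin_cases i
  · refine ((((hasDerivAt_fourier_add (-k) p.1).mul_const (θ p.2.1)).mul_const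
      (fourier (-l) p.2.2 : ℂ)).congr_deriv ?_).congr_of_eventuallyEq
      (Eventually.of_forall fun s => ?_)
    · simp only [osc, lineD]
      push_cast
      simp
      ring
    · simp [osc, axis]
  · refine (((hθ.const_mul (fourier (-k) p.1 : ℂ)).mul_const
      (fourier (-l) p.2.2 : ℂ)).congr_deriv ?_).congr_of_eventuallyEq
      (Eventually.of_forall fun s => ?_)
    · simp [osc, lineD]
    · simp [osc, axis]
  · refine (((hasDerivAt_fourier_add (-l) p.2.2).const_mul
      (fourier (-k) p.1 * θ p.2.1 : ℂ)).congr_deriv ?_).congr_of_eventuallyEq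
      (Eventually.of_forall fun s => ?_)
    · simp only [osc, lineD]
      push_cast
      simp
      ring
    · simp [osc, axis]

lemma pd_osc {θ : ℝ → ℂ} (h : IsTestLine θ) (k l : ℤ) (ℓ : ℂ →L[ℝ] ℝ) (i : Fin 3) :
    pd i (fun p => ℓ (osc k l θ p)) = fun p => ℓ (osc k l (lineD k l i θ) p) :=
  funext fun p => (ℓ.hasFDerivAt.comp_hasDerivAt (0 : ℝ) (hasDerivAt_osc h k l i p)).deriv

/-- The Laplacian in terms of the amplitude of `e^{-i(kx + lz)} θ(y)`. -/
def lineLap (k l : ℤ) (θ : ℝ → ℂ) (y : ℝ) : ℂ := ∑ i : Fin 3, lineD k l i (lineD k l i θ) y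

lemma osc_lineLap (k l : ℤ) (θ : ℝ → ℂ) (p : Dom) :
    osc k l (lineLap k l θ) p = ∑ i : Fin 3, osc k l (lineD k l i (lineD k l i θ)) p := by
  simp only [osc, lineLap, Finset.mul_sum, Finset.sum_mul]

lemma lap_osc {θ : ℝ → ℂ} (h : IsTestLine θ) (k l : ℤ) (ℓ : ℂ →L[ℝ] ℝ) :
    lap (fun p => ℓ (osc k l θ p)) = fun p => ℓ (osc k l (lineLap k l θ) p) := by
  funext p
  rw [osc_lineLap, map_sum]
  refine Finset.sum_congr rfl fun i _ => ?_
  rw [pd_osc h, pd_osc (h.lineD k l i)]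

lemma IsTestLine.lineLap {θ : ℝ → ℂ} (h : IsTestLine θ) (k l : ℤ) :
    IsTestLine (lineLap k l θ) := by
  unfold Couette.lineLap
  simp only [Fin.sum_univ_three]
  exact (((h.lineD k l 0).lineD k l 0).add ((h.lineD k l 1).lineD k l 1)).add
    ((h.lineD k l 2).lineD k l 2)

/-- The pairing of `f` with the complex test function `e^{-i(kx + lz)} θ(y)`. -/
def oscPairing (k l : ℤ) (f : Dom → ℝ) (θ : ℝ → ℂ) : ℂ := ∫ p, (f p : ℂ) * osc k l θ p

lemma integrable_mul_osc {f : Dom → ℝ} (hf : MemLp f 2 volume) {θ : ℝ → ℂ} (h : IsTestLine θ)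
    (k l : ℤ) : Integrable fun p => (f p : ℂ) * osc k l θ p :=
  MemLp.integrable_mul (hf.ofReal (K := ℂ)) (memLp_osc h k l)

lemma integral_mul_osc {f : Dom → ℝ} (hf : MemLp f 2 volume) {θ : ℝ → ℂ} (h : IsTestLine θ)
    (k l : ℤ) (ℓ : ℂ →L[ℝ] ℝ) : ∫ p, f p * ℓ (osc k l θ p) = ℓ (oscPairing k l f θ) := by
  refine Eq.trans ?_ (ℓ.integral_comp_comm (integrable_mul_osc hf h k l))
  refine integral_congr_ae (Eventually.of_forall fun p => ?_)
  simp only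
  rw [← Complex.real_smul, map_smul, smul_eq_mul]

open Classical in
/-- The Fourier coefficient of frequency `(k, l)` in `(x, z)`, as an element of `L²(ℝ)`; the value
`0` for functions outside `L²` is never used. -/
def lineCoef (k l : ℤ) (f : Dom → ℝ) : LineL2 :=
  if h : MemLp (coef k l fun p => (f p : ℂ)) 2 volume then h.toLp else 0

lemma coeFn_lineCoef {f : Dom → ℝ} (hf : MemLp f 2 volume) (k l : ℤ) :
    lineCoef k l f =ᵐ[volume] coef k l fun p => (f p : ℂ) := by
  have h := memLp_coef (f := fun p => (f p : ℂ)) (hf.ofReal (K := ℂ)) k l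
  rw [lineCoef, dif_pos h]
  exact h.coeFn_toLp

lemma integral_mul_lineCoef {f : Dom → ℝ} (hf : MemLp f 2 volume) {θ : ℝ → ℂ}
    (h : IsTestLine θ) (k l : ℤ) : ∫ y, θ y * lineCoef k l f y = oscPairing k l f θ := by
  have hi := integrable_mul_osc hf h k l
  have e1 : ∫ y, θ y * lineCoef k l f y = ∫ y, θ y * coef k l (fun p => (f p : ℂ)) y := by
    refine integral_congr_ae ?_
    filter_upwards [coeFn_lineCoef hf k l] with y hy
    rw [hy]
  rw [e1, oscPairing]
  have e2 : ∫ p : Dom, (f p : ℂ) * osc k l θ p =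
      ∫ q : ℝ × Torus, ∫ x : Torus, (f (x, q) : ℂ) * osc k l θ (x, q) :=
    integral_prod_symm _ hi
  have e3 : ∫ q : ℝ × Torus, ∫ x : Torus, (f (x, q) : ℂ) * osc k l θ (x, q) =
      ∫ y : ℝ, ∫ z : Torus, ∫ x : Torus, (f (x, y, z) : ℂ) * osc k l θ (x, y, z) :=
    integral_prod _ hi.integral_prod_right
  rw [e2, e3]
  refine integral_congr_ae (Eventually.of_forall fun y => ?_)
  simp only [coef, fiberCoef, circleCoef, osc, Prod.swap_prod_mk]
  rw [← integral_const_mul]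
  refine integral_congr_ae (Eventually.of_forall fun z => ?_)
  simp only
  rw [← mul_assoc, ← integral_const_mul, ← integral_mul_const]
  refine integral_congr_ae (Eventually.of_forall fun x => ?_)
  simp only
  ring

lemma lineL2_ext {F G : LineL2}
    (h : ∀ θ, IsTestLine θ → ∫ y, θ y * F y = ∫ y, θ y * G y) : F = G := by
  apply Lp.ext
  refine ae_eq_of_integral_contDiff_smul_eq ((Lp.memLp F).locallyIntegrable one_le_two)
    ((Lp.memLp G).locallyIntegrable one_le_two) fun g hg hgs => ?_
  have h1 : HasCompactSupport (Complex.ofReal ∘ g) := hgs.comp_left Complex.ofReal_zero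
  have h2 : ContDiff ℝ ∞ (Complex.ofRealCLM ∘ g) := Complex.ofRealCLM.contDiff.comp hg
  exact h _ ⟨h2, h1⟩

lemma lineCoef_congr {f g : Dom → ℝ} (hf : MemLp f 2 volume) (hfg : f =ᵐ[volume] g) (k l : ℤ) :
    lineCoef k l f = lineCoef k l g := by
  refine lineL2_ext fun θ hθ => ?_
  rw [integral_mul_lineCoef hf hθ, integral_mul_lineCoef (hf.ae_eq hfg) hθ]
  refine integral_congr_ae ?_
  filter_upwards [hfg] with p hp
  rw [hp]

lemma lineCoef_sub {f g : Dom → ℝ} (hf : MemLp f 2 volume) (hg : MemLp g 2 volume) (k l : ℤ) :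
    lineCoef k l (fun p => f p - g p) = lineCoef k l f - lineCoef k l g := by
  refine lineL2_ext fun θ hθ => ?_
  have e : ∫ y, θ y * (lineCoef k l f - lineCoef k l g : LineL2) y =
      (∫ y, θ y * lineCoef k l f y) - ∫ y, θ y * lineCoef k l g y := by
    rw [← pairing_apply hθ.memLp, map_sub, pairing_apply, pairing_apply]
  rw [e, integral_mul_lineCoef hf hθ, integral_mul_lineCoef hg hθ,
    integral_mul_lineCoef (f := fun p => f p - g p) (hf.sub hg) hθ, oscPairing, oscPairing,
    oscPairing, ← integral_sub (integrable_mul_osc hf hθ k l) (integrable_mul_osc hg hθ k l)]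
  refine integral_congr_ae (Eventually.of_forall fun p => ?_)
  simp only
  push_cast
  ring

lemma enorm_lineCoef_sq {f : Dom → ℝ} (hf : MemLp f 2 volume) (k l : ℤ) :
    ‖lineCoef k l f‖ₑ ^ 2 = ∫⁻ y, ‖coef k l (fun p => (f p : ℂ)) y‖ₑ ^ 2 := by
  rw [Lp.enorm_def, eLpNorm_two_sq]
  refine lintegral_congr_ae ?_
  filter_upwards [coeFn_lineCoef hf k l] with y hy
  rw [hy]

lemma norm_lineCoef_le (u : L2) (k l : ℤ) : ‖lineCoef k l u‖ ≤ 2 * Real.pi * ‖u‖ := by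
  have h1 := lintegral_coef_le (f := fun p => (u p : ℂ)) ((Lp.memLp u).ofReal (K := ℂ)) k l
  rw [← enorm_lineCoef_sq (Lp.memLp u)] at h1
  have h2 : ∫⁻ p, ‖(u p : ℂ)‖ₑ ^ 2 = ‖u‖ₑ ^ 2 := by
    rw [Lp.enorm_def, eLpNorm_two_sq]
    refine lintegral_congr fun p => ?_
    rw [← ofReal_norm, ← ofReal_norm, Complex.norm_real]
  rw [h2, ← mul_pow] at h1
  have h3 := (ENNReal.pow_le_pow_left_iff two_ne_zero).1 h1
  rw [← ofReal_norm, ← ofReal_norm, ← ENNReal.ofReal_mul Real.two_pi_pos.le] at h3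
  exact (ENNReal.ofReal_le_ofReal_iff (by positivity)).1 h3

lemma continuous_lineCoef (k l : ℤ) : Continuous fun u : L2 => lineCoef k l u := by
  refine (LipschitzWith.of_dist_le_mul (K := (2 * Real.pi).toNNReal) fun u v => ?_).continuous
  rw [dist_eq_norm, dist_eq_norm, ← lineCoef_sub (Lp.memLp u) (Lp.memLp v),
    Real.coe_toNNReal _ Real.two_pi_pos.le]
  have h := lineCoef_congr (Lp.memLp (u - v)) (Lp.coeFn_sub u v) k l
  rw [show (fun p => u p - v p) = (u : Dom → ℝ) - v from rfl, ← h]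
  exact norm_lineCoef_le (u - v) k l

/-! ### Modulations -/

/-- The character `e^{iay}`. -/
def character (a y : ℝ) : ℂ := Complex.exp (Complex.I * a * y)

lemma norm_character (a y : ℝ) : ‖character a y‖ = 1 := by
  have : Complex.I * a * y = ((a * y : ℝ) : ℂ) * Complex.I := by push_cast; ring
  rw [character, this, Complex.norm_exp_ofReal_mul_I]

lemma contDiff_character (a : ℝ) : ContDiff ℝ ∞ (character a) := by
  have h2 : ContDiff ℝ ∞ fun x : ℝ => (x : ℂ) := Complex.ofRealCLM.contDiff
  unfold character
  fun_prop

lemma hasDerivAt_character (a y : ℝ) :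
    HasDerivAt (character a) (Complex.I * a * character a y) y := by
  have h1 : HasDerivAt (fun x : ℝ => Complex.I * a * (x : ℂ)) (Complex.I * a) y := by
    simpa using (Complex.ofRealCLM.hasDerivAt (x := y)).const_mul (Complex.I * (a : ℂ))
  refine h1.cexp.congr_deriv ?_
  rw [character]
  ring

lemma memLp_character_mul (a : ℝ) {c : ℝ → ℂ} (hc : MemLp c 2 volume) :
    MemLp (fun y => character a y * c y) 2 volume := by
  refine hc.of_le ((contDiff_character a).continuous.aestronglyMeasurable.mul hc.1)
    (Eventually.of_forall fun y => ?_)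
  rw [norm_mul, norm_character, one_mul]

/-- Multiplication by the character `e^{iay}` on `L²(ℝ)`. -/
def modulate (a : ℝ) : LineL2 →ₗᵢ[ℂ] LineL2 where
  toFun c := (memLp_character_mul a (Lp.memLp c)).toLp
  map_add' c d := by
    apply Lp.ext
    filter_upwards [(memLp_character_mul a (Lp.memLp (c + d))).coeFn_toLp,
      (memLp_character_mul a (Lp.memLp c)).coeFn_toLp,
      (memLp_character_mul a (Lp.memLp d)).coeFn_toLp, Lp.coeFn_add c d,
      Lp.coeFn_add (memLp_character_mul a (Lp.memLp c)).toLp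
        (memLp_character_mul a (Lp.memLp d)).toLp] with y h1 h2 h3 h4 h5
    rw [h1, h5, Pi.add_apply, h2, h3, h4, Pi.add_apply, mul_add]
  map_smul' r c := by
    apply Lp.ext
    filter_upwards [(memLp_character_mul a (Lp.memLp (r • c))).coeFn_toLp,
      (memLp_character_mul a (Lp.memLp c)).coeFn_toLp, Lp.coeFn_smul r c,
      Lp.coeFn_smul r (memLp_character_mul a (Lp.memLp c)).toLp] with y h1 h2 h3 h4
    simp only [RingHom.id_apply]
    rw [h1, h4, Pi.smul_apply, h2, h3, Pi.smul_apply, smul_eq_mul, smul_eq_mul]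
    ring
  norm_map' c := by
    change ‖(memLp_character_mul a (Lp.memLp c)).toLp‖ = ‖c‖
    rw [Lp.norm_toLp, Lp.norm_def]
    congr 1
    refine eLpNorm_congr_norm_ae (Eventually.of_forall fun y => ?_)
    rw [norm_mul, norm_character, one_mul]

lemma coeFn_modulate (a : ℝ) (c : LineL2) :
    modulate a c =ᵐ[volume] fun y => character a y * c y :=
  (memLp_character_mul a (Lp.memLp c)).coeFn_toLp

lemma integral_mul_modulate (a : ℝ) (c : LineL2) (ψ : ℝ → ℂ) :
    ∫ y, ψ y * modulate a c y = ∫ y, (character a y * ψ y) * c y := by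
  refine integral_congr_ae ?_
  filter_upwards [coeFn_modulate a c] with y hy
  rw [hy]
  ring

lemma modulate_zero (c : LineL2) : modulate 0 c = c := by
  apply Lp.ext
  filter_upwards [coeFn_modulate 0 c] with y hy
  rw [hy]
  simp [character]

lemma continuous_modulate (c : LineL2) : Continuous fun a => modulate a c := by
  refine continuous_iff_continuousAt.2 fun a => ?_
  rw [ContinuousAt, Lp.tendsto_Lp_iff_tendsto_eLpNorm']
  have h1 : Tendsto (fun b => ∫⁻ y, ‖(character b y - character a y) * c y‖ₑ ^ 2) (𝓝 a)
      (𝓝 (∫⁻ _ : ℝ, 0)) := by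
    refine tendsto_lintegral_filter_of_dominated_convergence (fun y => (2 * ‖c y‖ₑ) ^ 2)
      (Eventually.of_forall fun b => ?_) (Eventually.of_forall fun b => ?_) ?_ ?_
    · exact (((contDiff_character b).continuous.sub
        (contDiff_character a).continuous).measurable.mul
          (Lp.stronglyMeasurable c).measurable).enorm.pow_const 2
    · refine Eventually.of_forall fun y => ?_
      rw [enorm_mul]
      gcongr
      refine (enorm_sub_le).trans ?_
      rw [← ofReal_norm, ← ofReal_norm, norm_character, norm_character]
      norm_num
    · simp only [mul_pow]
      rw [lintegral_const_mul' _ _ (by norm_num)]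
      exact (ENNReal.mul_lt_top (by norm_num) (memLp_two_iff.1 (Lp.memLp c)).2).ne
    · refine Eventually.of_forall fun y => ?_
      have h2 : Continuous fun b : ℝ => ‖(character b y - character a y) * c y‖ₑ ^ 2 := by
        unfold character
        fun_prop
      simpa using h2.tendsto a
  rw [lintegral_zero] at h1
  have h2 : ∀ b, eLpNorm (modulate b c - modulate a c : ℝ → ℂ) 2 volume =
      (∫⁻ y, ‖(character b y - character a y) * c y‖ₑ ^ 2) ^ (1 / 2 : ℝ) := fun b => by
    have h3 : ∫⁻ y, ‖(character b y - character a y) * c y‖ₑ ^ 2 =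
        eLpNorm (modulate b c - modulate a c : ℝ → ℂ) 2 volume ^ 2 := by
      rw [eLpNorm_two_sq]
      refine lintegral_congr_ae ?_
      filter_upwards [coeFn_modulate a c, coeFn_modulate b c] with y h4 h5
      rw [Pi.sub_apply, h4, h5, sub_mul]
    rw [h3, ← ENNReal.rpow_natCast, ← ENNReal.rpow_mul]
    norm_num
  simp only [h2]
  have h3 := h1.ennrpow_const (1 / 2 : ℝ)
  simpa using h3

lemma continuous_modulate_comp {a : ℝ → ℝ} (ha : Continuous a) {c : ℝ → LineL2}
    (hc : Continuous c) : Continuous fun t => modulate (a t) (c t) := by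
  refine continuous_iff_continuousAt.2 fun t => ?_
  rw [ContinuousAt, tendsto_iff_norm_sub_tendsto_zero]
  have h1 : Tendsto (fun s => ‖c s - c t‖ + ‖modulate (a s) (c t) - modulate (a t) (c t)‖) (𝓝 t)
      (𝓝 0) := by
    have h2 := tendsto_iff_norm_sub_tendsto_zero.1 (hc.tendsto t)
    have h3 := tendsto_iff_norm_sub_tendsto_zero.1
      (((continuous_modulate (c t)).comp ha).tendsto t)
    simpa using h2.add h3
  refine squeeze_zero (fun _ => norm_nonneg _) (fun s => ?_) h1
  have h4 : modulate (a s) (c s) - modulate (a t) (c t) =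
      modulate (a s) (c s - c t) + (modulate (a s) (c t) - modulate (a t) (c t)) := by
    rw [map_sub]
    abel
  rw [h4]
  exact (norm_add_le _ _).trans (add_le_add ((modulate (a s)).norm_map _).le le_rfl)

lemma norm_character_taylor_le (h y : ℝ) :
    ‖character h y - 1 - h * (Complex.I * y)‖ ≤ 3 * (h ^ 2 * y ^ 2) := by
  have e : Complex.I * h * y = h * (Complex.I * y) := by ring
  have hn : ‖(h : ℂ) * (Complex.I * y)‖ = |h * y| := by
    simp [abs_mul]
  rcases le_total |h * y| 1 with h1 | h1
  · have h2 := Complex.norm_exp_sub_one_sub_id_le (x := (h : ℂ) * (Complex.I * y))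
      (by rw [hn]; exact h1)
    rw [hn, sq_abs, mul_pow] at h2
    rw [character, e]
    linarith [mul_nonneg (sq_nonneg h) (sq_nonneg y)]
  · refine (norm_sub_le _ _).trans ((add_le_add_left (norm_sub_le _ _) _).trans ?_)
    rw [norm_character, norm_one, hn, ← mul_pow, ← sq_abs (h * y)]
    nlinarith

/-- Modulations of a test function depend differentiably on the frequency. -/
lemma hasDerivAt_modulate {ψ : ℝ → ℂ} (h : IsTestLine ψ)
    (h1 : MemLp (fun y : ℝ => Complex.I * y * ψ y) 2 volume) (a : ℝ) :
    HasDerivAt (fun b => modulate b h.memLp.toLp) (modulate a h1.toLp) a := by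
  have hid : ContDiff ℝ ∞ fun y : ℝ => (y : ℂ) ^ 2 :=
    Complex.ofRealCLM.contDiff.pow 2
  have h2 := (h.mul_left hid).memLp
  rw [hasDerivAt_iff_isLittleO_nhds_zero]
  have hO : (fun s : ℝ => modulate (a + s) h.memLp.toLp - modulate a h.memLp.toLp
      - s • modulate a h1.toLp) =O[𝓝 0] fun s : ℝ => s ^ 2 := by
    refine Asymptotics.IsBigO.of_bound (3 * ‖h2.toLp‖) (Eventually.of_forall fun s => ?_)
    have h3 : ‖modulate (a + s) h.memLp.toLp - modulate a h.memLp.toLp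
        - s • modulate a h1.toLp‖ ≤ (3 * s ^ 2) * ‖h2.toLp‖ := by
      refine Lp.norm_le_mul_norm_of_ae_le_mul ?_
      filter_upwards [coeFn_modulate (a + s) h.memLp.toLp, coeFn_modulate a h.memLp.toLp,
        coeFn_modulate a h1.toLp, h.memLp.coeFn_toLp, h1.coeFn_toLp, h2.coeFn_toLp,
        Lp.coeFn_sub (modulate (a + s) h.memLp.toLp - modulate a h.memLp.toLp)
          (s • modulate a h1.toLp),
        Lp.coeFn_sub (modulate (a + s) h.memLp.toLp) (modulate a h.memLp.toLp),
        Lp.coeFn_smul s (modulate a h1.toLp)] with y e1 e2 e3 e4 e5 e6 e7 e8 e9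
      rw [e7, Pi.sub_apply, e8, Pi.sub_apply, e9, Pi.smul_apply, e1, e2, e3, e4, e5, e6]
      have e10 : character (a + s) y * ψ y - character a y * ψ y
          - s • (character a y * (Complex.I * y * ψ y)) =
          character a y * ((character s y - 1 - s * (Complex.I * y)) * ψ y) := by
        have : character (a + s) y = character a y * character s y := by
          rw [character, character, character, ← Complex.exp_add]
          push_cast
          ring_nf
        rw [this, Complex.real_smul]
        ring
      rw [e10, norm_mul, norm_character, one_mul, norm_mul, norm_mul, norm_pow, Complex.norm_real,
        Real.norm_eq_abs, sq_abs]
      calc _ ≤ 3 * (s ^ 2 * y ^ 2) * ‖ψ y‖ := by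
            gcongr
            exact norm_character_taylor_le s y
        _ = _ := by ring
    refine h3.trans_eq ?_
    rw [Real.norm_of_nonneg (sq_nonneg s)]
    ring
  refine hO.trans_isLittleO ?_
  simpa using Asymptotics.isLittleO_pow_pow (𝕜 := ℝ) (one_lt_two : 1 < 2)

/-- Product rule for a pairing when `c` is only continuous and weakly differentiable, in the sense
that its pairing with the fixed `g t` is differentiable. -/
lemma hasDerivWithinAt_bilin {E F : Type*} [NormedAddCommGroup E] [NormedSpace ℝ E]
    [NormedAddCommGroup F] [NormedSpace ℝ F] (B : E →L[ℝ] F →L[ℝ] ℂ) {g : ℝ → E} {c : ℝ → F}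
    {g' : E} {L : ℂ} {S : Set ℝ} {t : ℝ} (hg : HasDerivWithinAt g g' S t)
    (hc : ContinuousWithinAt c S t) (hL : HasDerivWithinAt (fun s => B (g t) (c s)) L S t) :
    HasDerivWithinAt (fun s => B (g s) (c s)) (L + B g' (c t)) S t := by
  rw [hasDerivWithinAt_iff_tendsto_slope] at hg hL ⊢
  have hc' : Tendsto c (𝓝[S \ {t}] t) (𝓝 (c t)) :=
    hc.mono_left (nhdsWithin_mono _ sdiff_subset)
  have h1 : Tendsto (fun s => B (slope g t s) (c s)) (𝓝[S \ {t}] t) (𝓝 (B g' (c t))) :=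
    (B.continuous₂.tendsto (g', c t)).comp (hg.prodMk_nhds hc')
  refine (hL.add h1).congr fun s => ?_
  simp only [slope, vsub_eq_sub, map_smul, map_sub, smul_apply, sub_apply]
  rw [← smul_add]
  congr 1
  abel

/-! ### The system at a pair of frequencies -/

lemma hasDerivWithinAt_of_re_im {F : ℝ → ℂ} {L : ℂ} {S : Set ℝ} {t : ℝ}
    (h : ∀ ℓ : ℂ →L[ℝ] ℝ, HasDerivWithinAt (fun s => ℓ (F s)) (ℓ L) S t) :
    HasDerivWithinAt F L S t := by
  have h1 := ((h Complex.reCLM).ofReal_comp).add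
    (((h Complex.imCLM).ofReal_comp).mul_const Complex.I)
  refine (h1.congr_deriv (Complex.re_add_im L)).congr (fun s _ => ?_) ?_
  · exact (Complex.re_add_im (F s)).symm
  · exact (Complex.re_add_im (F t)).symm

lemma IsTestLine.id_mul {θ : ℝ → ℂ} (h : IsTestLine θ) : IsTestLine fun y => (y : ℂ) * θ y :=
  h.mul_left Complex.ofRealCLM.contDiff

lemma mul_map_osc (k l : ℤ) (θ : ℝ → ℂ) (ℓ : ℂ →L[ℝ] ℝ) (p : Dom) :
    p.2.1 * ℓ (osc k l θ p) = ℓ (osc k l (fun y => (y : ℂ) * θ y) p) := by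
  rw [← smul_eq_mul, ← map_smul, Complex.real_smul, osc, osc]
  congr 1
  ring

section Solution

variable {ε μ lam : ℝ} {bin : Dom → ℝ} {uin : Fin 3 → Dom → ℝ} {b : ℝ → L2} {u : ℝ → Fin 3 → L2}

lemma integral_mul_osc_coe (f : L2) {θ : ℝ → ℂ} (h : IsTestLine θ) (k l : ℤ) (ℓ : ℂ →L[ℝ] ℝ) :
    ∫ p, f p * ℓ (osc k l θ p) = ℓ (∫ y, θ y * lineCoef k l f y) := by
  rw [integral_mul_osc (Lp.memLp f) h, integral_mul_lineCoef (Lp.memLp f) h]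

/-- The mass equation for a pair of frequencies in `(x, z)`. -/
lemma mass_line (hs : IsSolution ε μ lam bin uin b u) (k l : ℤ) {θ : ℝ → ℂ} (h : IsTestLine θ)
    {t : ℝ} (ht : 0 ≤ t) :
    HasDerivWithinAt (fun s => ∫ y, θ y * lineCoef k l (b s) y)
      ((∫ y : ℝ, ((y : ℂ) * lineD k l 0 θ y) * lineCoef k l (b t) y)
        + ∑ j : Fin 3, ∫ y, lineD k l j θ y * lineCoef k l (u t j) y) (Ici t) t := by
  refine hasDerivWithinAt_of_re_im fun ℓ => ?_
  have h1 := (hs.mass _ (isTest_osc h k l ℓ) t ht).mono (Ici_subset_Ici.2 ht)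
  simp only [pd_osc h, mul_map_osc, integral_mul_osc_coe _ h,
    integral_mul_osc_coe _ (h.lineD k l _),
    integral_mul_osc_coe _ (h.lineD k l _).id_mul] at h1
  simpa only [map_add, map_sum] using h1

/-- The momentum equations for a pair of frequencies in `(x, z)`. -/
lemma momentum_line (hs : IsSolution ε μ lam bin uin b u) (k l : ℤ) {θ : ℝ → ℂ}
    (h : IsTestLine θ) (i : Fin 3) {t : ℝ} (ht : 0 ≤ t) :
    HasDerivWithinAt (fun s => ∫ y, θ y * lineCoef k l (u s i) y)
      ((∫ y : ℝ, ((y : ℂ) * lineD k l 0 θ y) * lineCoef k l (u t i) y)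
        + (-(if i = 0 then ∫ y, θ y * lineCoef k l (u t 1) y else 0)
        + (1 / ε ^ 2 : ℝ) * (∫ y, lineD k l i θ y * lineCoef k l (b t) y)
        + (μ : ℝ) * (∫ y, lineLap k l θ y * lineCoef k l (u t i) y)
        + (lam + μ : ℝ) * ∑ j : Fin 3,
          ∫ y, lineD k l j (lineD k l i θ) y * lineCoef k l (u t j) y)) (Ici t) t := by
  refine hasDerivWithinAt_of_re_im fun ℓ => ?_
  have h1 := (hs.momentum _ (isTest_osc h k l ℓ) i t ht).mono (Ici_subset_Ici.2 ht)
  simp only [pd_osc h, lap_osc h, pd_osc (h.lineD k l _), mul_map_osc, integral_mul_osc_coe _ h,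
    integral_mul_osc_coe _ (h.lineD k l _), integral_mul_osc_coe _ (h.lineLap k l),
    integral_mul_osc_coe _ ((h.lineD k l _).lineD k l _),
    integral_mul_osc_coe _ (h.lineD k l _).id_mul] at h1
  refine h1.congr_deriv ?_
  have hr : ∀ (r : ℝ) (z : ℂ), ℓ (r * z) = r * ℓ z := fun r z => by
    rw [← Complex.real_smul, map_smul, smul_eq_mul]
  simp only [map_add, map_sum, map_neg, hr, apply_ite ℓ, map_zero]
  ring

end Solution

/-- In the frame moving with the shear flow the transport term disappears: it is cancelled by the
time derivative of the character `e^{ikty}`. -/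
lemma hasDerivWithinAt_moving_frame (k l : ℤ) {c : ℝ → LineL2} (hc : Continuous c)
    {ψ : ℝ → ℂ} (hψ : IsTestLine ψ) {t : ℝ} {Q : ℂ}
    (h : HasDerivWithinAt (fun s => ∫ y, (character (k * t) y * ψ y) * c s y)
      ((∫ y : ℝ, ((y : ℂ) * lineD k l 0 (fun y => character (k * t) y * ψ y) y) * c t y) + Q)
      (Ici t) t) :
    HasDerivWithinAt (fun s => ∫ y, ψ y * modulate (k * s) (c s) y) Q (Ici t) t := by
  set B : LineL2 →L[ℝ] LineL2 →L[ℝ] ℂ := (ContinuousLinearMap.mul ℝ ℂ).lpPairing volume 2 2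
  have hB : ∀ f g : LineL2, B f g = ∫ y, f y * g y := fun f g =>
    ContinuousLinearMap.lpPairing_eq_integral _ _ _
  have hψ' : IsTestLine fun y => Complex.I * y * ψ y := by
    simpa only [mul_assoc] using hψ.id_mul.const_mul Complex.I
  have hBm : ∀ {θ : ℝ → ℂ} (hθ : IsTestLine θ) (a : ℝ) (g : LineL2),
      B (modulate a hθ.memLp.toLp) g = ∫ y, (character a y * θ y) * g y := fun hθ a g => by
    rw [hB]
    refine integral_congr_ae ?_
    filter_upwards [coeFn_modulate a hθ.memLp.toLp, hθ.memLp.coeFn_toLp] with y h1 h2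
    rw [h1, h2]
  have hg : HasDerivWithinAt (fun s : ℝ => modulate (k * s) hψ.memLp.toLp)
      ((k : ℝ) • modulate (k * t) hψ'.memLp.toLp) (Ici t) t := by
    have h1 : HasDerivAt (fun s : ℝ => (k : ℝ) * s) (k : ℝ) t := by
      simpa using (hasDerivAt_id t).const_mul (k : ℝ)
    exact ((hasDerivAt_modulate hψ hψ'.memLp (k * t)).scomp t h1).hasDerivWithinAt
  have h2 := hasDerivWithinAt_bilin B hg hc.continuousWithinAt
    (h.congr (fun s _ => hBm hψ _ _) (hBm hψ _ _))
  simp only [hBm hψ] at h2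
  simp only [integral_mul_modulate]
  refine h2.congr_deriv ?_
  rw [map_smul, smul_apply, hBm hψ', add_right_comm]
  have h3 : (∫ y : ℝ, ((y : ℂ) * lineD k l 0 (fun y => character (k * t) y * ψ y) y) * c t y)
      = -((k : ℝ) • ∫ y, (character (k * t) y * (Complex.I * y * ψ y)) * c t y) := by
    rw [← integral_smul, ← integral_neg]
    refine integral_congr_ae (Eventually.of_forall fun y => ?_)
    simp only [lineD, if_true, Complex.real_smul]
    push_cast
    ring
  rw [h3]
  ring

/-- The zeroth order coefficient of `∂ᵢ` acting on `e^{-i(kx + lz) + iay} ψ(y)`. -/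
def shiftCoef (k l : ℤ) (a : ℝ) (i : Fin 3) : ℂ :=
  if i = 0 then -(k * Complex.I) else if i = 1 then Complex.I * a else -(l * Complex.I)

/-- The first order coefficient of `∂ᵢ` acting on `e^{-i(kx + lz) + iay} ψ(y)`. -/
def dirCoef (i : Fin 3) : ℂ := if i = 1 then 1 else 0

lemma lineD_character (k l : ℤ) (a : ℝ) (i : Fin 3) {ψ : ℝ → ℂ} (hψ : Differentiable ℝ ψ) :
    lineD k l i (fun y => character a y * ψ y) =
      fun y => character a y * (shiftCoef k l a i * ψ y + dirCoef i * deriv ψ y) := by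
  funext y
  fin_cases i
  · simp [lineD, shiftCoef, dirCoef]; ring
  · have h1 := ((hasDerivAt_character a y).mul (hψ y).hasDerivAt).deriv
    simp only [lineD, shiftCoef, dirCoef]
    simp
    refine h1.trans ?_
    ring
  · simp [lineD, shiftCoef, dirCoef]; ring

lemma lineD_lineD_character (k l : ℤ) (a : ℝ) (i j : Fin 3) {ψ : ℝ → ℂ} (hψ : IsTestLine ψ) :
    lineD k l j (lineD k l i (fun y => character a y * ψ y)) =
      fun y => character a y * (shiftCoef k l a j * shiftCoef k l a i * ψ y
        + (shiftCoef k l a j * dirCoef i + dirCoef j * shiftCoef k l a i) * deriv ψ y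
        + dirCoef j * dirCoef i * deriv (deriv ψ) y) := by
  have hd := hψ.differentiable
  have hd' := hψ.deriv.differentiable
  have hd'' : Differentiable ℝ fun y => shiftCoef k l a i * ψ y + dirCoef i * deriv ψ y :=
    (hd.const_mul _).add (hd'.const_mul _)
  rw [lineD_character k l a i hd, lineD_character k l a j hd'']
  funext y
  have h1 : deriv (fun y => shiftCoef k l a i * ψ y + dirCoef i * deriv ψ y) y =
      shiftCoef k l a i * deriv ψ y + dirCoef i * deriv (deriv ψ) y :=
    (((hd y).hasDerivAt.const_mul _).add ((hd' y).hasDerivAt.const_mul _)).deriv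
  simp only [h1]
  ring

/-! ### Coefficients of the system in the moving frame -/

lemma integral_character_mul (a : ℝ) {ψ : ℝ → ℂ} (hψ : IsTestLine ψ) (c₀ c₁ c₂ : ℂ) (c : LineL2) :
    ∫ y, (character a y * (c₀ * ψ y + c₁ * deriv ψ y + c₂ * deriv (deriv ψ) y)) * c y =
      c₀ * (∫ y, ψ y * modulate a c y) + c₁ * (∫ y, deriv ψ y * modulate a c y)
        + c₂ * ∫ y, deriv (deriv ψ) y * modulate a c y := by
  rw [← integral_mul_modulate a c fun y => c₀ * ψ y + c₁ * deriv ψ y + c₂ * deriv (deriv ψ) y,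
    ← integral_const_mul, ← integral_const_mul, ← integral_const_mul]
  simp only [add_mul, ← mul_assoc]
  exact integral_mul_coe_add (hψ.const_mul c₀).memLp (hψ.deriv.const_mul c₁).memLp
    (hψ.deriv.deriv.const_mul c₂).memLp _ _ _

/-- A weak linear system on the line, with differential operators of order at most two in `y` as
coefficients, becomes a system of multiplication operators for the Fourier transforms. -/
lemma hasDerivWithinAt_bandFourier_sum {ι : Type*} [Fintype ι] (R : ℝ) {w : ℝ → LineL2}
    (hw : Continuous w) {V : ι → ℝ → LineL2} (hV : ∀ e, Continuous (V e))
    {c₀ c₁ c₂ : ι → ℝ → ℂ} (h₀ : ∀ e, Continuous (c₀ e)) (h₁ : ∀ e, Continuous (c₁ e))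
    (h₂ : ∀ e, Continuous (c₂ e))
    (h : ∀ ψ, IsTestLine ψ → ∀ t, 0 ≤ t →
      HasDerivWithinAt (fun s => ∫ y, ψ y * w s y)
        (∑ e, (c₀ e t * (∫ y, ψ y * V e t y) + c₁ e t * (∫ y, deriv ψ y * V e t y)
          + c₂ e t * ∫ y, deriv (deriv ψ) y * V e t y)) (Ici t) t) {t : ℝ} (ht : 0 ≤ t) :
    HasDerivWithinAt (fun s => bandFourier R (w s))
      (∑ e, (c₀ e t • bandFourier R (V e t)
        - Complex.I • mulOp R (freq R) (c₁ e t • bandFourier R (V e t))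
        - mulOp R (freq R) (mulOp R (freq R) (c₂ e t • bandFourier R (V e t))))) (Ici t) t := by
  have hc : ∀ {c : ι → ℝ → ℂ}, (∀ e, Continuous (c e)) →
      Continuous fun t => ∑ e, c e t • V e t := fun hc =>
    continuous_finsetSum _ fun e _ => (hc e).smul (hV e)
  have h3 := hasDerivWithinAt_bandFourier R hw (hc h₀) (hc h₁) (hc h₂) (fun ψ hψ s hs => by
    refine (h ψ hψ s hs).congr_deriv ?_
    rw [← pairing_apply hψ.memLp, ← pairing_apply hψ.deriv.memLp,
      ← pairing_apply hψ.deriv.deriv.memLp]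
    simp only [map_sum, map_smul, pairing_apply, smul_eq_mul, Finset.sum_add_distrib]) ht
  refine h3.congr_deriv ?_
  simp only [map_sum, map_smul, Finset.sum_sub_distrib, Finset.smul_sum]

lemma smul_sub_mulOp_eq (R : ℝ) (V : BandL2 R) {κ κ' c₀ c₁ c₂ : ℂ} {m : ℝ →ᵇ ℝ}
    (h : ∀ ξ, κ * (c₀ - Complex.I * freq R ξ * c₁ - (freq R ξ : ℂ) ^ 2 * c₂) = m ξ * κ') :
    κ • (c₀ • V - Complex.I • mulOp R (freq R) (c₁ • V)
      - mulOp R (freq R) (mulOp R (freq R) (c₂ • V))) = mulOp R m (κ' • V) := by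
  rw [← mulOp_mul, mulOp_smul, mulOp_smul, mulOp_smul]
  apply Lp.ext
  set G₁ := mulOp R (freq R) V with hG₁
  set G₂ := mulOp R (freq R * freq R) V with hG₂
  set G₃ := mulOp R m V with hG₃
  filter_upwards [coeFn_mulOp R (freq R) V, coeFn_mulOp R (freq R * freq R) V, coeFn_mulOp R m V,
    Lp.coeFn_smul κ (c₀ • V - Complex.I • c₁ • G₁ - c₂ • G₂),
    Lp.coeFn_sub (c₀ • V - Complex.I • c₁ • G₁) (c₂ • G₂),
    Lp.coeFn_sub (c₀ • V) (Complex.I • c₁ • G₁), Lp.coeFn_smul Complex.I (c₁ • G₁),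
    Lp.coeFn_smul c₀ V, Lp.coeFn_smul c₁ G₁, Lp.coeFn_smul c₂ G₂, Lp.coeFn_smul κ' G₃]
    with ξ e1 e2 e3 e4 e5 e6 e7 e8 e9 e10 e11
  rw [← hG₁] at e1
  rw [← hG₂] at e2
  rw [← hG₃] at e3
  rw [e4, e11, Pi.smul_apply, Pi.smul_apply, e5, Pi.sub_apply, e6, Pi.sub_apply, e7, Pi.smul_apply,
    e8, e9, e10, Pi.smul_apply, Pi.smul_apply, Pi.smul_apply, e1, e2, e3,
    BoundedContinuousFunction.mul_apply]
  simp only [smul_eq_mul]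
  push_cast
  linear_combination V ξ * h ξ

/-- The coefficients of `ψ` in the weak form of the system in the moving frame, for the
equation `o` and the unknown `e`; `none` stands for the density, `some i` for the velocity
component `i`. -/
def coef₀ (ε μ lam : ℝ) (k l : ℤ) (t : ℝ) : Option (Fin 3) → Option (Fin 3) → ℂ
  | none, none => 0
  | none, some j => shiftCoef k l (k * t) j
  | some i, none => (1 / ε ^ 2 : ℝ) * shiftCoef k l (k * t) i
  | some i, some j => -(if i = 0 ∧ j = 1 then 1 else 0)
      + (if j = i then (μ : ℂ) * ∑ a, shiftCoef k l (k * t) a * shiftCoef k l (k * t) a else 0)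
      + (lam + μ : ℝ) * (shiftCoef k l (k * t) j * shiftCoef k l (k * t) i)

/-- The coefficients of `ψ'`, as in `coef₀`. -/
def coef₁ (ε μ lam : ℝ) (k l : ℤ) (t : ℝ) : Option (Fin 3) → Option (Fin 3) → ℂ
  | none, none => 0
  | none, some j => dirCoef j
  | some i, none => (1 / ε ^ 2 : ℝ) * dirCoef i
  | some i, some j =>
      (if j = i then (μ : ℂ) * ∑ a, (shiftCoef k l (k * t) a * dirCoef a
        + dirCoef a * shiftCoef k l (k * t) a) else 0)
      + (lam + μ : ℝ) * (shiftCoef k l (k * t) j * dirCoef i + dirCoef j * shiftCoef k l (k * t) i)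

/-- The coefficients of `ψ''`, as in `coef₀`. -/
def coef₂ (μ lam : ℝ) : Option (Fin 3) → Option (Fin 3) → ℂ
  | some i, some j => (if j = i then (μ : ℂ) * ∑ a, dirCoef a * dirCoef a else 0)
      + (lam + μ : ℝ) * (dirCoef j * dirCoef i)
  | _, _ => 0

/-- The wave vector `(k, η - kt, l)` in the moving frame, with `η` the truncated frequency. -/
def waveVec (R : ℝ) (k l : ℤ) (t : ℝ) (i : Fin 3) : ℝ →ᵇ ℝ :=
  if i = 0 then BoundedContinuousFunction.const ℝ (k : ℝ) else
    if i = 1 then freq R - BoundedContinuousFunction.const ℝ (k * t : ℝ) else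
      BoundedContinuousFunction.const ℝ (l : ℝ)

/-- The matrix of the system for the unknowns `(B, iU)`, which is real. -/
def modeMat (R ε μ lam : ℝ) (k l : ℤ) (t : ℝ) : Option (Fin 3) → Option (Fin 3) → (ℝ →ᵇ ℝ)
  | none, none => 0
  | none, some j => -waveVec R k l t j
  | some i, none => (1 / ε ^ 2 : ℝ) • waveVec R k l t i
  | some i, some j => -(if i = 0 ∧ j = 1 then 1 else 0)
      - (if j = i then μ • ∑ a, waveVec R k l t a * waveVec R k l t a else 0)
      - (lam + μ) • (waveVec R k l t j * waveVec R k l t i)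

/-- The phase by which an unknown is multiplied to make the system real. -/
def phase : Option (Fin 3) → ℂ
  | none => 1
  | some _ => Complex.I

lemma shiftCoef_sub (R : ℝ) (k l : ℤ) (t ξ : ℝ) (i : Fin 3) :
    shiftCoef k l (k * t) i - Complex.I * freq R ξ * dirCoef i =
      -(Complex.I * waveVec R k l t i ξ) := by
  fin_cases i <;> simp [shiftCoef, dirCoef, waveVec] <;> ring

lemma shiftCoef_mul_sub (R : ℝ) (k l : ℤ) (t ξ : ℝ) (i j : Fin 3) :
    shiftCoef k l (k * t) j * shiftCoef k l (k * t) i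
      - Complex.I * freq R ξ * (shiftCoef k l (k * t) j * dirCoef i
        + dirCoef j * shiftCoef k l (k * t) i)
      - (freq R ξ : ℂ) ^ 2 * (dirCoef j * dirCoef i) =
      -(waveVec R k l t j ξ * waveVec R k l t i ξ : ℂ) := by
  have h1 := shiftCoef_sub R k l t ξ i
  have h2 := shiftCoef_sub R k l t ξ j
  have h3 := Complex.I_sq
  linear_combination (shiftCoef k l (k * t) i - Complex.I * freq R ξ * dirCoef i) * h2
    - Complex.I * waveVec R k l t j ξ * h1
    + ((waveVec R k l t j ξ : ℂ) * waveVec R k l t i ξ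
      - (freq R ξ : ℂ) ^ 2 * (dirCoef j * dirCoef i)) * h3

lemma phase_mul_coef (R ε μ lam : ℝ) (k l : ℤ) (t ξ : ℝ) (o e : Option (Fin 3)) :
    phase o * (coef₀ ε μ lam k l t o e - Complex.I * freq R ξ * coef₁ ε μ lam k l t o e
      - (freq R ξ : ℂ) ^ 2 * coef₂ μ lam o e) = modeMat R ε μ lam k l t o e ξ * phase e := by
  rcases o with _ | i <;> rcases e with _ | j
  · simp [coef₀, coef₁, coef₂, modeMat, phase]
  · simp only [coef₀, coef₁, coef₂, modeMat, phase, BoundedContinuousFunction.neg_apply]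
    push_cast
    linear_combination shiftCoef_sub R k l t ξ j
  · simp only [coef₀, coef₁, coef₂, modeMat, phase, BoundedContinuousFunction.smul_apply,
      smul_eq_mul]
    push_cast
    linear_combination (1 / (ε : ℂ) ^ 2) * Complex.I * shiftCoef_sub R k l t ξ i
      - (1 / (ε : ℂ) ^ 2) * waveVec R k l t i ξ * Complex.I_sq
  · have h1 := shiftCoef_mul_sub R k l t ξ i j
    have h2 := fun a => shiftCoef_mul_sub R k l t ξ a a
    have h3 : ((∑ a, waveVec R k l t a * waveVec R k l t a : ℝ →ᵇ ℝ) ξ : ℂ) =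
        ∑ a, (waveVec R k l t a ξ * waveVec R k l t a ξ : ℂ) := by
      rw [BoundedContinuousFunction.coe_sum, Finset.sum_apply]
      push_cast
      exact Finset.sum_congr rfl fun a _ => by
        rw [BoundedContinuousFunction.mul_apply, Complex.ofReal_mul]
    have h4 : (∑ a, shiftCoef k l (k * t) a * shiftCoef k l (k * t) a)
        - Complex.I * freq R ξ * (∑ a, (shiftCoef k l (k * t) a * dirCoef a
          + dirCoef a * shiftCoef k l (k * t) a))
        - (freq R ξ : ℂ) ^ 2 * (∑ a, dirCoef a * dirCoef a) =
        -((∑ a, waveVec R k l t a * waveVec R k l t a : ℝ →ᵇ ℝ) ξ : ℂ) := by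
      rw [h3, Finset.mul_sum, Finset.mul_sum, ← Finset.sum_sub_distrib, ← Finset.sum_sub_distrib,
        ← Finset.sum_neg_distrib]
      exact Finset.sum_congr rfl fun a _ => h2 a
    simp only [coef₀, coef₁, coef₂, modeMat, phase, BoundedContinuousFunction.sub_apply,
      BoundedContinuousFunction.neg_apply, BoundedContinuousFunction.smul_apply,
      BoundedContinuousFunction.mul_apply, smul_eq_mul]
    split_ifs
    all_goals
      simp only [BoundedContinuousFunction.coe_one, BoundedContinuousFunction.coe_zero,
        Pi.one_apply, Pi.zero_apply, BoundedContinuousFunction.smul_apply, smul_eq_mul]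
      push_cast
    · linear_combination Complex.I * (lam + μ) * h1 + Complex.I * μ * h4
    · linear_combination Complex.I * (lam + μ) * h1
    · linear_combination Complex.I * (lam + μ) * h1 + Complex.I * μ * h4
    · linear_combination Complex.I * (lam + μ) * h1

lemma continuous_modeMat (R ε μ lam : ℝ) (k l : ℤ) (o e : Option (Fin 3)) :
    Continuous fun t => modeMat R ε μ lam k l t o e := by
  have hconst : Continuous fun x : ℝ => BoundedContinuousFunction.const ℝ x :=
    (continuous_id.smul (continuous_const (y := (1 : ℝ →ᵇ ℝ)))).congr fun x => by ext; simp
  have hw : ∀ i, Continuous fun t => waveVec R k l t i := fun i => by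
    unfold waveVec
    fin_cases i
    · exact continuous_const
    · exact continuous_const.sub (hconst.comp (by fun_prop : Continuous fun t : ℝ => (k : ℝ) * t))
    · exact continuous_const
  rcases o with _ | i <;> rcases e with _ | j <;> simp only [modeMat]
  · exact continuous_const
  · exact (hw j).neg
  · exact Continuous.const_smul (hw i) (1 / ε ^ 2 : ℝ)
  · refine (continuous_const.sub ?_).sub
      (Continuous.const_smul ((hw j).mul (hw i)) (lam + μ : ℝ))
    split_ifs
    · exact Continuous.const_smul (continuous_finsetSum _ fun a _ => (hw a).mul (hw a)) (μ : ℝ)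
    · exact continuous_const

lemma continuous_coef₀ (ε μ lam : ℝ) (k l : ℤ) (o e : Option (Fin 3)) :
    Continuous fun t => coef₀ ε μ lam k l t o e := by
  have hw : ∀ i, Continuous fun t : ℝ => shiftCoef k l (k * t) i := fun i => by
    unfold shiftCoef
    fin_cases i
    · exact continuous_const
    · simp; fun_prop
    · exact continuous_const
  rcases o with _ | i <;> rcases e with _ | j <;> simp only [coef₀]
  · exact continuous_const
  · exact hw j
  · fun_prop
  · split_ifs <;> fun_prop

lemma continuous_coef₁ (ε μ lam : ℝ) (k l : ℤ) (o e : Option (Fin 3)) :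
    Continuous fun t => coef₁ ε μ lam k l t o e := by
  have hw : ∀ i, Continuous fun t : ℝ => shiftCoef k l (k * t) i := fun i => by
    unfold shiftCoef
    fin_cases i
    · exact continuous_const
    · simp; fun_prop
    · exact continuous_const
  rcases o with _ | i <;> rcases e with _ | j <;> simp only [coef₁]
  · exact continuous_const
  · exact continuous_const
  · exact continuous_const
  · split_ifs <;> fun_prop

/-! ### The Fourier transform of a solution -/

/-- The unknowns of the system: the density for `none`, a velocity component for `some i`. -/
def unknown (b : ℝ → L2) (u : ℝ → Fin 3 → L2) : Option (Fin 3) → ℝ → L2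
  | none => b
  | some i => fun t => u t i

/-- The coefficient of an unknown of frequency `(k, l)` in `(x, z)`, in the frame moving with the
shear flow. Negative times, which play no role, are mapped to `0`. -/
def frame (k l : ℤ) (b : ℝ → L2) (u : ℝ → Fin 3 → L2) (o : Option (Fin 3)) (t : ℝ) : LineL2 :=
  modulate (k * t) (lineCoef k l (unknown b u o (max t 0)))

section Solution

variable {ε μ lam : ℝ} {bin : Dom → ℝ} {uin : Fin 3 → Dom → ℝ} {b : ℝ → L2} {u : ℝ → Fin 3 → L2}

lemma continuous_lineCoef_unknown (hs : IsSolution ε μ lam bin uin b u) (k l : ℤ)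
    (o : Option (Fin 3)) : Continuous fun t => lineCoef k l (unknown b u o (max t 0)) := by
  have h1 : ContinuousOn (unknown b u o) (Ici 0) := by
    rcases o with _ | i
    · exact hs.continuousOn_b
    · exact hs.continuousOn_u i
  have h2 : Continuous fun t : ℝ => unknown b u o (max t 0) :=
    h1.comp_continuous (by fun_prop) fun t => le_max_right t 0
  exact (continuous_lineCoef k l).comp h2

lemma continuous_frame (hs : IsSolution ε μ lam bin uin b u) (k l : ℤ) (o : Option (Fin 3)) :
    Continuous (frame k l b u o) :=
  continuous_modulate_comp (by fun_prop) (continuous_lineCoef_unknown hs k l o)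

lemma frame_of_nonneg (k l : ℤ) (b : ℝ → L2) (u : ℝ → Fin 3 → L2) (o : Option (Fin 3)) {t : ℝ}
    (ht : 0 ≤ t) : frame k l b u o t = modulate (k * t) (lineCoef k l (unknown b u o t)) := by
  rw [frame, max_eq_left ht]

lemma integral_lineD_character (k l : ℤ) (a : ℝ) (i : Fin 3) {ψ : ℝ → ℂ} (hψ : IsTestLine ψ)
    (c : LineL2) :
    ∫ y, lineD k l i (fun y => character a y * ψ y) y * c y =
      shiftCoef k l a i * (∫ y, ψ y * modulate a c y)
        + dirCoef i * (∫ y, deriv ψ y * modulate a c y)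
        + 0 * ∫ y, deriv (deriv ψ) y * modulate a c y := by
  rw [← integral_character_mul a hψ, lineD_character k l a i hψ.differentiable]
  simp only [zero_mul, add_zero]

lemma integral_lineD_lineD_character (k l : ℤ) (a : ℝ) (i j : Fin 3) {ψ : ℝ → ℂ}
    (hψ : IsTestLine ψ) (c : LineL2) :
    ∫ y, lineD k l j (lineD k l i fun y => character a y * ψ y) y * c y =
      shiftCoef k l a j * shiftCoef k l a i * (∫ y, ψ y * modulate a c y)
        + (shiftCoef k l a j * dirCoef i + dirCoef j * shiftCoef k l a i) *
          (∫ y, deriv ψ y * modulate a c y)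
        + dirCoef j * dirCoef i * ∫ y, deriv (deriv ψ) y * modulate a c y := by
  rw [← integral_character_mul a hψ, lineD_lineD_character k l a i j hψ]

lemma integral_lineLap_character (k l : ℤ) (a : ℝ) {ψ : ℝ → ℂ} (hψ : IsTestLine ψ) (c : LineL2) :
    ∫ y, lineLap k l (fun y => character a y * ψ y) y * c y =
      (∑ i, shiftCoef k l a i * shiftCoef k l a i) * (∫ y, ψ y * modulate a c y)
        + (∑ i, (shiftCoef k l a i * dirCoef i + dirCoef i * shiftCoef k l a i)) *
          (∫ y, deriv ψ y * modulate a c y)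
        + (∑ i, dirCoef i * dirCoef i) * ∫ y, deriv (deriv ψ) y * modulate a c y := by
  rw [← integral_character_mul a hψ]
  congr 1
  funext y
  congr 1
  simp only [lineLap, lineD_lineD_character k l a _ _ hψ, Fin.sum_univ_three]
  ring

/-- The weak form of the system in the moving frame. -/
lemma hasDerivWithinAt_frame (hs : IsSolution ε μ lam bin uin b u) (k l : ℤ) (o : Option (Fin 3))
    {ψ : ℝ → ℂ} (hψ : IsTestLine ψ) {t : ℝ} (ht : 0 ≤ t) :
    HasDerivWithinAt (fun s => ∫ y, ψ y * frame k l b u o s y)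
      (∑ e, (coef₀ ε μ lam k l t o e * (∫ y, ψ y * frame k l b u e t y)
        + coef₁ ε μ lam k l t o e * (∫ y, deriv ψ y * frame k l b u e t y)
        + coef₂ μ lam o e * ∫ y, deriv (deriv ψ) y * frame k l b u e t y)) (Ici t) t := by
  have hθ : IsTestLine fun y => character (k * t) y * ψ y := hψ.mul_left (contDiff_character _)
  have hmax : ∀ s ∈ Ici t, max s 0 = s := fun s hs => max_eq_left (ht.trans hs)
  rcases o with _ | i
  · refine (hasDerivWithinAt_moving_frame k l (continuous_lineCoef_unknown hs k l none) hψ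
      (Q := ∑ j : Fin 3, ∫ y, lineD k l j (fun y => character (k * t) y * ψ y) y *
        lineCoef k l (u t j) y) ?_).congr_deriv ?_
    · have h1 := mass_line hs k l hθ ht
      rw [max_eq_left ht]
      exact h1.congr (fun s hs => by simp only [hmax s hs, unknown])
        (by simp only [max_eq_left ht, unknown])
    · simp only [integral_lineD_character _ _ _ _ hψ, Fintype.sum_option, coef₀, coef₁, coef₂,
        frame_of_nonneg k l b u _ ht, unknown, zero_mul, add_zero, zero_add]
  · have h1 := (momentum_line hs k l hθ i ht).congr
      (f₁ := fun s => ∫ y, (character (k * t) y * ψ y) *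
        lineCoef k l (unknown b u (some i) (max s 0)) y)
      (fun s hs => by simp only [hmax s hs, unknown]) (by simp only [max_eq_left ht, unknown])
    have h2 : unknown b u (some i) (max t 0) = u t i := by rw [max_eq_left ht]; rfl
    have h3 := hasDerivWithinAt_moving_frame k l (continuous_lineCoef_unknown hs k l (some i)) hψ
      (h1.congr_deriv (by rw [h2]))
    refine HasDerivWithinAt.congr_deriv h3 ?_
    have h4 : ∀ c : LineL2, ∫ y, (character (k * t) y * ψ y) * c y =
        ∫ y, ψ y * modulate (k * t) c y := fun c => (integral_mul_modulate _ _ _).symm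
    simp only [h4, integral_lineD_character _ _ _ _ hψ, integral_lineLap_character _ _ _ hψ,
      integral_lineD_lineD_character _ _ _ _ _ hψ, Fintype.sum_option, coef₀, coef₁, coef₂,
      frame_of_nonneg k l b u _ ht, unknown]
    simp only [Fin.sum_univ_three]
    fin_cases i <;> simp <;> ring

/-- The Fourier transforms of the unknowns in the moving frame solve, for almost every frequency,
the ordinary differential equations of that frequency. -/
lemma exists_solution_frequency (hs : IsSolution ε μ lam bin uin b u) (k l : ℤ) (R : ℝ) {T : ℝ}
    (hT : 0 ≤ T) :
    ∀ᵐ ξ ∂(bandMeasure R), ∃ y : ℝ → Option (Fin 3) → ℂ,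
      (∀ t o, HasDerivAt (fun s => y s o)
        (∑ e, (modeMat R ε μ lam k l t o e ξ : ℂ) * y t e) t) ∧
      (∀ o, y 0 o = phase o * (𝓕 (lineCoef k l (unknown b u o 0)) : LineL2) ξ) ∧
      ∀ o, y T o = phase o * (𝓕 (frame k l b u o T) : LineL2) ξ := by
  set X : ℝ → Option (Fin 3) → BandL2 R := fun t o => phase o • bandFourier R (frame k l b u o t)
    with hX
  have hXc : Continuous X := continuous_pi fun o =>
    ((bandFourier R).continuous.comp (continuous_frame hs k l o)).const_smul (phase o)
  have h1 := exists_pointwise_solution R (m := modeMat R ε μ lam k l)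
    (continuous_modeMat R ε μ lam k l) hXc (fun t ht => hasDerivWithinAt_pi.2 fun o => by
      have h2 := hasDerivWithinAt_bandFourier_sum R (continuous_frame hs k l o)
        (continuous_frame hs k l) (continuous_coef₀ ε μ lam k l o)
        (continuous_coef₁ ε μ lam k l o) (c₂ := fun e _ => coef₂ μ lam o e)
        (fun e => continuous_const) (fun ψ hψ s hs' => hasDerivWithinAt_frame hs k l o hψ hs') ht
      refine (h2.const_smul (phase o)).congr_deriv ?_
      rw [Finset.smul_sum]
      exact Finset.sum_congr rfl fun e _ =>
        smul_sub_mulOp_eq R _ fun ξ => phase_mul_coef R ε μ lam k l t ξ o e) hT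
  have h3 : ∀ t, ∀ᵐ ξ ∂(bandMeasure R), ∀ o,
      X t o ξ = phase o * (𝓕 (frame k l b u o t) : LineL2) ξ := fun t =>
    ae_all_iff.2 fun o => by
      filter_upwards [Lp.coeFn_smul (phase o) (bandFourier R (frame k l b u o t)),
        coeFn_bandFourier R (frame k l b u o t)] with ξ e1 e2
      rw [hX]
      simp only
      rw [e1, Pi.smul_apply, e2, smul_eq_mul]
  filter_upwards [h1, h3 0, h3 T] with ξ ⟨y, hy, hy0, hyT⟩ e1 e2
  refine ⟨y, hy, fun o => ?_, fun o => by rw [hyT, e2]⟩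
  rw [hy0, e1, frame_of_nonneg k l b u o le_rfl, mul_zero, modulate_zero]

end Solution

/-! ### Decay at almost every frequency -/

lemma isMode_of_hasDerivAt {R ε ρ lam : ℝ} {k l : ℤ} {ξ : ℝ} (hξ : ξ ∈ Icc (-R) R)
    {x : ℝ → Option (Fin 3) → ℝ}
    (hx : ∀ t o, HasDerivAt (fun s => x s o)
      (∑ e, modeMat R ε (ρ ^ 3) lam k l t o e ξ * x t e) t) :
    IsMode ε ρ (lam + 2 * ρ ^ 3) k l (2 * Real.pi * ξ) (fun t => x t none)
      (fun t => x t (some 0)) (fun t => x t (some 1)) (fun t => x t (some 2)) := by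
  constructor
  all_goals
    intro t
    refine (hx t _).congr_deriv ?_
    simp [Fintype.sum_option, Fin.sum_univ_three, modeMat, waveVec, freq_apply hξ, symb] <;>
      ring

/-- The factor by which the square of an unknown is multiplied in the estimates, in terms of
`ρ = μ^{1/3}`: the density and `u²` lose a factor `ρ^{-1/2} = μ^{-1/6}`. -/
def gain (ρ : ℝ) : Option (Fin 3) → ℝ
  | none => ρ
  | some i => if i = 1 then ρ else 1

lemma norm_phase (o : Option (Fin 3)) : ‖phase o‖ = 1 := by
  rcases o with _ | i <;> simp [phase]

/-- The bounds of `exists_mode_le`, applied to the real and the imaginary parts of the Fourier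
transform of a solution. The weight of the data is the square of the symbol of `Δ`. -/
theorem exists_frequency_le (ε : ℝ) (hε : 0 < ε) : ∃ C : ℝ, 0 ≤ C ∧ ∀ (ρ lam : ℝ)
    (bin : Dom → ℝ) (uin : Fin 3 → Dom → ℝ) (b : ℝ → L2) (u : ℝ → Fin 3 → L2),
    Admissible ε ρ (lam + 2 * ρ ^ 3) → IsSolution ε (ρ ^ 3) lam bin uin b u →
    ∀ k l : ℤ, k ≠ 0 → ∀ T, 0 ≤ T → ∀ᵐ ξ : ℝ, ∀ o,
      gain ρ o * ‖(𝓕 (frame k l b u o T) : LineL2) ξ‖ ^ 2 ≤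
        C * Real.exp (-(3 / 10 * ρ * T)) * ((k ^ 2 + l ^ 2 + (2 * Real.pi * ξ) ^ 2) ^ 2 *
          ∑ e, ‖(𝓕 (lineCoef k l (unknown b u e 0)) : LineL2) ξ‖ ^ 2) := by
  obtain ⟨C, hC, hmode⟩ := exists_mode_le ε hε
  refine ⟨C, hC, fun ρ lam bin uin b u hp hs k l hk T hT => ?_⟩
  have hk1 : (1 : ℝ) ≤ |(k : ℝ)| := by exact_mod_cast Int.one_le_abs hk
  have h1 : ∀ n : ℕ, ∀ᵐ ξ : ℝ, ξ ∈ Icc (-(n : ℝ)) n → _ := fun n =>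
    (ae_restrict_iff' measurableSet_Icc).1 (exists_solution_frequency hs k l n hT)
  filter_upwards [ae_all_iff.2 h1] with ξ hξ o
  obtain ⟨n, hn⟩ := exists_nat_ge |ξ|
  have hmem : ξ ∈ Icc (-(n : ℝ)) n := abs_le.1 hn
  obtain ⟨y, hy, hy0, hyT⟩ := hξ n hmem
  -- the real and imaginary parts solve the same real system
  have hpart : ∀ ℓ : ℂ →L[ℝ] ℝ, gain ρ o * ℓ (y T o) ^ 2 ≤
      C * Real.exp (-(3 / 10 * ρ * T)) * ((k ^ 2 + l ^ 2 + (2 * Real.pi * ξ) ^ 2) ^ 2 *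
        ∑ e, ℓ (y 0 e) ^ 2) := fun ℓ => by
    have hm := isMode_of_hasDerivAt hmem (x := fun t o => ℓ (y t o)) (ε := ε) (ρ := ρ) (lam := lam)
      (k := k) (l := l) fun t o => by
        refine (ℓ.hasFDerivAt.comp_hasDerivAt t (hy t o)).congr_deriv ?_
        rw [map_sum]
        exact Finset.sum_congr rfl fun e _ => by
          rw [← Complex.real_smul, map_smul, smul_eq_mul]
    have h2 := hmode ρ _ k l _ _ _ _ _ hp hk1 hm T hT
    have h3 : C * dataSq k l (2 * Real.pi * ξ) (fun t => ℓ (y t none)) (fun t => ℓ (y t (some 0)))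
        (fun t => ℓ (y t (some 1))) (fun t => ℓ (y t (some 2))) * Real.exp (-(3 / 10 * ρ * T)) =
        C * Real.exp (-(3 / 10 * ρ * T)) * ((k ^ 2 + l ^ 2 + (2 * Real.pi * ξ) ^ 2) ^ 2 *
        ∑ e, ℓ (y 0 e) ^ 2) := by
      simp only [dataSq, symb, Fintype.sum_option, Fin.sum_univ_three]
      ring
    rw [h3] at h2
    rcases o with _ | i
    · exact h2.1
    · fin_cases i
      · simpa [gain] using h2.2.1
      · simpa [gain] using h2.2.2.1
      · simpa [gain] using h2.2.2.2
  have hnorm : ∀ z : ℂ, ‖z‖ ^ 2 = Complex.reCLM z ^ 2 + Complex.imCLM z ^ 2 := fun z => by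
    rw [← Complex.normSq_eq_norm_sq, Complex.normSq_apply, Complex.reCLM_apply,
      Complex.imCLM_apply]
    ring
  have e1 : ∀ e, ‖(𝓕 (lineCoef k l (unknown b u e 0)) : LineL2) ξ‖ = ‖y 0 e‖ := fun e => by
    rw [hy0, norm_mul, norm_phase, one_mul]
  have e2 : ‖(𝓕 (frame k l b u o T) : LineL2) ξ‖ = ‖y T o‖ := by
    rw [hyT, norm_mul, norm_phase, one_mul]
  simp only [e1, e2, hnorm, Finset.sum_add_distrib]
  linarith [hpart Complex.reCLM, hpart Complex.imCLM]

lemma IsWeakPartial.oscPairing_eq {i : Fin 3} {f g : Dom → ℝ} (hf : MemLp f 2 volume)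
    (h : IsWeakPartial i f g) (k l : ℤ) {θ : ℝ → ℂ} (hθ : IsTestLine θ) :
    oscPairing k l f (lineD k l i θ) = -oscPairing k l g θ := by
  have h1 : ∀ ℓ : ℂ →L[ℝ] ℝ, ℓ (oscPairing k l f (lineD k l i θ)) = ℓ (-oscPairing k l g θ) :=
    fun ℓ => by
      have h2 := h.2 _ (isTest_osc hθ k l ℓ)
      rwa [pd_osc hθ, integral_mul_osc hf (hθ.lineD k l i), integral_mul_osc h.1 hθ, ← map_neg]
        at h2
  exact Complex.ext (h1 Complex.reCLM) (h1 Complex.imCLM)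

lemma isWeakPartial_weakPartial {i : Fin 3} {f : Dom → ℝ} (h : ∃ g, IsWeakPartial i f g) :
    IsWeakPartial i f (weakPartial i f) := by
  rw [weakPartial, dif_pos h]
  exact h.choose_spec

lemma MemH2.memLp_weakLaplacian {f : Dom → ℝ} (h : MemH2 f) :
    MemLp (weakLaplacian f) 2 volume :=
  memLp_finsetSum _ fun i _ => (isWeakPartial_weakPartial ((h.2 i).2 i)).1

lemma MemH2.oscPairing_weakLaplacian {f : Dom → ℝ} (h : MemH2 f) (k l : ℤ) {θ : ℝ → ℂ}
    (hθ : IsTestLine θ) :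
    oscPairing k l (weakLaplacian f) θ =
      ∑ i, oscPairing k l f (lineD k l i (lineD k l i θ)) := by
  have h1 : ∀ i, IsWeakPartial i (weakPartial i f) (weakPartial i (weakPartial i f)) := fun i =>
    isWeakPartial_weakPartial ((h.2 i).2 i)
  have h2 : ∀ i, IsWeakPartial i f (weakPartial i f) := fun i => isWeakPartial_weakPartial (h.2 i).1
  have h3 : ∀ i, oscPairing k l f (lineD k l i (lineD k l i θ)) =
      oscPairing k l (weakPartial i (weakPartial i f)) θ := fun i => by
    rw [(h2 i).oscPairing_eq h.1 k l (hθ.lineD k l i),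
      (h1 i).oscPairing_eq (h2 i).1 k l hθ, neg_neg]
  simp only [h3]
  unfold oscPairing
  rw [← integral_finsetSum _ fun i _ => integrable_mul_osc (h1 i).1 hθ k l]
  refine integral_congr_ae (Eventually.of_forall fun p => ?_)
  simp only [weakLaplacian]
  push_cast
  rw [Finset.sum_mul]

/-- The Fourier transform turns the Laplacian into multiplication by its symbol. -/
lemma MemH2.fourier_weakLaplacian {f : Dom → ℝ} (h : MemH2 f) (k l : ℤ) :
    ∀ᵐ ξ : ℝ, (𝓕 (lineCoef k l (weakLaplacian f)) : LineL2) ξ =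
      -((k ^ 2 + l ^ 2 + (2 * Real.pi * ξ) ^ 2 : ℝ) : ℂ) * (𝓕 (lineCoef k l f) : LineL2) ξ := by
  set F := lineCoef k l f with hF
  set G := lineCoef k l (weakLaplacian f) with hG
  have h1 := fourier_add_eq_zero (G + ((k : ℂ) ^ 2 + (l : ℂ) ^ 2) • F) 0 (-F) fun ψ hψ => by
    have e1 : ∫ y, ψ y * G y = ∑ i, ∫ y, lineD k l i (lineD k l i ψ) y * F y := by
      rw [hG, integral_mul_lineCoef h.memLp_weakLaplacian hψ, h.oscPairing_weakLaplacian k l hψ]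
      exact Finset.sum_congr rfl fun i _ =>
        (integral_mul_lineCoef h.1 ((hψ.lineD k l i).lineD k l i) k l).symm
    have e2 : ∫ y, (ψ y * (G + ((k : ℂ) ^ 2 + (l : ℂ) ^ 2) • F : LineL2) y
        + deriv ψ y * (0 : LineL2) y + deriv (deriv ψ) y * (-F : LineL2) y) =
        pairing hψ.memLp (G + ((k : ℂ) ^ 2 + (l : ℂ) ^ 2) • F) + pairing hψ.deriv.memLp 0
          + pairing hψ.deriv.deriv.memLp (-F) := by
      rw [pairing_apply, pairing_apply, pairing_apply]
      exact integral_mul_coe_add hψ.memLp hψ.deriv.memLp hψ.deriv.deriv.memLp _ _ _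
    have e3 : ∫ y, lineD k l 0 (lineD k l 0 ψ) y * F y = -(k : ℂ) ^ 2 * ∫ y, ψ y * F y := by
      rw [← integral_const_mul]
      refine integral_congr_ae (Eventually.of_forall fun y => ?_)
      simp [lineD]
      linear_combination (k : ℂ) ^ 2 * ψ y * F y * Complex.I_sq
    have e4 : ∫ y, lineD k l 2 (lineD k l 2 ψ) y * F y = -(l : ℂ) ^ 2 * ∫ y, ψ y * F y := by
      rw [← integral_const_mul]
      refine integral_congr_ae (Eventually.of_forall fun y => ?_)
      simp [lineD]
      linear_combination (l : ℂ) ^ 2 * ψ y * F y * Complex.I_sq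
    have e5 : lineD k l 1 (lineD k l 1 ψ) = deriv (deriv ψ) := by
      funext y
      simp only [lineD]
      simp
      rfl
    rw [Fin.sum_univ_three, e3, e4, e5] at e1
    rw [e2, map_add, map_smul, map_zero, map_neg, pairing_apply, pairing_apply, pairing_apply, e1,
      smul_eq_mul]
    ring
  have e6 : (𝓕 (G + ((k : ℂ) ^ 2 + (l : ℂ) ^ 2) • F) : LineL2) =
      𝓕 G + ((k : ℂ) ^ 2 + (l : ℂ) ^ 2) • 𝓕 F :=
    ((Lp.fourierTransformₗᵢ ℝ ℂ).map_add _ _).trans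
      (congrArg _ ((Lp.fourierTransformₗᵢ ℝ ℂ).map_smul _ _))
  have e7 : (𝓕 (-F) : LineL2) = -𝓕 F := (Lp.fourierTransformₗᵢ ℝ ℂ).map_neg _
  have e8 : (𝓕 (0 : LineL2) : LineL2) = 0 := (Lp.fourierTransformₗᵢ ℝ ℂ).map_zero
  rw [e6, e7, e8] at h1
  filter_upwards [h1, Lp.coeFn_add (𝓕 G : LineL2) (((k : ℂ) ^ 2 + (l : ℂ) ^ 2) • (𝓕 F : LineL2)),
    Lp.coeFn_smul ((k : ℂ) ^ 2 + (l : ℂ) ^ 2) (𝓕 F : LineL2), Lp.coeFn_neg (𝓕 F : LineL2),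
    Lp.coeFn_zero ℂ 2 (volume : Measure ℝ)] with ξ a1 a2 a3 a4 a5
  rw [a2, Pi.add_apply, a3, a4, a5, Pi.smul_apply, Pi.neg_apply, Pi.zero_apply, smul_eq_mul] at a1
  push_cast
  linear_combination a1 + (2 * Real.pi * ξ : ℂ) ^ 2 * (𝓕 F : LineL2) ξ * Complex.I_sq

/-! ### Summation over the frequencies -/

/-- The initial data, indexed like the unknowns. -/
def datum (bin : Dom → ℝ) (uin : Fin 3 → Dom → ℝ) : Option (Fin 3) → Dom → ℝ
  | none => bin
  | some i => uin i

lemma enorm_fourier_sq (F : LineL2) : ‖F‖ₑ ^ 2 = ∫⁻ ξ, ‖(𝓕 F : LineL2) ξ‖ₑ ^ 2 := by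
  have h : ‖(𝓕 F : LineL2)‖ₑ = ‖F‖ₑ := by
    rw [← ofReal_norm, ← ofReal_norm, Lp.norm_fourier_eq]
  rw [← h, Lp.enorm_def, eLpNorm_two_sq]

lemma enorm_sq_eq_ofReal (z : ℂ) : ‖z‖ₑ ^ 2 = ENNReal.ofReal (‖z‖ ^ 2) := by
  rw [← ofReal_norm, ENNReal.ofReal_pow (norm_nonneg z)]

lemma gain_pos {ρ : ℝ} (hρ : 0 < ρ) (o : Option (Fin 3)) : 0 < gain ρ o := by
  rcases o with _ | i
  · exact hρ
  · simp only [gain]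
    split_ifs
    exacts [hρ, one_pos]

lemma lineCoef_unknown_zero {ε μ lam : ℝ} {bin : Dom → ℝ} {uin : Fin 3 → Dom → ℝ} {b : ℝ → L2}
    {u : ℝ → Fin 3 → L2} (hs : IsSolution ε μ lam bin uin b u) (k l : ℤ) (e : Option (Fin 3)) :
    lineCoef k l (unknown b u e 0) = lineCoef k l (datum bin uin e) := by
  rcases e with _ | i
  · exact lineCoef_congr (Lp.memLp _) hs.initial_b k l
  · exact lineCoef_congr (Lp.memLp _) (hs.initial_u i) k l

/-- The estimate for a pair of frequencies in `(x, z)`. -/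
theorem exists_lineCoef_le (ε : ℝ) (hε : 0 < ε) : ∃ C : ℝ, 0 ≤ C ∧ ∀ (ρ lam : ℝ)
    (bin : Dom → ℝ) (uin : Fin 3 → Dom → ℝ) (b : ℝ → L2) (u : ℝ → Fin 3 → L2),
    Admissible ε ρ (lam + 2 * ρ ^ 3) → IsSolution ε (ρ ^ 3) lam bin uin b u →
    (∀ e, MemH2 (datum bin uin e)) → ∀ k l : ℤ, k ≠ 0 → ∀ T, 0 ≤ T → ∀ o,
      ‖lineCoef k l (unknown b u o T)‖ₑ ^ 2 ≤
        ENNReal.ofReal (C * Real.exp (-(3 / 10 * ρ * T)) / gain ρ o) *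
          ∑ e, ‖lineCoef k l (weakLaplacian (datum bin uin e))‖ₑ ^ 2 := by
  obtain ⟨C, hC, hmain⟩ := exists_frequency_le ε hε
  refine ⟨C, hC, fun ρ lam bin uin b u hp hs hd k l hk T hT o => ?_⟩
  have hg := gain_pos hp.ρ_pos o
  have h1 : ‖lineCoef k l (unknown b u o T)‖ₑ = ‖frame k l b u o T‖ₑ := by
    rw [frame_of_nonneg k l b u o hT, ← ofReal_norm, ← ofReal_norm, LinearIsometry.norm_map]
  rw [h1, enorm_fourier_sq]
  have h2 : ∀ᵐ ξ : ℝ, ‖(𝓕 (frame k l b u o T) : LineL2) ξ‖ₑ ^ 2 ≤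
      ENNReal.ofReal (C * Real.exp (-(3 / 10 * ρ * T)) / gain ρ o) *
        ∑ e, ‖(𝓕 (lineCoef k l (weakLaplacian (datum bin uin e))) : LineL2) ξ‖ₑ ^ 2 := by
    filter_upwards [hmain ρ lam bin uin b u hp hs k l hk T hT,
      ae_all_iff.2 fun e => (hd e).fourier_weakLaplacian k l] with ξ a1 a2
    have a3 := a1 o
    have a4 : (k ^ 2 + l ^ 2 + (2 * Real.pi * ξ) ^ 2) ^ 2 *
        ∑ e, ‖(𝓕 (lineCoef k l (unknown b u e 0)) : LineL2) ξ‖ ^ 2 =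
        ∑ e, ‖(𝓕 (lineCoef k l (weakLaplacian (datum bin uin e))) : LineL2) ξ‖ ^ 2 := by
      rw [Finset.mul_sum]
      refine Finset.sum_congr rfl fun e _ => ?_
      rw [a2 e, lineCoef_unknown_zero hs, norm_mul, norm_neg, Complex.norm_real, Real.norm_eq_abs,
        mul_pow |_|, sq_abs]
    rw [a4] at a3
    simp only [enorm_sq_eq_ofReal]
    rw [← ENNReal.ofReal_sum_of_nonneg fun e _ => sq_nonneg _,
      ← ENNReal.ofReal_mul (div_nonneg (mul_nonneg hC (Real.exp_pos _).le) hg.le)]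
    refine ENNReal.ofReal_le_ofReal ?_
    rw [div_mul_eq_mul_div, le_div_iff₀ hg]
    linarith
  refine (lintegral_mono_ae h2).trans_eq ?_
  rw [lintegral_const_mul' _ _ ENNReal.ofReal_ne_top, lintegral_finsetSum']
  · simp only [enorm_fourier_sq]
  · exact fun e _ => ((Lp.aestronglyMeasurable _).enorm).pow_const 2

lemma dataNorm_sq (bin : Dom → ℝ) (uin : Fin 3 → Dom → ℝ) :
    dataNorm bin uin ^ 2 = ∑ e, l2norm (nonzeroMode (weakLaplacian (datum bin uin e))) ^ 2 := by
  rw [dataNorm, ← ENNReal.rpow_natCast, ← ENNReal.rpow_mul]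
  norm_num
  rfl

/-- The estimate of the theorem, in terms of `ρ = μ^{1/3}` and for any admissible bound `A`. -/
theorem exists_l2norm_le (ε : ℝ) (hε : 0 < ε) : ∃ C : ℝ, 0 ≤ C ∧ ∀ (ρ lam : ℝ)
    (bin : Dom → ℝ) (uin : Fin 3 → Dom → ℝ) (b : ℝ → L2) (u : ℝ → Fin 3 → L2),
    Admissible ε ρ (lam + 2 * ρ ^ 3) → IsSolution ε (ρ ^ 3) lam bin uin b u →
    (∀ e, MemH2 (datum bin uin e)) → ∀ T, 0 ≤ T → ∀ o, ∀ A : ℝ, 0 ≤ A →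
      C * Real.exp (-(3 / 10 * ρ * T)) ≤ gain ρ o * A ^ 2 →
      l2norm (nonzeroMode (unknown b u o T)) ≤ ENNReal.ofReal A * dataNorm bin uin := by
  obtain ⟨C, hC, hmain⟩ := exists_lineCoef_le ε hε
  refine ⟨C, hC, fun ρ lam bin uin b u hp hs hd T hT o A hA hCA => ?_⟩
  have hg := gain_pos hp.ρ_pos o
  set K := ENNReal.ofReal A ^ 2 with hK
  have hK1 : ENNReal.ofReal (C * Real.exp (-(3 / 10 * ρ * T)) / gain ρ o) ≤ K := by
    rw [hK, ← ENNReal.ofReal_pow hA]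
    refine ENNReal.ofReal_le_ofReal ?_
    rw [div_le_iff₀ hg]
    linarith
  have hπ : ENNReal.ofReal (2 * Real.pi) ^ 2 ≠ 0 :=
    pow_ne_zero _ (ENNReal.ofReal_pos.2 Real.two_pi_pos).ne'
  have hπ' : ENNReal.ofReal (2 * Real.pi) ^ 2 ≠ ⊤ := ENNReal.pow_ne_top ENNReal.ofReal_ne_top
  rw [← ENNReal.pow_le_pow_left_iff two_ne_zero, mul_pow, ← hK, dataNorm_sq,
    ← ENNReal.mul_le_mul_iff_right hπ hπ', mul_left_comm, Finset.mul_sum,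
    l2norm_nonzeroMode_sq (Lp.memLp _)]
  simp only [l2norm_nonzeroMode_sq (hd _).memLp_weakLaplacian,
    ← enorm_lineCoef_sq (hd _).memLp_weakLaplacian, ← enorm_lineCoef_sq (Lp.memLp _)]
  have hsum : ∀ g : Option (Fin 3) → ℤ → ℤ → ℝ≥0∞,
      ∑ e, ∑' k, ∑' l, g e k l = ∑' k, ∑' l, ∑ e, g e k l := fun g => by
    rw [← Summable.tsum_finsetSum fun e _ => ENNReal.summable]
    exact tsum_congr fun k => (Summable.tsum_finsetSum fun e _ => ENNReal.summable).symm
  rw [hsum, ← ENNReal.tsum_mul_left]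
  refine ENNReal.tsum_le_tsum fun k => ?_
  rw [← ENNReal.tsum_mul_left]
  refine ENNReal.tsum_le_tsum fun l => ?_
  by_cases hk : k = 0
  · simp [hk]
  · simp only [hk, if_false]
    exact (hmain ρ lam bin uin b u hp hs hd k l hk T hT o).trans (mul_le_mul_left hK1 _)

end Couette

end

theorem theorem1p1 (ε : ℝ) (hε : 0 < ε) :
    ∃ C₁ : ℝ, 0 < C₁ ∧
      ∀ μ lam : ℝ, 0 < μ → 0 ≤ 2 * μ + 3 * lam → lam + 2 * μ ≤ 1 →
        μ ^ (1 / 3 : ℝ) * ε ≤ 1 / 4 →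
        μ ^ (1 / 3 : ℝ) * (lam + 2 * μ) * ε ^ 2 ≤ 1 →
      ∀ (bin : Couette.Dom → ℝ) (uin : Fin 3 → Couette.Dom → ℝ),
        Couette.MemH2 bin → (∀ i, Couette.MemH2 (uin i)) →
      ∀ (b : ℝ → Couette.L2) (u : ℝ → Fin 3 → Couette.L2),
        Couette.IsSolution ε μ lam bin uin b u →
      ∀ t : ℝ, 0 ≤ t →
        Couette.l2norm (Couette.nonzeroMode (b t)) ≤
            ENNReal.ofReal (C₁ * μ ^ (-(1 / 6) : ℝ) * Real.exp (-(μ ^ (1 / 3 : ℝ) * t / 44))) *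
              Couette.dataNorm bin uin ∧
        Couette.l2norm (Couette.nonzeroMode (u t 0)) ≤
            ENNReal.ofReal (C₁ * Real.exp (-(μ ^ (1 / 3 : ℝ) * t / 88))) *
              Couette.dataNorm bin uin ∧
        Couette.l2norm (Couette.nonzeroMode (u t 1)) ≤
            ENNReal.ofReal (C₁ * μ ^ (-(1 / 3) : ℝ) * Real.exp (-(μ ^ (1 / 3 : ℝ) * t / 88))) *
              Couette.dataNorm bin uin ∧
        Couette.l2norm (Couette.nonzeroMode (u t 2)) ≤
            ENNReal.ofReal (C₁ * Real.exp (-(μ ^ (1 / 3 : ℝ) * t / 44))) *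
              Couette.dataNorm bin uin := by
  obtain ⟨C, hC, hmain⟩ := Couette.exists_l2norm_le ε hε
  refine ⟨C + 1, by linarith, fun μ lam hμ h1 h2 h3 h4 bin uin hb hu b u hs t ht => ?_⟩
  set ρ := μ ^ (1 / 3 : ℝ) with hρ
  have hρ0 : 0 < ρ := Real.rpow_pos_of_pos hμ _
  have hρμ : ρ ^ 3 = μ := by
    rw [hρ, ← Real.rpow_natCast, ← Real.rpow_mul hμ.le]
    norm_num
  -- the two conditions on the viscosities give `4 μ / 3 ≤ lam + 2 μ ≤ 1`
  have hρ1 : ρ ≤ 1 := Real.rpow_le_one hμ.le (by linarith) (by norm_num)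
  have hp : Couette.Admissible ε ρ (lam + 2 * ρ ^ 3) := by
    rw [hρμ]
    exact ⟨hε, hρ0, hρ1, h3, by rw [hρμ]; linarith, h2, h4⟩
  have h6 : (μ ^ (-(1 / 6) : ℝ)) ^ 2 = ρ⁻¹ := by
    rw [hρ, ← Real.rpow_natCast, ← Real.rpow_mul hμ.le, ← Real.rpow_neg hμ.le]
    norm_num
  have h5 : μ ^ (-(1 / 3) : ℝ) = ρ⁻¹ := by rw [hρ, ← Real.rpow_neg hμ.le]
  have hρt : 0 ≤ ρ * t := by positivity
  have hinv : 1 ≤ ρ⁻¹ := (one_le_inv₀ hρ0).2 hρ1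
  -- a constant `c` with `1 ≤ gain * c²` and a rate at most `3 / 20` are allowed
  have hA : ∀ (o : Option (Fin 3)) (c r : ℝ), 1 ≤ Couette.gain ρ o * c ^ 2 → r ≤ 3 / 20 * (ρ * t) →
      C * Real.exp (-(3 / 10 * ρ * t)) ≤ Couette.gain ρ o * ((C + 1) * c * Real.exp (-r)) ^ 2 :=
    fun o c r hc hr => by
      have e1 : Real.exp (-(3 / 10 * ρ * t)) ≤ Real.exp (-r) ^ 2 := by
        rw [← Real.exp_nat_mul]
        refine Real.exp_le_exp.2 ?_
        push_cast
        linarith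
      have e2 : C ≤ (C + 1) ^ 2 := by nlinarith
      calc C * Real.exp (-(3 / 10 * ρ * t)) ≤ (C + 1) ^ 2 * Real.exp (-r) ^ 2 := by gcongr
        _ = 1 * ((C + 1) ^ 2 * Real.exp (-r) ^ 2) := (one_mul _).symm
        _ ≤ (Couette.gain ρ o * c ^ 2) * ((C + 1) ^ 2 * Real.exp (-r) ^ 2) := by gcongr
        _ = _ := by ring
  have hfin := hmain ρ lam bin uin b u hp (by rw [hρμ]; exact hs)
    (fun e => by rcases e with _ | i; exacts [hb, hu i]) t ht
  have hpos : ∀ c r : ℝ, 0 ≤ c → 0 ≤ (C + 1) * c * Real.exp (-r) := fun c r hc => by positivity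
  have hμ6 : (0 : ℝ) ≤ μ ^ (-(1 / 6) : ℝ) := (Real.rpow_pos_of_pos hμ _).le
  refine ⟨?_, ?_, ?_, ?_⟩
  · exact hfin none _ (hpos _ _ hμ6) (hA none _ _ (by
      rw [h6, Couette.gain, mul_inv_cancel₀ hρ0.ne']) (by linarith))
  · have := hfin (some 0) _ (hpos 1 _ zero_le_one) (hA (some 0) 1 (ρ * t / 88)
      (by simp [Couette.gain]) (by linarith))
    rwa [mul_one] at this
  · rw [h5]
    exact hfin (some 1) _ (hpos _ _ (by positivity)) (hA (some 1) _ _ (by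
      rw [Couette.gain, if_pos rfl, pow_two, ← mul_assoc, mul_inv_cancel₀ hρ0.ne', one_mul]
      exact hinv) (by linarith))
  · have := hfin (some 2) _ (hpos 1 _ zero_le_one) (hA (some 2) 1 (ρ * t / 44)
      (by simp [Couette.gain]) (by linarith))
    rwa [mul_one] at this
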